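/- **Monomials.** Let $N\ge 1$, $p\ge 0$, and let $A_1,\dots,A_p$ be complex $N\times N$ matrices. A monomial is a word in the letters $u,u^{*},a_i,a_i^{*}$ ($1\le i\le p$), with no relation between the letters. Its degree is its number of letters $u$ and $u^{*}$. Words in the letters $a_i,a_i^{*}$ only are evaluated at $A_i,A_i^{*}$, and $\operatorname{tr}=\frac1N\operatorname{Tr}$. **Maps of unitary type.** Let $I$ be a finite totally ordered set. A map of unitary type with labels in $I$ and $r\ge 0$ black vertices is an oriented map (an oriented graph embedded in a compact oriented surface with all faces discs, up to isomorphism; combinatorially, a rotation $\sigma$ around the vertices and an involution $\alpha$ pairing outgoing with ingoing half-edges) with white and black vertices such that * there are $r$ black vertices, numbered $1,\dots,r$, each of degree $4$ with half-edges alternately ingoing and outgoing; * the half-edges at white vertices (white half-edges) are labelled bijectively by $I$; * an edge oriented from the black vertex $k$ to the black vertex $k'$ satisfies $k<k'$. Isomorphisms preserve labels and numbers. The label of a half-edge at a black vertex is that of the first white half-edge met when turning clockwise around the face to its left. The value of a black vertex is the larger label of its two outgoing half-edges. The map is nondecreasing if the values of the black vertices $1,\dots,r$ form a nondecreasing sequence.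 For such a map $\mathcal C$, let $\epsilon_{\mathcal C}(i)=+1$ (resp. $-1$) if the white half-edge $i$ is outgoing (resp. ingoing). Let $\rho_{\mathcal C}\in\mathfrak S(I)$ send $i$ to the next half-edge counterclockwise around its white vertex, and let $\phi_{\mathcal C}\in\mathfrak S(I)$ send $i$ to the next white half-edge with the same face to its left, counterclockwise around this face. The genus $g$ of a connected map is given by $2-2g=\#\text{vertices}-\#\text{edges}+\#\text{faces}$. **Sums of maps.** Let $\bm P=(P_1,\dots,P_l)$ be monomials of degrees $d_1,\dots,d_l\ge 1$ and $d=\sum_i d_i$. After moving the letters of $P_i$ that follow its last $u^{\pm1}$ to the front (where $u^{-1}=u^{*}$), write $P_i=M_{i,1}u^{\epsilon_{i,1}}\cdots M_{i,d_i}u^{\epsilon_{i,d_i}}$ with $M_{i,j}$ words in the $a_k,a_k^{*}$. Let $(M_k)_{k\in[d]}$ and $\epsilon_{\bm P}=(\epsilon_k)_{k\in[d]}$ be the concatenations of the $M_{i,j}$ and of the $\epsilon_{i,j}$, and let $\gamma_{\bm P}=(1,\dots,d_1)(d_1+1,\dots,d_1+d_2)\cdots$. Set, with $m=d/2$, $$\mathcal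 M^{(g),N}_{0,l}(P_1,\dots,P_l)=(-1)^{m+l}\sum_{\mathcal C}(-1)^{c(\phi_{\mathcal C})}\operatorname{tr}_{\phi_{\mathcal C}}(M_1,\dots,M_d),$$ where $\mathcal C$ runs over the connected nondecreasing maps of unitary type of genus $g$, with labels in $[d]$ and any number of black vertices, such that $\epsilon_{\mathcal C}=\epsilon_{\bm P}$ and $\rho_{\mathcal C}=\gamma_{\bm P}^{-1}$ (there are finitely many, and none if $d$ is odd). Here $c(\phi)$ is the number of cycles of $\phi$, and $\operatorname{tr}_\phi$ is the product over the cycles $(i_1,\dots,i_k)$ of $\phi$ of $\operatorname{tr}(M_{i_1}\cdots M_{i_k})$. If some $P_i$ has degree $0$, set $\mathcal M^{(0),N}_{0,1}(P_1)=\operatorname{tr}(P_1)$ when $l=1$ and $g=0$, and $\mathcal M^{(g),N}_{0,l}(P_1,\dots,P_l)=0$ otherwise. Finally $\mathcal M^{(-1),N}_{0,l}=0$ and $\mathcal M^{(g),N}_{0,0}=0$. **Theorem.** Let $l\ge 1$, $g\ge 0$, and let $P_1,\dots,P_l$ be monomials such that $\frac12\big(\sum_{i=1}^{l}\deg P_i+1\big)\ge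 2$. Then $$\begin{aligned} \mathcal{M}^{(g), N}_{0, l}(P_{1}, \dots,P_{l-1}, P_{l}u) = &-\sum_{P_{l} = QuR}\Big[\mathcal{M}^{(g-1), N}_{0, l+1}(P_{1}, \dots, P_{l-1}, Qu, Ru) + \sum_{\substack{g_{1}+g_{2}=g\\I\subseteq [l-1]}}\mathcal{M}^{(g_{1}), N}_{0, |I|+1}(\bm{P}|_{I}, Qu)\,\mathcal{M}^{(g_{2}), N}_{0, l-|I|}(\bm{P}|_{I^{c}}, Ru)\Big]\\ &- \sum_{j=1}^{l-1}\sum_{P_{j}=QuR}\mathcal{M}^{(g), N}_{0, l-1}(P_{1}, \dots, P_{j-1}, P_{j+1}, \dots, P_{l-1}, RQuP_{l}u)\\ &+\sum_{P_{l} = Qu^{*}R}\Big[\mathcal{M}^{(g-1), N}_{0, l+1}(P_{1}, \dots, P_{l-1}, Q, R) + \sum_{\substack{g_{1}+g_{2}=g\\I\subseteq [l-1]}}\mathcal{M}^{(g_{1}), N}_{0, |I|+1}(\bm{P}|_{I}, Q)\,\mathcal{M}^{(g_{2}), N}_{0, l-|I|}(\bm{P}|_{I^{c}}, R)\Big]\\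 &+ \sum_{j=1}^{l-1}\sum_{P_{j}=Qu^{*}R}\mathcal{M}^{(g), N}_{0, l-1}(P_{1}, \dots, P_{j-1}, P_{j+1}, \dots, P_{l-1}, RQP_{l}), \end{aligned}$$ where $g_1,g_2\ge 0$, $I^{c}=[l-1]\setminus I$, $\bm{P}|_{I}=(P_i)_{i\in I}$, and the sums over $P=QuR$ (resp. $P=Qu^{*}R$) run over all occurrences of the letter $u$ (resp. $u^{*}$) in the word $P$. -/

import Mathlib

noncomputable section

/-! ## Permutations -/

/-- The number `c(f)` of cycles of a permutation, fixed points included. -/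
def numCycles {A : Type*} (f : Equiv.Perm A) : ℕ :=
  Nat.card (Quotient (Equiv.Perm.SameCycle.setoid f))

section FirstReturn

variable {A I : Type*} [Finite A]

theorem exists_return (f : Equiv.Perm A) (e : I ↪ A) (i : I) :
    ∃ n : ℕ, (f ^ (n + 1)) (e i) ∈ Set.range e := by
  refine ⟨orderOf f - 1, i, ?_⟩
  have h : orderOf f - 1 + 1 = orderOf f := Nat.sub_add_cancel (orderOf_pos f)
  rw [h, pow_orderOf_eq_one]
  rfl

open Classical in
/-- One less than the first time `n ≥ 1` at which `f ^ n` brings `e i` back to the range of `e`. -/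
def returnTime (f : Equiv.Perm A) (e : I ↪ A) (i : I) : ℕ :=
  Nat.find (exists_return f e i)

open Classical in
theorem returnTime_spec (f : Equiv.Perm A) (e : I ↪ A) (i : I) :
    ∃ j : I, e j = (f ^ (returnTime f e i + 1)) (e i) :=
  Nat.find_spec (exists_return f e i)

/-- The first element of `I` met after `i` when following `f`. -/
def firstReturn (f : Equiv.Perm A) (e : I ↪ A) (i : I) : I :=
  (returnTime_spec f e i).choose

theorem firstReturn_spec (f : Equiv.Perm A) (e : I ↪ A) (i : I) :
    e (firstReturn f e i) = (f ^ (returnTime f e i + 1)) (e i) :=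
  (returnTime_spec f e i).choose_spec

open Classical in
theorem firstReturn_inv_firstReturn (f : Equiv.Perm A) (e : I ↪ A) (i : I) :
    firstReturn f⁻¹ e (firstReturn f e i) = i := by
  have key : ∀ k, k ≤ returnTime f e i →
      (f⁻¹ ^ (k + 1)) (e (firstReturn f e i)) = (f ^ (returnTime f e i - k)) (e i) := by
    intro k hk
    have h : returnTime f e i + 1 = (k + 1) + (returnTime f e i - k) := by omega
    rw [firstReturn_spec, inv_pow, Equiv.Perm.inv_eq_iff_eq, ← Equiv.Perm.mul_apply, ← pow_add, ← h]
  have ht : returnTime f⁻¹ e (firstReturn f e i) = returnTime f e i := by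
    refine (Nat.find_eq_iff _).2 ⟨⟨i, ?_⟩, ?_⟩
    · rw [key _ le_rfl]; simp
    · intro k hk
      rw [key k hk.le]
      have h : returnTime f e i - k = (returnTime f e i - k - 1) + 1 := by omega
      rw [h]
      exact Nat.find_min (exists_return f e i)
        (show returnTime f e i - k - 1 < returnTime f e i by omega)
  apply e.injective
  rw [firstReturn_spec, ht, key _ le_rfl]
  simp

/-- The permutation induced by `f` on a subset `I` of `A` (embedded by `e`):
`i` is sent to the first of `f i, f² i, …` that lies in `I`. -/
def inducedPerm (f : Equiv.Perm A) (e : I ↪ A) : Equiv.Perm I where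
  toFun := firstReturn f e
  invFun := firstReturn f⁻¹ e
  left_inv := firstReturn_inv_firstReturn f e
  right_inv := fun i => by
    have h := firstReturn_inv_firstReturn f⁻¹ e i
    rwa [inv_inv] at h

end FirstReturn

/-! ## Oriented maps -/

/-- An oriented map (a graph embedded in an oriented compact surface, possibly disconnected, such
that the complement is a union of discs, up to homeomorphism), given by its set `H` of half-edges,
the counterclockwise rotation `σ` around the vertices, the involution `α` which
exchanges the two halves of each edge, and the orientation `ε` of the half-edges,
`1` for outgoing and `-1` for ingoing ones. -/
structure OrientedMap (H : Type*) where
  σ : Equiv.Perm H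
  α : Equiv.Perm H
  ε : H → ℤˣ
  α_α : ∀ h, α (α h) = h
  ε_α : ∀ h, ε (α h) = -ε h

namespace OrientedMap

variable {H : Type*} (C : OrientedMap H)

/-- The face permutation: each half-edge is sent to the next half-edge which has the same face to
its left, in counterclockwise order around this face. It satisfies `φ α σ = 1`. -/
def φ : Equiv.Perm H := (C.α * C.σ)⁻¹

def numVertices : ℕ := numCycles C.σ

def numEdges : ℕ := numCycles C.α

def numFaces : ℕ := numCycles C.φ

/-- The number of connected components. -/
def numComponents : ℕ :=
  Nat.card (MulAction.orbitRel.Quotient (Subgroup.closure {C.σ, C.α}) H)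

def Connected : Prop := C.numComponents = 1

/-- The surface has genus `g`, the genus being read off Euler's formula. -/
def HasGenus (g : ℤ) : Prop :=
  2 * (C.numComponents : ℤ) - 2 * g = C.numVertices - C.numEdges + C.numFaces

end OrientedMap

/-! ## Maps of unitary type -/

/-- A map of unitary type with labels in `I` and `r` black vertices. A half-edge attached to a white
vertex is denoted by its label `i : I`, and the four half-edges of the black vertex with number
`k` are denoted by `(k, c)`, with `c : ZMod 4` increasing counterclockwise. -/
structure UnitaryMap (I : Type*) (r : ℕ) extends OrientedMap (I ⊕ Fin r × ZMod 4) where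
  /-- black vertices have degree four -/
  σ_black : ∀ k c, σ (Sum.inr (k, c)) = Sum.inr (k, c + 1)
  /-- black vertices are alternated -/
  alternated : ∀ k c, ε (Sum.inr (k, c + 1)) = -ε (Sum.inr (k, c))
  /-- an edge from the black vertex `k` to the black vertex `k'` satisfies `k < k'` -/
  increasing : ∀ k c k' c', ε (Sum.inr (k, c)) = 1 →
    α (Sum.inr (k, c)) = Sum.inr (k', c') → k < k'

namespace UnitaryMap

variable {I : Type*} {r : ℕ} (C : UnitaryMap I r)

/-- The orientations of the white half-edges. -/
def whiteε (i : I) : ℤˣ := C.ε (Sum.inl i)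

/-- The rotation around the white vertices. -/
def whiteρ [Finite I] : Equiv.Perm I := inducedPerm C.σ Function.Embedding.inl

/-- The next white half-edge with the same face to its left, counterclockwise around
the face. -/
def whiteφ [Finite I] : Equiv.Perm I := inducedPerm C.φ Function.Embedding.inl

theorem φ_inv_apply (h : I ⊕ Fin r × ZMod 4) : C.φ⁻¹ h = C.α (C.σ h) := by
  simp [OrientedMap.φ]

theorem exists_white_aux (n : ℕ) (k : Fin r) (c : ZMod 4) :
    (C.ε (Sum.inr (k, c)) = 1 → k.val ≤ n → ∃ n, ((C.φ⁻¹ ^ n) (Sum.inr (k, c))).isLeft) ∧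
    (C.ε (Sum.inr (k, c)) = -1 → r ≤ k.val + n →
      ∃ n, ((C.φ⁻¹ ^ n) (Sum.inr (k, c))).isLeft) := by
  induction n generalizing k c with
  | zero =>
    refine ⟨fun he hk => ⟨1, ?_⟩, fun _ hk => absurd k.isLt (by omega)⟩
    rw [pow_one, φ_inv_apply, C.σ_black]
    rcases hx : C.α (Sum.inr (k, c + 1)) with i | ⟨k', c'⟩
    · rfl
    · have h1 : C.ε (Sum.inr (k', c')) = 1 := by
        rw [← hx, C.ε_α, C.alternated, he, neg_neg]
      have h2 := C.increasing k' c' k (c + 1) h1 (by rw [← hx, C.α_α])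
      exact absurd (Fin.lt_def.1 h2) (by omega)
  | succ n ih =>
    refine ⟨fun he hk => ?_, fun he hk => ?_⟩
    · rcases hx : C.α (Sum.inr (k, c + 1)) with i | ⟨k', c'⟩
      · exact ⟨1, by rw [pow_one, φ_inv_apply, C.σ_black, hx]; rfl⟩
      · have h1 : C.ε (Sum.inr (k', c')) = 1 := by
          rw [← hx, C.ε_α, C.alternated, he, neg_neg]
        have h2 := Fin.lt_def.1 (C.increasing k' c' k (c + 1) h1 (by rw [← hx, C.α_α]))
        obtain ⟨m, hm⟩ := (ih k' c').1 h1 (by omega)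
        exact ⟨m + 1, by
          rwa [pow_succ, Equiv.Perm.mul_apply, φ_inv_apply, C.σ_black, hx]⟩
    · rcases hx : C.α (Sum.inr (k, c + 1)) with i | ⟨k', c'⟩
      · exact ⟨1, by rw [pow_one, φ_inv_apply, C.σ_black, hx]; rfl⟩
      · have h1 : C.ε (Sum.inr (k', c')) = -1 := by
          rw [← hx, C.ε_α, C.alternated, he, neg_neg]
        have h2 := Fin.lt_def.1
          (C.increasing k (c + 1) k' c' (by rw [C.alternated, he, neg_neg]) hx)
        obtain ⟨m, hm⟩ := (ih k' c').2 h1 (by omega)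
        exact ⟨m + 1, by
          rwa [pow_succ, Equiv.Perm.mul_apply, φ_inv_apply, C.σ_black, hx]⟩

/-- Each face is incident to a white vertex. -/
theorem exists_white (h : I ⊕ Fin r × ZMod 4) : ∃ n : ℕ, ((C.φ⁻¹ ^ n) h).isLeft := by
  rcases h with i | ⟨k, c⟩
  · exact ⟨0, rfl⟩
  · rcases Int.units_eq_one_or (C.ε (Sum.inr (k, c))) with he | he
    · exact (C.exists_white_aux k.val k c).1 he le_rfl
    · exact (C.exists_white_aux r k c).2 he (by omega)

/-- The label of a half-edge `h`: starting from `h`, turn clockwise around the face to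
the left of `h` and take the label of the first white half-edge that is met. -/
def label (h : I ⊕ Fin r × ZMod 4) : I :=
  ((C.φ⁻¹ ^ Nat.find (C.exists_white h)) h).getLeft (Nat.find_spec (C.exists_white h))

/-- The value of a black vertex: the largest label of its outgoing half-edges. -/
def value [LinearOrder I] (k : Fin r) : WithBot I :=
  ((Finset.univ.filter fun c : ZMod 4 => C.ε (Sum.inr (k, c)) = 1).image
    fun c => C.label (Sum.inr (k, c))).max

/-- The values of the black vertices, in the order of their numbers, are nondecreasing. -/
def Nondecreasing [LinearOrder I] : Prop := Monotone C.value

/-- Isomorphism of maps of unitary type: a bijection between the half-edges which respects the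
structure, the labels of the white half-edges and the numbers of the black vertices. -/
def Iso (C C' : UnitaryMap I r) : Prop :=
  ∃ θ : Equiv.Perm (I ⊕ Fin r × ZMod 4),
    (∀ i, θ (Sum.inl i) = Sum.inl i) ∧
    (∀ k c, ∃ c', θ (Sum.inr (k, c)) = Sum.inr (k, c')) ∧
    (∀ h, θ (C.σ h) = C'.σ (θ h)) ∧
    (∀ h, θ (C.α h) = C'.α (θ h)) ∧
    (∀ h, C.ε h = C'.ε (θ h))

theorem iso_equivalence : Equivalence (Iso (I := I) (r := r)) where
  refl C := ⟨1, fun _ => rfl, fun _ c => ⟨c, rfl⟩, fun _ => rfl, fun _ => rfl, fun _ => rfl⟩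
  symm := by
    rintro C C' ⟨θ, h1, h2, h3, h4, h5⟩
    refine ⟨θ⁻¹, fun i => ?_, fun k c => ?_, fun h => ?_, fun h => ?_, fun h => ?_⟩
    · rw [Equiv.Perm.inv_eq_iff_eq, h1]
    · rcases hx : θ⁻¹ (Sum.inr (k, c)) with i | ⟨k', c'⟩
      · rw [Equiv.Perm.inv_eq_iff_eq, h1] at hx
        exact absurd hx (by simp)
      · rw [Equiv.Perm.inv_eq_iff_eq] at hx
        obtain ⟨d, hd⟩ := h2 k' c'
        rw [hd] at hx
        simp only [Sum.inr.injEq, Prod.mk.injEq] at hx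
        exact ⟨c', by rw [hx.1]⟩
    · rw [Equiv.Perm.inv_eq_iff_eq, h3]; simp
    · rw [Equiv.Perm.inv_eq_iff_eq, h4]; simp
    · rw [h5]; simp
  trans := by
    rintro C C' C'' ⟨θ, h1, h2, h3, h4, h5⟩ ⟨η, k1, k2, k3, k4, k5⟩
    refine ⟨η * θ, fun i => ?_, fun k c => ?_, fun h => ?_, fun h => ?_, fun h => ?_⟩
    · simp [h1, k1]
    · obtain ⟨c', hc'⟩ := h2 k c
      obtain ⟨c'', hc''⟩ := k2 k c'
      exact ⟨c'', by rw [Equiv.Perm.mul_apply, hc', hc'']⟩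
    · simp [h3, k3]
    · simp [h4, k4]
    · rw [h5, k5]; rfl

end UnitaryMap

def unitaryMapSetoid (I : Type*) (r : ℕ) : Setoid (UnitaryMap I r) :=
  ⟨UnitaryMap.Iso, UnitaryMap.iso_equivalence⟩

/-- Isomorphism classes of maps of unitary type with labels in `I`, with any number of
black vertices. -/
abbrev UnitaryMapClass (I : Type*) : Type _ :=
  Σ r : ℕ, Quotient (unitaryMapSetoid I r)

/-- A representative of an isomorphism class. -/
def UnitaryMapClass.rep {I : Type*} (C : UnitaryMapClass I) : UnitaryMap I C.1 :=
  Quotient.out C.2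

/-- The connected nondecreasing maps of unitary type of genus `g` with labels in `I`, with
orientations `ε` of the white half-edges and rotation `ρ` around the white vertices. -/
def connectedMaps {I : Type*} [LinearOrder I] [Finite I] (g : ℤ) (ε : I → ℤˣ)
    (ρ : Equiv.Perm I) : Set (UnitaryMapClass I) :=
  {C | C.rep.Nondecreasing ∧ C.rep.Connected ∧ C.rep.HasGenus g ∧
    C.rep.whiteε = ε ∧ C.rep.whiteρ = ρ}

/-! ## Monomials -/

/-- The letters `u`, `u* = u⁻¹`, `a_i`, `a_i*`. -/
inductive Letter (p : ℕ) where
  | u : Letter p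
  | us : Letter p
  | a (i : Fin p) : Letter p
  | as (i : Fin p) : Letter p
  deriving DecidableEq

/-- Monomials are words in the letters; there is no relation between the letters. -/
abbrev Word (p : ℕ) := List (Letter p)

namespace Word

variable {p N : ℕ}

/-- The number of letters `u` and `u*`. -/
def degree (w : Word p) : ℕ := w.count Letter.u + w.count Letter.us

/-- For `w = M₁ u^ε₁ ⋯ M_d u^ε_d T` with `M₁, …, M_d, T` words in the letters `a_i, a_i*` only,
`parse M w` is the list of the `(M M₁, ε₁), (M₂, ε₂), …, (M_d, ε_d)`, together with
the word `T` (or `M T` if `d = 0`). -/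
def parse : Word p → Word p → List (Word p × ℤˣ) × Word p
  | M, [] => ([], M)
  | M, Letter.u :: w => ((M, 1) :: (parse [] w).1, (parse [] w).2)
  | M, Letter.us :: w => ((M, -1) :: (parse [] w).1, (parse [] w).2)
  | M, Letter.a i :: w => parse (M ++ [Letter.a i]) w
  | M, Letter.as i :: w => parse (M ++ [Letter.as i]) w

/-- The factors `(M₁, ε₁), …, (M_d, ε_d)` of a monomial `M₁ u^ε₁ ⋯ M_d u^ε_d`. A monomial
`M₁ u^ε₁ ⋯ M_d u^ε_d T` is replaced by `T M₁ u^ε₁ ⋯ M_d u^ε_d`. -/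
def blocks (w : Word p) : List (Word p × ℤˣ) := (parse (parse [] w).2 w).1

theorem length_parse (M w : Word p) : (parse M w).1.length = w.degree := by
  induction w generalizing M with
  | nil => rfl
  | cons x w ih => cases x <;> simp [parse, ih, degree] <;> omega

theorem length_blocks (w : Word p) : w.blocks.length = w.degree := length_parse _ _

/-- The value of a letter; the letters `u`, `u*` do not occur where this is used. -/
def evalLetter (A : Fin p → Matrix (Fin N) (Fin N) ℂ) : Letter p → Matrix (Fin N) (Fin N) ℂ
  | Letter.u => 1
  | Letter.us => 1
  | Letter.a i => A i
  | Letter.as i => (A i).conjTranspose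

/-- The value at the matrices `A_i`, `A_i*` of a word in the letters `a_i, a_i*` only. -/
def eval (A : Fin p → Matrix (Fin N) (Fin N) ℂ) (w : Word p) : Matrix (Fin N) (Fin N) ℂ :=
  (w.map (evalLetter A)).prod

/-- The pairs `(Q, R)` with `w = Q x R`. -/
def splits (x : Letter p) (w : Word p) : Finset (Word p × Word p) :=
  ((Finset.range w.length).image fun k => (w.take k, w.drop (k + 1))).filter
    fun q => w = q.1 ++ x :: q.2

theorem mem_splits (x : Letter p) (w : Word p) (q : Word p × Word p) :
    q ∈ splits x w ↔ w = q.1 ++ x :: q.2 := by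
  simp only [splits, Finset.mem_filter, Finset.mem_image, Finset.mem_range, and_iff_right_iff_imp]
  intro h
  refine ⟨q.1.length, ?_, ?_⟩
  · rw [h]; simp
  · rw [h]; simp

end Word

/-! ## Sums of maps -/

/-- The normalized trace. -/
def ntr {N : ℕ} (B : Matrix (Fin N) (Fin N) ℂ) : ℂ := B.trace / N

/-- `tr_f(B)`: the product over the cycles `(i₁ … i_k)` of `f` of the normalized traces of
`B_{i₁} ⋯ B_{i_k}`. -/
def ntrPerm {I : Type*} {N : ℕ} (f : Equiv.Perm I) (B : I → Matrix (Fin N) (Fin N) ℂ) : ℂ :=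
  ∏ᶠ c : Quotient (Equiv.Perm.SameCycle.setoid f),
    ntr ((List.range (Function.minimalPeriod f c.out)).map fun n => B ((f ^ n) c.out)).prod

section MapSum

variable {p N : ℕ}

/-- The degrees `d_1, …, d_l` of the monomials `P_1, …, P_l`. -/
def degs (P : List (Word p)) (i : Fin P.length) : ℕ := (P.get i).blocks.length

/-- The labels `1, …, d_1 + ⋯ + d_l` (numbered from zero): `finSigmaFinEquiv` sends `(i, j)` to
`d_1 + ⋯ + d_{i-1} + j`. -/
abbrev Labels (P : List (Word p)) : Type := Fin (∑ i, degs P i)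

/-- The `j`-th factor `(M_{i,j}, ε_{i,j})` of the monomial `P_i`. -/
def factor (P : List (Word p)) (k : Labels P) : Word p × ℤˣ :=
  (P.get (finSigmaFinEquiv.symm k).1).blocks.get (finSigmaFinEquiv.symm k).2

/-- The permutation `(1, …, d_1)(d_1 + 1, …, d_1 + d_2) ⋯`. -/
def gammaPerm (P : List (Word p)) : Equiv.Perm (Labels P) :=
  finSigmaFinEquiv.permCongr (Equiv.sigmaCongrRight fun i => finRotate (degs P i))

/-- The sum over connected maps for monomials of positive degree. -/
def mapSumPos (A : Fin p → Matrix (Fin N) (Fin N) ℂ) (g : ℤ) (P : List (Word p)) : ℂ :=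
  (-1) ^ ((∑ i, degs P i) / 2 + P.length) *
    ∑ᶠ C ∈ connectedMaps g (fun k => (factor P k).2) (gammaPerm P)⁻¹,
      (-1) ^ numCycles C.rep.whiteφ * ntrPerm C.rep.whiteφ fun k => (factor P k).1.eval A

/-- The sum `M^{(g),N}_{0,l}(P_1, …, P_l)` of maps of genus `g`. It is zero for `g < 0` and for
`l = 0`. A monomial `P_i` of degree `0` is an isolated vertex: the only connected map
is then this vertex alone, on a sphere, with weight `tr P_i`. -/
def mapSum (A : Fin p → Matrix (Fin N) (Fin N) ℂ) (g : ℤ) (P : List (Word p)) : ℂ :=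
  if g < 0 ∨ P = [] then 0
  else if ∀ w ∈ P, 0 < w.degree then mapSumPos A g P
  else match P with
    | [w] => if g = 0 then ntr (w.eval A) else 0
    | _ => 0

end MapSum

/-- The tuple `(P_i)_{i ∈ I}`, in increasing order of the indices. -/
def restrict {n p : ℕ} (P : Fin n → Word p) (I : Finset (Fin n)) : List (Word p) :=
  ((List.finRange n).filter fun i => i ∈ I).map P

end

set_option linter.unusedSectionVars false

/-! A map of unitary type can be read as a diagram of strands running from outgoing to ingoing white
half-edges, on which each black vertex acts as a crossing. Following labels along strands, the black
vertex `k` becomes the transposition of the two labels leaving it, and what remains without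
crossings is a matching T of the outgoing with the ingoing white labels. Thus an isomorphism class
amounts to its rotation γ⁻¹, the orientations, T, and a sequence of transpositions whose largest
elements are nondecreasing (`bijOn_data`). If a is the product of the transpositions, the inverse
face permutation is a T γ⁻¹, the Euler characteristic is c(γ) + c(φ) − m − r, and connectedness says
that the partitions generated by γ, T and the transpositions join to the trivial one. As 2 − 2g is
even, the sign (−1)^(m+l+c(φ)) equals (−1)^r (`sum_connectedMaps`).

The recursion peels off the letter u at the end of the last word; call its point d. Sums over
monotone sequences are complete homogeneous symmetric polynomials in Jucys–Murphy elements. These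
commute, so the order of the labels is irrelevant (`monoSum_perm`) and d may be taken largest. Then
either no transposition involves d, and T matches d with an ingoing point x, or the last
transposition is (x d) for another outgoing point x (`mapCount_succ_eq`). In both cases, up to
conjugation by (x d), deleting this edge or crossing replaces γ by (x d)γ. This cuts the last word
if x belongs to it, and otherwise joins to it the word of x.

In the first case x and d become inert: these are the u* terms. In the second case they stay
outgoing and r drops by one: these are the u terms, with their minus sign (`hasSum_shift`). After a
join the map stays connected with the same genus. After a cut it is either connected of genus g − 1,
or has two components (`cutCount_of_not_rel`), which share the other words, the genus and the black
vertices; the count is then a product (`mapCount_sum`).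

Matrices are carried by the points of cyclic words. Letters other than u and u* are points of sign
0, unmatched and absorbed into the next point. Counts depend on words only up to rotation and such
absorptions (`wordCount_congr`), which brings the words produced by surgery into the form of the
statement. The result for families of cyclic words is `wordSum_fullFamily`, and `mapSum_eq`
identifies `mapSum` with these signed counts, monomials of degree 0 included. -/

noncomputable section

/-! ## Partitions and cycles of permutations -/

section Orbits

variable {A : Type*}

/-- The partition into cycles of a permutation. -/
abbrev orb (f : Equiv.Perm A) : Setoid A := Equiv.Perm.SameCycle.setoid f

/-- Universal property of the cycle partition: one step of `f` suffices to compare it with any other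
partition. Most partition arguments below go through it. -/
theorem orb_le_iff {f : Equiv.Perm A} {θ : Setoid A} : orb f ≤ θ ↔ ∀ x, θ x (f x) := by
  constructor
  · intro h x
    exact h (show f.SameCycle x (f x) from ⟨1, by simp⟩)
  · intro h x y hxy
    obtain ⟨n, rfl⟩ := hxy
    induction n with
    | zero => exact θ.refl' x
    | succ n ih =>
      rw [add_comm, zpow_add, zpow_one, Equiv.Perm.mul_apply]
      exact θ.trans' ih (h _)
    | pred n ih =>
      refine θ.trans' ih (θ.symm' ?_)
      have := h ((f ^ (-(n : ℤ) - 1)) x)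
      rwa [← Equiv.Perm.mul_apply, ← zpow_one_add, add_sub_cancel] at this

theorem orb_rel (f : Equiv.Perm A) (x : A) : orb f x (f x) := orb_le_iff.1 le_rfl x

theorem orb_inv (f : Equiv.Perm A) : orb f⁻¹ = orb f := by
  refine Setoid.ext fun x y => ?_
  exact Equiv.Perm.sameCycle_inv

theorem orb_mul_le {f g : Equiv.Perm A} {θ : Setoid A} (hf : orb f ≤ θ) (hg : orb g ≤ θ) :
    orb (f * g) ≤ θ :=
  orb_le_iff.2 fun x => θ.trans' (orb_le_iff.1 hg x) (orb_le_iff.1 hf _)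

/-- The finest partition in which `x` and `y` are in the same class. -/
def joinPair (x y : A) : Setoid A := Relation.EqvGen.setoid fun u v => u = x ∧ v = y

theorem joinPair_le_iff {x y : A} {θ : Setoid A} : joinPair x y ≤ θ ↔ θ x y := by
  constructor
  · intro h
    exact h (Relation.EqvGen.rel _ _ ⟨rfl, rfl⟩)
  · intro h
    apply Setoid.eqvGen_le
    rintro u v ⟨rfl, rfl⟩
    exact h

theorem joinPair_rel (x y : A) : joinPair x y x y := joinPair_le_iff.1 le_rfl

theorem joinPair_comm (x y : A) : joinPair x y = joinPair y x :=
  le_antisymm (joinPair_le_iff.2 (Setoid.symm' _ (joinPair_rel _ _)))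
    (joinPair_le_iff.2 (Setoid.symm' _ (joinPair_rel _ _)))

theorem orb_swap_le [DecidableEq A] (x y : A) : orb (Equiv.swap x y) ≤ joinPair x y := by
  refine orb_le_iff.2 fun z => ?_
  by_cases hx : z = x
  · subst hx; rw [Equiv.swap_apply_left]; exact joinPair_rel _ _
  by_cases hy : z = y
  · subst hy; rw [Equiv.swap_apply_right]; exact Setoid.symm' _ (joinPair_rel _ _)
  rw [Equiv.swap_apply_of_ne_of_ne hx hy]

/-- The merge of two classes, explicitly. -/
theorem sup_joinPair_rel {θ : Setoid A} {x y u v : A} :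
    (θ ⊔ joinPair x y) u v ↔ θ u v ∨ (θ u x ∧ θ v y) ∨ (θ u y ∧ θ v x) := by
  let η : Setoid A :=
    ⟨fun u v => θ u v ∨ (θ u x ∧ θ v y) ∨ (θ u y ∧ θ v x), by
      have S : ∀ {a b}, θ a b → θ b a := fun h => θ.symm' h
      have T : ∀ {a b c}, θ a b → θ b c → θ a c := fun h h' => θ.trans' h h'
      refine ⟨fun a => Or.inl (θ.refl' a), ?_, ?_⟩
      · rintro a b (h | ⟨h, h'⟩ | ⟨h, h'⟩)
        · exact Or.inl (S h)
        · exact Or.inr (Or.inr ⟨h', h⟩)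
        · exact Or.inr (Or.inl ⟨h', h⟩)
      · rintro a b c (h | ⟨h, h'⟩ | ⟨h, h'⟩) (k | ⟨k, k'⟩ | ⟨k, k'⟩)
        · exact Or.inl (T h k)
        · exact Or.inr (Or.inl ⟨T h k, k'⟩)
        · exact Or.inr (Or.inr ⟨T h k, k'⟩)
        · exact Or.inr (Or.inl ⟨h, T (S k) h'⟩)
        · exact Or.inl (T h (T (S k) (T h' (S k'))))
        · exact Or.inl (T h (S k'))
        · exact Or.inr (Or.inr ⟨h, T (S k) h'⟩)
        · exact Or.inl (T h (S k'))
        · exact Or.inl (T h (T (S k) (T h' (S k'))))⟩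
  constructor
  · intro h
    have hle : θ ⊔ joinPair x y ≤ η :=
      sup_le (fun {a b} hab => Or.inl hab)
        (joinPair_le_iff.2 (Or.inr (Or.inl ⟨θ.refl' x, θ.refl' y⟩)))
    exact hle h
  · have hθ : θ ≤ θ ⊔ joinPair x y := le_sup_left
    have hp : (θ ⊔ joinPair x y) x y := joinPair_le_iff.1 le_sup_right
    rintro (h | ⟨h, h'⟩ | ⟨h, h'⟩)
    · exact hθ h
    · exact Setoid.trans' _ (hθ h) (Setoid.trans' _ hp (Setoid.symm' _ (hθ h')))
    · exact Setoid.trans' _ (hθ h) (Setoid.trans' _ (Setoid.symm' _ hp) (Setoid.symm' _ (hθ h')))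

/-- The number of classes of a partition. -/
def numClasses (θ : Setoid A) : ℕ := Nat.card (Quotient θ)

theorem numCycles_eq (f : Equiv.Perm A) : numCycles f = numClasses (orb f) := rfl

/-- The classes of `θ` other than that of `y` are in bijection with the classes after the merge. -/
theorem numClasses_sup_joinPair [Finite A] {θ : Setoid A} {x y : A} (h : ¬ θ x y) :
    numClasses (θ ⊔ joinPair x y) + 1 = numClasses θ := by
  classical
  have := Fintype.ofFinite (Quotient θ)
  let F : {q : Quotient θ // q ≠ Quotient.mk θ y} → Quotient (θ ⊔ joinPair x y) :=
    fun q => Setoid.map_of_le le_sup_left q.1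
  have hF : Function.Bijective F := by
    constructor
    · rintro ⟨⟨u⟩, hu⟩ ⟨⟨v⟩, hv⟩ huv
      have huv' : (θ ⊔ joinPair x y) u v := Quotient.exact huv
      have hu' : ¬ θ u y := fun hh => hu (Quotient.sound hh)
      have hv' : ¬ θ v y := fun hh => hv (Quotient.sound hh)
      rcases sup_joinPair_rel.1 huv' with h1 | ⟨_, h2⟩ | ⟨h2, _⟩
      · exact Subtype.ext (Quotient.sound h1)
      · exact absurd h2 hv'
      · exact absurd h2 hu'
    · rintro ⟨u⟩
      by_cases hu : θ u y
      · refine ⟨⟨Quotient.mk θ x, fun hh => h (Quotient.exact hh)⟩, ?_⟩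
        exact Quotient.sound (sup_joinPair_rel.2 (Or.inr (Or.inl ⟨θ.refl' x, hu⟩)))
      · exact ⟨⟨Quotient.mk θ u, fun hh => hu (Quotient.exact hh)⟩, rfl⟩
  rw [numClasses, numClasses, ← Nat.card_eq_of_bijective F hF, Nat.card_eq_fintype_card,
    Nat.card_eq_fintype_card, Fintype.card_subtype_compl, Fintype.card_subtype_eq]
  have : 0 < Fintype.card (Quotient θ) := Fintype.card_pos_iff.2 ⟨Quotient.mk θ y⟩
  omega

theorem numClasses_top [Nonempty A] : numClasses (⊤ : Setoid A) = 1 := by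
  rw [numClasses, Nat.card_eq_one_iff_unique]
  exact ⟨Quotient.subsingleton_iff.2 rfl, ⟨Quotient.mk _ (Classical.arbitrary A)⟩⟩

/-- Whatever the transposition does to the cycles of `f` is invisible once `x` and `y` are joined.
This transfers connectedness when the rotation of a map is modified. -/
theorem orb_swap_mul_sup [DecidableEq A] (f : Equiv.Perm A) (x y : A) :
    orb (Equiv.swap x y * f) ⊔ joinPair x y = orb f ⊔ joinPair x y := by
  refine le_antisymm (sup_le (orb_mul_le ?_ le_sup_left) le_sup_right)
    (sup_le ?_ le_sup_right)
  · exact (orb_swap_le x y).trans le_sup_right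
  · have : f = Equiv.swap x y * (Equiv.swap x y * f) := by
      rw [← mul_assoc, Equiv.swap_mul_self, one_mul]
    conv_lhs => rw [this]
    exact orb_mul_le ((orb_swap_le x y).trans le_sup_right) le_sup_left

/-! ### A transposition cuts or joins cycles. -/

section Swap

variable [DecidableEq A] [Finite A]

/-- The cycle of `x` never meets `y`, so the new permutation follows it for one full period; the
step that would return to `x` is redirected to `y`. -/
theorem sameCycle_swap_mul {f : Equiv.Perm A} {x y : A} (h : ¬ orb f x y) :
    orb (Equiv.swap x y * f) x y := by
  classical
  set n := Function.minimalPeriod f x with hn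
  have hpos : 0 < n := Function.minimalPeriod_pos_of_mem_periodicPts
    (by
      rw [Function.mem_periodicPts]
      exact ⟨orderOf f, orderOf_pos f, by
        rw [Function.IsPeriodicPt, ← Equiv.Perm.coe_pow, pow_orderOf_eq_one]; rfl⟩)
  have key : ∀ k, k < n → ((Equiv.swap x y * f) ^ k) x = (f ^ k) x := by
    intro k
    induction k with
    | zero => intro _; rfl
    | succ k ih =>
      intro hk
      rw [pow_succ', Equiv.Perm.mul_apply, ih (by omega), Equiv.Perm.mul_apply,
        ← Equiv.Perm.mul_apply f, ← pow_succ']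
      apply Equiv.swap_apply_of_ne_of_ne
      · intro hh
        have := Function.IsPeriodicPt.minimalPeriod_le (f := f) (x := x) (n := k + 1) (by omega)
          (by rw [Function.IsPeriodicPt, ← Equiv.Perm.coe_pow]; exact hh)
        omega
      · intro hh
        exact h ⟨((k + 1 : ℕ) : ℤ), by rw [zpow_natCast, hh]⟩
  refine ⟨(n : ℤ), ?_⟩
  obtain ⟨k, hk⟩ : ∃ k, n = k + 1 := ⟨n - 1, by omega⟩
  rw [zpow_natCast, hk, pow_succ', Equiv.Perm.mul_apply, key k (by omega), Equiv.Perm.mul_apply,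
    ← Equiv.Perm.mul_apply f, ← pow_succ', ← hk]
  have : (f ^ n) x = x := by
    rw [Equiv.Perm.coe_pow]; exact Function.iterate_minimalPeriod
  rw [this, Equiv.swap_apply_left]

theorem orb_swap_mul_of_not {f : Equiv.Perm A} {x y : A} (h : ¬ orb f x y) :
    orb (Equiv.swap x y * f) = orb f ⊔ joinPair x y := by
  rw [← orb_swap_mul_sup, eq_comm, sup_eq_left, joinPair_le_iff]
  exact sameCycle_swap_mul h

theorem numCycles_swap_mul_of_not {f : Equiv.Perm A} {x y : A} (h : ¬ orb f x y) :
    numCycles (Equiv.swap x y * f) + 1 = numCycles f := by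
  rw [numCycles_eq, orb_swap_mul_of_not h, numClasses_sup_joinPair h, numCycles_eq]

/-- Only the separation of `x` and `y` has to be proved when they share a cycle: the count then
follows from the joining case applied to the new permutation, since the transposition is an
involution. -/
theorem orb_swap_mul_cases {f : Equiv.Perm A} {x y : A} (hxy : x ≠ y) :
    orb f x y ∧ ¬ orb (Equiv.swap x y * f) x y ∧ numCycles (Equiv.swap x y * f) = numCycles f + 1 ∨
    ¬ orb f x y ∧ orb (Equiv.swap x y * f) x y ∧
      numCycles (Equiv.swap x y * f) + 1 = numCycles f := by
  have hff : Equiv.swap x y * (Equiv.swap x y * f) = f := by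
    rw [← mul_assoc, Equiv.swap_mul_self, one_mul]
  by_cases h : orb f x y
  · left
    have h' : ¬ orb (Equiv.swap x y * f) x y := by
      obtain ⟨n, hn, hfn⟩ : ∃ n : ℕ, n ≠ 0 ∧ (f ^ n) x = y := by
        obtain ⟨n, hn⟩ := Equiv.Perm.SameCycle.exists_pow_eq' (f := f) h
        refine ⟨n, ?_, hn.2⟩
        rintro rfl
        exact hxy hn.2
      classical
      have hex : ∃ n : ℕ, n ≠ 0 ∧ (f ^ n) x = y := ⟨n, hn, hfn⟩
      set m := Nat.find hex with hm
      obtain ⟨hm0, hmy⟩ := Nat.find_spec hex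
      rw [← hm] at hm0 hmy
      have hmin : ∀ k, k < m → k ≠ 0 → (f ^ k) x ≠ y := fun k hk h0 hh =>
        Nat.find_min hex hk ⟨h0, hh⟩
      have hx : ∀ k, k < m → k ≠ 0 → (f ^ k) x ≠ x := by
        intro k hk h0 hh
        have : (f ^ (m - k)) x = y := by
          have h1 : (f ^ m) x = (f ^ (m - k)) ((f ^ k) x) := by
            rw [← Equiv.Perm.mul_apply, ← pow_add, Nat.sub_add_cancel hk.le]
          rw [hh, hmy] at h1
          exact h1.symm
        exact hmin (m - k) (by omega) (by omega) this
      have key : ∀ k, k < m → ((Equiv.swap x y * f) ^ k) x = (f ^ k) x := by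
        intro k
        induction k with
        | zero => intro _; rfl
        | succ k ih =>
          intro hk
          rw [pow_succ', Equiv.Perm.mul_apply, ih (by omega), Equiv.Perm.mul_apply,
            ← Equiv.Perm.mul_apply f, ← pow_succ']
          exact Equiv.swap_apply_of_ne_of_ne (hx _ hk (by omega)) (hmin _ hk (by omega))
      -- Here `m` is the first time at which `f` brings `x` to `y`. At that time the transposition
      -- sends the path back to `x`, which closes the new cycle without `y`.
      have hper : ((Equiv.swap x y * f) ^ m) x = x := by
        obtain ⟨k, hk⟩ : ∃ k, m = k + 1 := ⟨m - 1, by omega⟩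
        rw [hk, pow_succ', Equiv.Perm.mul_apply, key k (by omega), Equiv.Perm.mul_apply,
          ← Equiv.Perm.mul_apply f, ← pow_succ', ← hk, hmy, Equiv.swap_apply_right]
      have hmul : ∀ q : ℕ, ((Equiv.swap x y * f) ^ (m * q)) x = x := by
        intro q
        induction q with
        | zero => rfl
        | succ q ih => rw [Nat.mul_succ, pow_add, Equiv.Perm.mul_apply, hper, ih]
      intro hs
      obtain ⟨k, -, hk⟩ := Equiv.Perm.SameCycle.exists_pow_eq' (f := Equiv.swap x y * f) hs
      rw [← Nat.mod_add_div k m, pow_add, Equiv.Perm.mul_apply, hmul,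
        key _ (Nat.mod_lt _ (by omega))] at hk
      by_cases h0 : k % m = 0
      · rw [h0] at hk; exact hxy hk
      · exact hmin _ (Nat.mod_lt _ (by omega)) h0 hk
    have := numCycles_swap_mul_of_not h'
    rw [hff] at this
    exact ⟨h, h', this.symm⟩
  · exact Or.inr ⟨h, sameCycle_swap_mul h, numCycles_swap_mul_of_not h⟩

/-- The effect of one transposition on the Euler characteristic. -/
theorem euler_step {f : Equiv.Perm A} {θ : Setoid A} (hf : orb f ≤ θ) {x y : A} (hxy : x ≠ y)
    {c : ℤ} (hle : c + numCycles f ≤ 2 * numClasses θ) (hev : Even (c + numCycles f)) :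
    c + numCycles (Equiv.swap x y * f) - 1 ≤ 2 * numClasses (θ ⊔ joinPair x y) ∧
      Even (c + numCycles (Equiv.swap x y * f) - 1) := by
  rcases orb_swap_mul_cases (f := f) hxy with ⟨h1, -, h3⟩ | ⟨h1, -, h3⟩
  -- A cut adds one cycle, which the term −1 cancels, and leaves the components unchanged.
  · have : θ ⊔ joinPair x y = θ := sup_eq_left.2 (joinPair_le_iff.2 (hf h1))
    rw [this, h3]
    push_cast
    obtain ⟨k, hk⟩ := hev
    exact ⟨by linarith, k, by linarith⟩
  -- A join lowers the left side by two, while at most one component is lost.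
  · have h3' : (numCycles f : ℤ) = numCycles (Equiv.swap x y * f) + 1 := by exact_mod_cast h3.symm
    rw [h3'] at hle hev
    refine ⟨?_, ?_⟩
    · by_cases hθ : θ x y
      · rw [sup_eq_left.2 (joinPair_le_iff.2 hθ)]; linarith
      · have := numClasses_sup_joinPair hθ
        have h' : (numClasses θ : ℤ) = numClasses (θ ⊔ joinPair x y) + 1 := by
          exact_mod_cast this.symm
        rw [h'] at hle
        linarith
    · obtain ⟨k, hk⟩ := hev
      exact ⟨k - 1, by linarith⟩

end Swap

theorem numCycles_conj {B : Type*} (e : A ≃ B) (f : Equiv.Perm A) (g : Equiv.Perm B)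
    (h : ∀ x, e (f x) = g (e x)) : numCycles g = numCycles f := by
  refine (Nat.card_congr (Quotient.congr e fun x y => ?_)).symm
  have hp : ∀ (n : ℤ) x, e ((f ^ n) x) = (g ^ n) (e x) := by
    have hn : ∀ (n : ℕ) x, e ((f ^ n) x) = (g ^ n) (e x) := by
      intro n
      induction n with
      | zero => intro x; rfl
      | succ n ih => intro x; rw [pow_succ, pow_succ, Equiv.Perm.mul_apply, ih, h]; rfl
    intro n x
    obtain ⟨n, rfl | rfl⟩ := n.eq_nat_or_neg
    · simpa using hn n x
    · rw [zpow_neg, zpow_neg, zpow_natCast, zpow_natCast, Equiv.Perm.eq_inv_iff_eq, ← hn]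
      simp
  constructor
  · rintro ⟨n, rfl⟩
    exact ⟨n, (hp n x).symm⟩
  · rintro ⟨n, hn⟩
    exact ⟨n, e.injective (by rw [hp, hn])⟩

end Orbits

end

noncomputable section

/-! ## Traces along the cycles of a permutation -/

section CycleTraces

variable {A : Type*} {N : ℕ}

theorem ntr_mul_comm (X Y : Matrix (Fin N) (Fin N) ℂ) : ntr (X * Y) = ntr (Y * X) := by
  rw [ntr, ntr, Matrix.trace_mul_comm]

/-- The normalized trace of the product of the matrices met on the cycle of `x`. -/
def cycleTrace (f : Equiv.Perm A) (B : A → Matrix (Fin N) (Fin N) ℂ) (x : A) : ℂ :=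
  ntr ((List.range (Function.minimalPeriod f x)).map fun n => B ((f ^ n) x)).prod

theorem minimalPeriod_pos [Finite A] (f : Equiv.Perm A) (x : A) :
    0 < Function.minimalPeriod f x := by
  refine Function.minimalPeriod_pos_of_mem_periodicPts ?_
  rw [Function.mem_periodicPts]
  exact ⟨orderOf f, orderOf_pos f, by
    rw [Function.IsPeriodicPt, ← Equiv.Perm.coe_pow, pow_orderOf_eq_one]; rfl⟩

theorem pow_minimalPeriod_apply (f : Equiv.Perm A) (x : A) :
    (f ^ Function.minimalPeriod f x) x = x := by
  rw [Equiv.Perm.coe_pow]; exact Function.iterate_minimalPeriod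

theorem pow_apply_ne_of_lt_minimalPeriod {f : Equiv.Perm A} {x : A} {n : ℕ} (h0 : n ≠ 0)
    (h : n < Function.minimalPeriod f x) : (f ^ n) x ≠ x := by
  intro hh
  have := Function.IsPeriodicPt.minimalPeriod_le (f := f) (x := x) (n := n) (by omega)
    (by rw [Function.IsPeriodicPt, ← Equiv.Perm.coe_pow]; exact hh)
  omega

theorem minimalPeriod_eq_of {f : Equiv.Perm A} {x : A} {n : ℕ} (h0 : 0 < n) (h : (f ^ n) x = x)
    (hlt : ∀ k, 0 < k → k < n → (f ^ k) x ≠ x) : Function.minimalPeriod f x = n := by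
  have hp : Function.IsPeriodicPt f n x := by
    rw [Function.IsPeriodicPt, ← Equiv.Perm.coe_pow]; exact h
  refine le_antisymm (hp.minimalPeriod_le h0) (not_lt.1 fun hh => ?_)
  exact hlt _ (hp.minimalPeriod_pos h0) hh (pow_minimalPeriod_apply f x)

/-- Moving the starting point rotates the product, and the trace is cyclic. -/
theorem cycleTrace_apply [Finite A] (f : Equiv.Perm A) (B : A → Matrix (Fin N) (Fin N) ℂ)
    (x : A) : cycleTrace f B (f x) = cycleTrace f B x := by
  have hper : Function.minimalPeriod f (f x) = Function.minimalPeriod f x :=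
    Function.minimalPeriod_apply (Function.minimalPeriod_pos_iff_mem_periodicPts.1
      (minimalPeriod_pos f x))
  rw [cycleTrace, cycleTrace, hper]
  obtain ⟨k, hk⟩ : ∃ k, Function.minimalPeriod f x = k + 1 :=
    ⟨Function.minimalPeriod f x - 1, by have := minimalPeriod_pos f x; omega⟩
  have hx : (f ^ k) (f x) = x := by
    rw [← Equiv.Perm.mul_apply, ← pow_succ, ← hk, pow_minimalPeriod_apply]
  rw [hk]
  conv_rhs => rw [List.range_succ_eq_map, List.map_cons, List.prod_cons, ntr_mul_comm]
  rw [List.range_succ, List.map_append, List.prod_append, List.map_singleton, List.prod_singleton,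
    hx, List.map_map]
  congr 2

theorem cycleTrace_eq_of_orb [Finite A] {f : Equiv.Perm A} {B : A → Matrix (Fin N) (Fin N) ℂ}
    {x y : A} (h : orb f x y) : cycleTrace f B x = cycleTrace f B y := by
  have : orb f ≤ Setoid.ker (cycleTrace f B) :=
    orb_le_iff.2 fun z => (cycleTrace_apply f B z).symm
  exact this h

/-- The cycles can be enumerated by any system of representatives. -/
theorem ntrPerm_eq_prod [Finite A] (f : Equiv.Perm A) (B : A → Matrix (Fin N) (Fin N) ℂ)
    {Q : Type*} [Fintype Q] (t : Q → A)
    (ht : Function.Bijective fun q => Quotient.mk (orb f) (t q)) :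
    ntrPerm f B = ∏ q, cycleTrace f B (t q) := by
  rw [← finprod_eq_prod_of_fintype, ntrPerm]
  refine (finprod_eq_of_bijective _ ht fun q => ?_).symm
  refine cycleTrace_eq_of_orb ?_
  exact Setoid.symm' _ (Quotient.exact (Quotient.out_eq _))

theorem bijective_mk_out (f : Equiv.Perm A) :
    Function.Bijective fun q : Quotient (orb f) => Quotient.mk (orb f) q.out := by
  simp only [Quotient.out_eq]
  exact Function.bijective_id

theorem semiconj_pow_apply {A' : Type*} (e : A ≃ A') (f : Equiv.Perm A) (g : Equiv.Perm A')
    (h : ∀ x, e (f x) = g (e x)) (n : ℕ) (x : A) : e ((f ^ n) x) = (g ^ n) (e x) := by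
  induction n generalizing x with
  | zero => rfl
  | succ n ih => rw [pow_succ, pow_succ, Equiv.Perm.mul_apply, ih, h]; rfl

theorem orb_conj {A' : Type*} (e : A ≃ A') (f : Equiv.Perm A) (g : Equiv.Perm A')
    (h : ∀ x, e (f x) = g (e x)) (x y : A) : orb g (e x) (e y) ↔ orb f x y := by
  constructor
  · have : orb g ≤ Setoid.comap e.symm (orb f) := by
      refine orb_le_iff.2 fun z => ?_
      obtain ⟨z, rfl⟩ := e.surjective z
      rw [Setoid.comap_rel, ← h, e.symm_apply_apply, e.symm_apply_apply]
      exact orb_rel f z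
    intro hh
    simpa [Setoid.comap_rel] using this hh
  · have : orb f ≤ Setoid.comap e (orb g) := by
      refine orb_le_iff.2 fun z => ?_
      rw [Setoid.comap_rel, h]
      exact orb_rel g _
    exact fun hh => this hh

theorem ntrPerm_conj [Finite A] {A' : Type*} (e : A ≃ A') (f : Equiv.Perm A) (g : Equiv.Perm A')
    (h : ∀ x, e (f x) = g (e x)) (B : A' → Matrix (Fin N) (Fin N) ℂ) :
    ntrPerm g B = ntrPerm f (fun x => B (e x)) := by
  classical
  have := Fintype.ofFinite (Quotient (orb f))
  have : Finite A' := Finite.of_equiv A e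
  rw [ntrPerm_eq_prod f _ _ (bijective_mk_out f),
    ntrPerm_eq_prod g B (fun q : Quotient (orb f) => e q.out) ?_]
  · refine Finset.prod_congr rfl fun q _ => ?_
    rw [cycleTrace, cycleTrace]
    have hper : Function.minimalPeriod g (e q.out) = Function.minimalPeriod f q.out := by
      refine Function.minimalPeriod_eq_minimalPeriod_iff.2 fun n => ?_
      rw [Function.IsPeriodicPt, Function.IsPeriodicPt, ← Equiv.Perm.coe_pow,
        ← Equiv.Perm.coe_pow, Function.IsFixedPt, Function.IsFixedPt, ← semiconj_pow_apply e f g h,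
        e.injective.eq_iff]
    rw [hper]
    simp only [semiconj_pow_apply e f g h]
  · constructor
    · intro q q' hq
      have : orb g (e q.out) (e q'.out) := Quotient.exact hq
      rw [orb_conj e f g h] at this
      rw [← q.out_eq, ← q'.out_eq]
      exact Quotient.sound this
    · rintro ⟨z⟩
      obtain ⟨z, rfl⟩ := e.surjective z
      refine ⟨Quotient.mk _ z, Quotient.sound ?_⟩
      change orb g _ _
      rw [orb_conj e f g h]
      exact Quotient.exact (Quotient.out_eq (Quotient.mk (orb f) z))

/-! ### Permutations of a disjoint union. -/

section Sum

variable {A' : Type*}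

theorem sumCongr_pow_inl (f : Equiv.Perm A) (g : Equiv.Perm A') (n : ℕ) (x : A) :
    ((Equiv.sumCongr f g : Equiv.Perm (A ⊕ A')) ^ n) (Sum.inl x) = Sum.inl ((f ^ n) x) := by
  induction n generalizing x with
  | zero => rfl
  | succ n ih => rw [pow_succ, pow_succ, Equiv.Perm.mul_apply]; exact ih (f x)

theorem sumCongr_pow_inr (f : Equiv.Perm A) (g : Equiv.Perm A') (n : ℕ) (x : A') :
    ((Equiv.sumCongr f g : Equiv.Perm (A ⊕ A')) ^ n) (Sum.inr x) = Sum.inr ((g ^ n) x) := by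
  induction n generalizing x with
  | zero => rfl
  | succ n ih => rw [pow_succ, pow_succ, Equiv.Perm.mul_apply]; exact ih (g x)

/-- The partition of a disjoint union given by partitions of the two parts. -/
def sumSetoid (θ : Setoid A) (η : Setoid A') : Setoid (A ⊕ A') where
  r := Sum.LiftRel θ η
  iseqv := by
    refine ⟨?_, ?_, ?_⟩
    · rintro (x | x)
      · exact Sum.LiftRel.inl (θ.refl' x)
      · exact Sum.LiftRel.inr (η.refl' x)
    · rintro _ _ (h | h)
      · exact Sum.LiftRel.inl (θ.symm' h)
      · exact Sum.LiftRel.inr (η.symm' h)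
    · rintro _ _ _ (h | h) (h' | h')
      · exact Sum.LiftRel.inl (θ.trans' h h')
      · exact Sum.LiftRel.inr (η.trans' h h')

@[simp] theorem sumSetoid_inl (θ : Setoid A) (η : Setoid A') (x y : A) :
    sumSetoid θ η (Sum.inl x) (Sum.inl y) ↔ θ x y := Sum.liftRel_inl_inl

@[simp] theorem sumSetoid_inr (θ : Setoid A) (η : Setoid A') (x y : A') :
    sumSetoid θ η (Sum.inr x) (Sum.inr y) ↔ η x y := Sum.liftRel_inr_inr

@[simp] theorem sumSetoid_inl_inr (θ : Setoid A) (η : Setoid A') (x : A) (y : A') :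
    ¬ sumSetoid θ η (Sum.inl x) (Sum.inr y) := Sum.not_liftRel_inl_inr

@[simp] theorem sumSetoid_inr_inl (θ : Setoid A) (η : Setoid A') (x : A') (y : A) :
    ¬ sumSetoid θ η (Sum.inr x) (Sum.inl y) := Sum.not_liftRel_inr_inl

theorem sumSetoid_le_iff {θ : Setoid A} {η : Setoid A'} {ζ : Setoid (A ⊕ A')} :
    sumSetoid θ η ≤ ζ ↔ θ ≤ Setoid.comap Sum.inl ζ ∧ η ≤ Setoid.comap Sum.inr ζ := by
  constructor
  · intro h
    exact ⟨fun {x y} hxy => h (Sum.LiftRel.inl hxy), fun {x y} hxy => h (Sum.LiftRel.inr hxy)⟩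
  · rintro ⟨h, h'⟩ _ _ (hxy | hxy)
    · exact h hxy
    · exact h' hxy

theorem orb_sumCongr (f : Equiv.Perm A) (g : Equiv.Perm A') :
    orb (Equiv.sumCongr f g : Equiv.Perm (A ⊕ A')) = sumSetoid (orb f) (orb g) := by
  refine le_antisymm (orb_le_iff.2 ?_) (sumSetoid_le_iff.2 ⟨orb_le_iff.2 ?_, orb_le_iff.2 ?_⟩)
  · rintro (x | x)
    · exact Sum.LiftRel.inl (orb_rel f x)
    · exact Sum.LiftRel.inr (orb_rel g x)
  · intro x
    exact orb_rel (Equiv.sumCongr f g : Equiv.Perm (A ⊕ A')) (Sum.inl x)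
  · intro x
    exact orb_rel (Equiv.sumCongr f g : Equiv.Perm (A ⊕ A')) (Sum.inr x)

/-- Representatives of the cycles of a permutation of a disjoint union. -/
def sumRep (f : Equiv.Perm A) (g : Equiv.Perm A') : Quotient (orb f) ⊕ Quotient (orb g) → A ⊕ A' :=
  Sum.map Quotient.out Quotient.out

theorem bijective_sumRep (f : Equiv.Perm A) (g : Equiv.Perm A') :
    Function.Bijective fun q =>
      Quotient.mk (orb (Equiv.sumCongr f g : Equiv.Perm (A ⊕ A'))) (sumRep f g q) := by
  constructor
  · intro q q' hq
    have hq' : orb (Equiv.sumCongr f g : Equiv.Perm (A ⊕ A')) (sumRep f g q) (sumRep f g q') :=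
      Quotient.exact hq
    rw [orb_sumCongr] at hq'
    rcases q with q | q <;> rcases q' with q' | q'
    · simp only [sumRep, Sum.map_inl, sumSetoid_inl] at hq'
      rw [← q.out_eq, ← q'.out_eq]
      exact congrArg Sum.inl (Quotient.sound hq')
    · simp [sumRep] at hq'
    · simp [sumRep] at hq'
    · simp only [sumRep, Sum.map_inr, sumSetoid_inr] at hq'
      rw [← q.out_eq, ← q'.out_eq]
      exact congrArg Sum.inr (Quotient.sound hq')
  · rintro ⟨z | z⟩
    · refine ⟨Sum.inl (Quotient.mk _ z), Quotient.sound ?_⟩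
      change orb _ _ _
      rw [orb_sumCongr]
      exact Sum.LiftRel.inl (Quotient.exact (Quotient.out_eq (Quotient.mk (orb f) z)))
    · refine ⟨Sum.inr (Quotient.mk _ z), Quotient.sound ?_⟩
      change orb _ _ _
      rw [orb_sumCongr]
      exact Sum.LiftRel.inr (Quotient.exact (Quotient.out_eq (Quotient.mk (orb g) z)))

theorem numCycles_sumCongr [Finite A] [Finite A'] (f : Equiv.Perm A) (g : Equiv.Perm A') :
    numCycles (Equiv.sumCongr f g : Equiv.Perm (A ⊕ A')) = numCycles f + numCycles g := by
  rw [numCycles, ← Nat.card_eq_of_bijective _ (bijective_sumRep f g), Nat.card_sum]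
  rfl

theorem ntrPerm_sumCongr [Finite A] [Finite A'] (f : Equiv.Perm A) (g : Equiv.Perm A')
    (B : A ⊕ A' → Matrix (Fin N) (Fin N) ℂ) :
    ntrPerm (Equiv.sumCongr f g : Equiv.Perm (A ⊕ A')) B =
      ntrPerm f (fun x => B (Sum.inl x)) * ntrPerm g (fun x => B (Sum.inr x)) := by
  classical
  have := Fintype.ofFinite (Quotient (orb f))
  have := Fintype.ofFinite (Quotient (orb g))
  rw [ntrPerm_eq_prod _ _ _ (bijective_sumRep f g), ntrPerm_eq_prod f _ _ (bijective_mk_out f),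
    ntrPerm_eq_prod g _ _ (bijective_mk_out g), Fintype.prod_sum_type]
  congr 1
  · refine Finset.prod_congr rfl fun q _ => ?_
    simp only [cycleTrace, sumRep, Sum.map_inl, sumCongr_pow_inl]
    congr 4
    refine Function.minimalPeriod_eq_minimalPeriod_iff.2 fun n => ?_
    rw [Function.IsPeriodicPt, Function.IsPeriodicPt, ← Equiv.Perm.coe_pow,
        ← Equiv.Perm.coe_pow, Function.IsFixedPt, Function.IsFixedPt, sumCongr_pow_inl,
        Sum.inl_injective.eq_iff]
  · refine Finset.prod_congr rfl fun q _ => ?_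
    simp only [cycleTrace, sumRep, Sum.map_inr, sumCongr_pow_inr]
    congr 4
    refine Function.minimalPeriod_eq_minimalPeriod_iff.2 fun n => ?_
    rw [Function.IsPeriodicPt, Function.IsPeriodicPt, ← Equiv.Perm.coe_pow,
        ← Equiv.Perm.coe_pow, Function.IsFixedPt, Function.IsFixedPt, sumCongr_pow_inr,
        Sum.inr_injective.eq_iff]

end Sum

/-! ### Insertion of a point into a cycle. -/

section InsertPoint

variable [DecidableEq A]

/-- The permutation obtained from `f` by inserting a new point `none` just before `y`. -/
def insertPoint (f : Equiv.Perm A) (y : A) : Equiv.Perm (Option A) :=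
  Equiv.swap none (some y) * Equiv.optionCongr f

theorem insertPoint_none (f : Equiv.Perm A) (y : A) : insertPoint f y none = some y := by
  simp [insertPoint]

theorem insertPoint_some_of_eq {f : Equiv.Perm A} {y z : A} (h : f z = y) :
    insertPoint f y (some z) = none := by
  simp [insertPoint, h]

theorem insertPoint_some_of_ne {f : Equiv.Perm A} {y z : A} (h : f z ≠ y) :
    insertPoint f y (some z) = some (f z) := by
  rw [insertPoint, Equiv.Perm.mul_apply, Equiv.optionCongr_apply, Option.map_some,
    Equiv.swap_apply_of_ne_of_ne (by simp) (by simpa using h)]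

/-- Collapsing the new point onto `y` maps the new cycles into the old ones. -/
theorem orb_insertPoint_some (f : Equiv.Perm A) (y x z : A) :
    orb (insertPoint f y) (some x) (some z) ↔ orb f x z := by
  constructor
  · have : orb (insertPoint f y) ≤ Setoid.comap (fun o => o.getD y) (orb f) := by
      refine orb_le_iff.2 ?_
      rintro (_ | z)
      · rw [insertPoint_none]; exact Setoid.refl' (orb f) y
      · by_cases h : f z = y
        · rw [insertPoint_some_of_eq h, Setoid.comap_rel]
          simpa [h] using orb_rel f z
        · rw [insertPoint_some_of_ne h]
          exact orb_rel f z
    exact fun h => this h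
  · have : orb f ≤ Setoid.comap some (orb (insertPoint f y)) := by
      refine orb_le_iff.2 fun z => ?_
      have h0 := orb_rel (insertPoint f y) (some z)
      by_cases h : f z = y
      · rw [insertPoint_some_of_eq h] at h0
        have h1 := orb_rel (insertPoint f y) none
        rw [insertPoint_none] at h1
        rw [h]
        exact Setoid.trans' (orb (insertPoint f y)) h0 h1
      · rwa [insertPoint_some_of_ne h] at h0
    exact fun h => this h

theorem orb_insertPoint_none (f : Equiv.Perm A) (y : A) :
    orb (insertPoint f y) none (some y) := by
  have := orb_rel (insertPoint f y) none
  rwa [insertPoint_none] at this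

theorem bijective_insertPoint (f : Equiv.Perm A) (y : A) :
    Function.Bijective fun q : Quotient (orb f) =>
      Quotient.mk (orb (insertPoint f y)) (some q.out) := by
  constructor
  · intro q q' hq
    have hq' : orb (insertPoint f y) (some q.out) (some q'.out) := Quotient.exact hq
    rw [orb_insertPoint_some] at hq'
    rw [← q.out_eq, ← q'.out_eq]
    exact Quotient.sound hq'
  · have key : ∀ z : A, ∃ q : Quotient (orb f), Quotient.mk (orb (insertPoint f y)) (some q.out) =
        Quotient.mk (orb (insertPoint f y)) (some z) := fun z =>
      ⟨Quotient.mk _ z, Quotient.sound ((orb_insertPoint_some _ _ _ _).2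
        (Quotient.exact (Quotient.out_eq (Quotient.mk (orb f) z))))⟩
    rintro ⟨_ | z⟩
    · obtain ⟨q, hq⟩ := key y
      exact ⟨q, hq.trans (Quotient.sound (Setoid.symm' _ (orb_insertPoint_none f y)))⟩
    · exact key z

theorem numCycles_insertPoint (f : Equiv.Perm A) (y : A) :
    numCycles (insertPoint f y) = numCycles f :=
  (Nat.card_eq_of_bijective _ (bijective_insertPoint f y)).symm

/-- From the new point one follows the cycle of `y` with a delay of one step, as long as it does not
close up. -/
theorem insertPoint_pow_none {f : Equiv.Perm A} {y : A} {k : ℕ}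
    (hk : k < Function.minimalPeriod f y) :
    (insertPoint f y ^ (k + 1)) none = some ((f ^ k) y) := by
  induction k with
  | zero => simp [insertPoint_none]
  | succ k ih =>
    rw [pow_succ', Equiv.Perm.mul_apply, ih (by omega), insertPoint_some_of_ne, pow_succ']
    · rfl
    · rw [← Equiv.Perm.mul_apply, ← pow_succ']
      exact pow_apply_ne_of_lt_minimalPeriod (by omega) hk

/-- Read from the new point, the modified cycle starts with `B none * B (some y)`, which is `B' y`;
nothing else changes. This is how an inert letter is absorbed by its successor. -/
theorem ntrPerm_insertPoint [Finite A] (f : Equiv.Perm A) (y : A)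
    (B : Option A → Matrix (Fin N) (Fin N) ℂ) (B' : A → Matrix (Fin N) (Fin N) ℂ)
    (hy : B' y = B none * B (some y)) (hB : ∀ z, z ≠ y → B' z = B (some z)) :
    ntrPerm (insertPoint f y) B = ntrPerm f B' := by
  classical
  have := Fintype.ofFinite (Quotient (orb f))
  rw [ntrPerm_eq_prod _ _ _ (bijective_insertPoint f y),
    ntrPerm_eq_prod f _ _ (bijective_mk_out f)]
  refine Finset.prod_congr rfl fun q _ => ?_
  generalize q.out = x
  by_cases hx : orb f x y
  · rw [cycleTrace_eq_of_orb hx, cycleTrace_eq_of_orb ((orb_insertPoint_some f y x y).2 hx),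
      ← cycleTrace_eq_of_orb (orb_insertPoint_none f y)]
    obtain ⟨k, hk⟩ : ∃ k, Function.minimalPeriod f y = k + 1 :=
      ⟨Function.minimalPeriod f y - 1, by have := minimalPeriod_pos f y; omega⟩
    have hper : Function.minimalPeriod (insertPoint f y) none = k + 2 := by
      refine minimalPeriod_eq_of (by omega) ?_ ?_
      · rw [pow_succ', Equiv.Perm.mul_apply, insertPoint_pow_none (by omega),
          insertPoint_some_of_eq]
        rw [← Equiv.Perm.mul_apply, ← pow_succ', ← hk, pow_minimalPeriod_apply]
      · intro j hj hj'
        obtain ⟨i, rfl⟩ : ∃ i, j = i + 1 := ⟨j - 1, by omega⟩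
        rw [insertPoint_pow_none (by omega)]
        simp
    rw [cycleTrace, cycleTrace, hper, hk, List.range_succ_eq_map, List.map_cons, List.prod_cons,
      List.map_map, List.range_succ_eq_map, List.map_cons, List.prod_cons, List.map_cons,
      List.prod_cons, List.map_map, List.map_map, ← mul_assoc]
    congr 2
    · simp only [pow_zero, Equiv.Perm.one_apply, hy, Function.comp_apply, Nat.succ_eq_add_one,
        zero_add, pow_one, insertPoint_none]
    · congr 1
      refine List.map_congr_left fun n hn => ?_
      rw [List.mem_range] at hn
      simp only [Function.comp_apply, Nat.succ_eq_add_one]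
      rw [insertPoint_pow_none (by omega), hB]
      exact pow_apply_ne_of_lt_minimalPeriod (by omega) (by omega)
  · have hne : ∀ n : ℕ, (f ^ n) x ≠ y := fun n hn => hx ⟨n, by rw [zpow_natCast, hn]⟩
    have hpow : ∀ n : ℕ, (insertPoint f y ^ n) (some x) = some ((f ^ n) x) := by
      intro n
      induction n with
      | zero => rfl
      | succ n ih =>
        rw [pow_succ', Equiv.Perm.mul_apply, ih, insertPoint_some_of_ne, pow_succ']
        · rfl
        · rw [← Equiv.Perm.mul_apply, ← pow_succ']; exact hne _
    have hper : Function.minimalPeriod (insertPoint f y) (some x) =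
        Function.minimalPeriod f x := by
      refine Function.minimalPeriod_eq_minimalPeriod_iff.2 fun n => ?_
      rw [Function.IsPeriodicPt, Function.IsPeriodicPt, ← Equiv.Perm.coe_pow,
        ← Equiv.Perm.coe_pow, Function.IsFixedPt, Function.IsFixedPt, hpow,
        Option.some_injective _ |>.eq_iff]
    rw [cycleTrace, cycleTrace, hper]
    congr 2
    refine List.map_congr_left fun n _ => ?_
    rw [hpow, hB _ (hne n)]

end InsertPoint

end CycleTraces

end

noncomputable section

/-! ## Sums over monotone sequences of transpositions -/

/-- A permutation together with a partition of the same set. The product multiplies the permutations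
and joins the partitions. -/
@[ext] structure PartPerm (I : Type*) where
  part : Setoid I
  perm : Equiv.Perm I

namespace PartPerm

variable {I : Type*}

instance : Monoid (PartPerm I) where
  mul a b := ⟨a.part ⊔ b.part, a.perm * b.perm⟩
  one := ⟨⊥, 1⟩
  mul_assoc a b c := PartPerm.ext (sup_assoc _ _ _) (mul_assoc _ _ _)
  one_mul a := PartPerm.ext (bot_sup_eq _) (one_mul _)
  mul_one a := PartPerm.ext (sup_bot_eq _) (mul_one _)

@[simp] theorem mul_part (a b : PartPerm I) : (a * b).part = a.part ⊔ b.part := rfl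
@[simp] theorem mul_perm (a b : PartPerm I) : (a * b).perm = a.perm * b.perm := rfl
@[simp] theorem one_part : (1 : PartPerm I).part = ⊥ := rfl
@[simp] theorem one_perm : (1 : PartPerm I).perm = 1 := rfl

variable [DecidableEq I]

/-- A transposition, with the partition into its orbits. -/
def swap (x y : I) : PartPerm I := ⟨joinPair x y, Equiv.swap x y⟩

@[simp] theorem swap_part (x y : I) : (swap x y).part = joinPair x y := rfl
@[simp] theorem swap_perm (x y : I) : (swap x y).perm = Equiv.swap x y := rfl

theorem swap_comm (x y : I) : swap x y = swap y x :=
  PartPerm.ext (joinPair_comm x y) (Equiv.swap_comm x y)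

/-- The three-point relation between transpositions. It also holds for the generated partitions, so
connectedness is not lost when a sequence of transpositions is rearranged. -/
theorem swap_mul_swap {a b x : I} (hab : a ≠ b) (hax : a ≠ x) (hbx : b ≠ x) :
    swap x b * swap x a = swap x a * swap a b := by
  refine PartPerm.ext ?_ ?_
  · simp only [mul_part, swap_part]
    refine le_antisymm (sup_le ?_ ?_) (sup_le ?_ ?_) <;> rw [joinPair_le_iff]
    · exact Setoid.trans' _ (joinPair_le_iff.1 le_sup_left) (joinPair_le_iff.1 le_sup_right)
    · exact joinPair_le_iff.1 le_sup_left
    · exact joinPair_le_iff.1 le_sup_right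
    · exact Setoid.trans' _ (Setoid.symm' _ (joinPair_le_iff.1 le_sup_right))
        (joinPair_le_iff.1 le_sup_left)
  · simp only [mul_perm, swap_perm]
    ext z
    simp only [Equiv.Perm.mul_apply, Equiv.swap_apply_def]
    grind

theorem swap_mul_swap_of_disjoint {a b x y : I} (hab : a ≠ b) (hay : x ≠ y) (hxa : x ≠ a)
    (hyb : y ≠ b) : swap x b * swap y a = swap y a * swap x b := by
  refine PartPerm.ext (sup_comm _ _) ?_
  simp only [mul_perm, swap_perm]
  ext z
  simp only [Equiv.Perm.mul_apply, Equiv.swap_apply_def]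
  grind

end PartPerm

/-- The induction follows the recursion of `monoSum`: either the largest element is discarded, or
one transposition is removed while the list is kept. -/
theorem monoSum_induction {I : Type*} {P : ℕ → List I → Prop} (zero : ∀ L, P 0 L) (nil : ∀ r, P (r + 1) [])
    (cons : ∀ r d L, P (r + 1) L → P r (d :: L) → P (r + 1) (d :: L)) (r : ℕ) (L : List I) :
    P r L := by
  induction r generalizing L with
  | zero => exact zero L
  | succ r ih =>
    induction L with
    | nil => exact nil r
    | cons d L ih' => exact cons r d L ih' (ih _)

section SuppIn

variable {I : Type*}

/-- The partition of which all classes are trivial, except possibly `S`. -/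
def onlyClass (S : Set I) : Setoid I where
  r x y := x = y ∨ x ∈ S ∧ y ∈ S
  iseqv := ⟨fun _ => Or.inl rfl, by rintro x y (rfl | h); exacts [Or.inl rfl, Or.inr h.symm], by
    rintro x y z (rfl | h) (rfl | h')
    exacts [Or.inl rfl, Or.inr h', Or.inr h, Or.inr ⟨h.1, h'.2⟩]⟩

/-- The permutation and the partition of `a` are trivial outside of `S`. -/
def PartPerm.SuppIn (S : Set I) (a : PartPerm I) : Prop :=
  orb a.perm ≤ a.part ∧ a.part ≤ onlyClass S

theorem PartPerm.suppIn_one (S : Set I) : PartPerm.SuppIn S 1 :=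
  ⟨orb_le_iff.2 fun _ => rfl, bot_le⟩

theorem PartPerm.SuppIn.perm_apply {S : Set I} {a : PartPerm I} (ha : a.SuppIn S) {x : I}
    (hx : x ∉ S) : a.perm x = x := by
  rcases (ha.1.trans ha.2) (orb_rel a.perm x) with h | h
  · exact h.symm
  · exact absurd h.1 hx

end SuppIn

section MonoSum

variable {I : Type*} [DecidableEq I]

/-- The sum of `F (t_r ⋯ t_1)` over the sequences `t_1, …, t_r` of transpositions of elements of
`L` whose largest elements are in nondecreasing order, where the list `L` is in decreasing order. -/
def monoSum : ℕ → List I → (PartPerm I → ℂ) → ℂ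
  | 0, _, F => F 1
  | _ + 1, [], _ => 0
  | r + 1, d :: L, F =>
    monoSum (r + 1) L F +
      ∑ y ∈ L.toFinset, monoSum r (d :: L) fun a => F (PartPerm.swap y d * a)
  termination_by r L => r + L.length

theorem monoSum_zero (L : List I) (F : PartPerm I → ℂ) : monoSum 0 L F = F 1 := by
  rw [monoSum]

theorem monoSum_nil (r : ℕ) (F : PartPerm I → ℂ) : monoSum (r + 1) [] F = 0 := by
  rw [monoSum]

theorem monoSum_cons (r : ℕ) (d : I) (L : List I) (F : PartPerm I → ℂ) :
    monoSum (r + 1) (d :: L) F = monoSum (r + 1) L F +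
      ∑ y ∈ L.toFinset, monoSum r (d :: L) fun a => F (PartPerm.swap y d * a) := by
  rw [monoSum]

/-- `monoSum` only sees the values of `F` at products of transpositions. -/
theorem monoSum_congr_of {S : Set I} {P : ℕ → PartPerm I → Prop} (h0 : P 0 1)
    (hs : ∀ r a x y, x ∈ S → y ∈ S → x ≠ y → P r a → P (r + 1) (PartPerm.swap x y * a))
    {r : ℕ} {L : List I} (hL : ∀ x ∈ L, x ∈ S) (hnd : L.Nodup) {F G : PartPerm I → ℂ}
    (hFG : ∀ a, P r a → F a = G a) : monoSum r L F = monoSum r L G := by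
  induction r, L using monoSum_induction generalizing F G with
  | zero L => rw [monoSum_zero, monoSum_zero]; exact hFG _ h0
  | nil r => rw [monoSum_nil, monoSum_nil]
  | cons r d L ih1 ih2 =>
    rw [monoSum_cons, monoSum_cons]
    have hnd' := List.nodup_cons.1 hnd
    congr 1
    · exact ih1 (fun x hx => hL x (List.mem_cons_of_mem _ hx)) hnd'.2 hFG
    · refine Finset.sum_congr rfl fun y hy => ?_
      rw [List.mem_toFinset] at hy
      refine ih2 hL hnd fun a ha => hFG _ (hs _ _ _ _ ?_ ?_ ?_ ha)
      · exact hL y (List.mem_cons_of_mem _ hy)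
      · exact hL d List.mem_cons_self
      · rintro rfl; exact hnd'.1 hy

theorem monoSum_zero_fun (r : ℕ) (L : List I) : monoSum r L (fun _ => 0) = 0 := by
  induction r, L using monoSum_induction with
  | zero L => rw [monoSum_zero]
  | nil r => rw [monoSum_nil]
  | cons r d L ih1 ih2 => rw [monoSum_cons, ih1]; simp [ih2]

theorem monoSum_add (r : ℕ) (L : List I) (F G : PartPerm I → ℂ) :
    monoSum r L (fun a => F a + G a) = monoSum r L F + monoSum r L G := by
  induction r, L using monoSum_induction generalizing F G with
  | zero L => simp only [monoSum_zero]
  | nil r => simp only [monoSum_nil, add_zero]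
  | cons r d L ih1 ih2 =>
    simp only [monoSum_cons, ih1, ih2, Finset.sum_add_distrib]
    ring

theorem monoSum_mul_left (r : ℕ) (L : List I) (c : ℂ) (F : PartPerm I → ℂ) :
    monoSum r L (fun a => c * F a) = c * monoSum r L F := by
  induction r, L using monoSum_induction generalizing F with
  | zero L => simp only [monoSum_zero]
  | nil r => simp only [monoSum_nil, mul_zero]
  | cons r d L ih1 ih2 =>
    simp only [monoSum_cons, ih1, ih2, mul_add, Finset.mul_sum]

theorem monoSum_sum {ι : Type*} (s : Finset ι) (r : ℕ) (L : List I) (F : ι → PartPerm I → ℂ) :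
    monoSum r L (fun a => ∑ i ∈ s, F i a) = ∑ i ∈ s, monoSum r L (F i) := by
  classical
  induction s using Finset.induction_on with
  | empty => simp [monoSum_zero_fun]
  | insert i s hi ih => simp only [Finset.sum_insert hi, monoSum_add, ih]

/-! ### Independence of the order: commuting Jucys–Murphy elements. -/

section Perm

/-- The product of the two Jucys–Murphy elements of `a` and `b` does not depend on which of the two
is the larger. The terms containing the transposition of `a` and `b` match the diagonal terms `x =
y` of the other side; off the diagonal the transpositions are disjoint and commute. -/
theorem monoSum_step_comm {a b : I} (hab : a ≠ b) {S : Finset I} (ha : a ∉ S) (hb : b ∉ S)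
    (F : PartPerm I → ℂ) (c : PartPerm I) :
    ∑ x ∈ S, F (PartPerm.swap x b * (PartPerm.swap b a * c)) +
        ∑ y ∈ S, ∑ x ∈ S, F (PartPerm.swap x b * (PartPerm.swap y a * c)) =
      ∑ x ∈ S, F (PartPerm.swap x a * (PartPerm.swap a b * c)) +
        ∑ y ∈ S, ∑ x ∈ S, F (PartPerm.swap x a * (PartPerm.swap y b * c)) := by
  have ne : ∀ {x}, x ∈ S → x ≠ a ∧ x ≠ b := fun hx =>
    ⟨fun h => ha (h ▸ hx), fun h => hb (h ▸ hx)⟩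
  have h1 : ∀ x ∈ S, F (PartPerm.swap x b * (PartPerm.swap b a * c)) =
      F (PartPerm.swap x a * (PartPerm.swap x b * c)) := fun x hx => by
    rw [← mul_assoc, ← mul_assoc,
      PartPerm.swap_mul_swap hab.symm (ne hx).2.symm (ne hx).1.symm]
  have h2 : ∀ x ∈ S, F (PartPerm.swap x a * (PartPerm.swap a b * c)) =
      F (PartPerm.swap x b * (PartPerm.swap x a * c)) := fun x hx => by
    rw [← mul_assoc, ← mul_assoc, PartPerm.swap_mul_swap hab (ne hx).1.symm (ne hx).2.symm]
  rw [Finset.sum_congr rfl h1, Finset.sum_congr rfl h2,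
    Finset.sum_comm (s := S) (t := S)
      (f := fun y x => F (PartPerm.swap x a * (PartPerm.swap y b * c)))]
  have split : ∀ G : I → I → ℂ, ∑ y ∈ S, ∑ x ∈ S, G y x =
      ∑ y ∈ S, G y y + ∑ y ∈ S, ∑ x ∈ S.erase y, G y x := by
    intro G
    rw [← Finset.sum_add_distrib]
    exact Finset.sum_congr rfl fun y hy => (Finset.add_sum_erase S _ hy).symm
  rw [split, split]
  have h3 : ∀ y ∈ S, ∀ x ∈ S.erase y, F (PartPerm.swap x b * (PartPerm.swap y a * c)) =
      F (PartPerm.swap y a * (PartPerm.swap x b * c)) := by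
    intro y hy x hx
    rw [Finset.mem_erase] at hx
    rw [← mul_assoc, ← mul_assoc,
      PartPerm.swap_mul_swap_of_disjoint hab hx.1 (ne hx.2).1 (ne hy).2]
  rw [Finset.sum_congr rfl fun y hy => Finset.sum_congr rfl (h3 y hy)]
  ring

/-- With J_b the sum of the transpositions of `b` with `L`, and J_a that of `a` with `b` and `L`,
the generating series H of the monotone sums satisfies (1 − tJ_b)(1 − tJ_a) H(a, b, L) = H(L). This
is its coefficient of degree `r + 2`; it involves `a` and `b` only through J_a + J_b and J_b J_a,
which are symmetric. -/
theorem monoSum_cons_cons (r : ℕ) (a b : I) (L : List I) (hb : b ∉ L) (F : PartPerm I → ℂ) :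
    monoSum (r + 2) (a :: b :: L) F = monoSum (r + 2) L F +
      monoSum (r + 1) (a :: b :: L) (fun c => ∑ x ∈ L.toFinset, F (PartPerm.swap x b * c) +
        (F (PartPerm.swap b a * c) + ∑ x ∈ L.toFinset, F (PartPerm.swap x a * c))) -
      monoSum r (a :: b :: L) (fun c =>
        ∑ x ∈ L.toFinset, F (PartPerm.swap x b * (PartPerm.swap b a * c)) +
        ∑ y ∈ L.toFinset, ∑ x ∈ L.toFinset,
          F (PartPerm.swap x b * (PartPerm.swap y a * c))) := by
  -- The factor 1 − tJ_a: the sum without `a` is a difference of sums over the full list.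
  have hY : ∀ G, monoSum (r + 1) (b :: L) G = monoSum (r + 1) (a :: b :: L) G -
      monoSum r (a :: b :: L) (fun c => G (PartPerm.swap b a * c) +
        ∑ y ∈ L.toFinset, G (PartPerm.swap y a * c)) := by
    intro G
    rw [monoSum_cons r a, List.toFinset_cons, Finset.sum_insert (by simpa using hb), monoSum_add,
      monoSum_sum]
    ring
  rw [monoSum_cons (r + 1) a, monoSum_cons (r + 1) b, ← monoSum_sum, hY, List.toFinset_cons,
    Finset.sum_insert (by simpa using hb)]
  simp only [monoSum_add, monoSum_sum]
  ring

/-- `monoSum` does not depend on the order of the elements. -/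
theorem monoSum_perm {L L' : List I} (h : L.Perm L') (hnd : L.Nodup) (r : ℕ)
    (F : PartPerm I → ℂ) : monoSum r L F = monoSum r L' F := by
  induction h generalizing r F with
  | nil => rfl
  | @cons d L L' h ih =>
    have hnd' := List.nodup_cons.1 hnd
    induction r generalizing F with
    | zero => rw [monoSum_zero, monoSum_zero]
    | succ r ihr =>
      rw [monoSum_cons, monoSum_cons, ih hnd'.2, List.toFinset_eq_of_perm _ _ h]
      simp only [ihr]
  | swap b a L =>
    simp only [List.nodup_cons, List.mem_cons, not_or] at hnd
    obtain ⟨⟨hab, ha⟩, hb, -⟩ := hnd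
    induction r using Nat.strong_induction_on generalizing F with
    | _ r ih =>
      match r, ih with
      | 0, _ => rw [monoSum_zero, monoSum_zero]
      | 1, _ =>
        simp only [monoSum_cons, monoSum_zero, List.toFinset_cons]
        rw [Finset.sum_insert (by simpa using hb), Finset.sum_insert (by simpa using ha),
          PartPerm.swap_comm b a]
        ring
      -- In the three-term relation the coefficients are symmetric in `a` and `b`, by `swap_comm`
      -- and `monoSum_step_comm`; strong induction treats the shorter sums.
      | r + 2, ih =>
        rw [monoSum_cons_cons _ _ _ _ hb, monoSum_cons_cons _ _ _ _ ha, ih (r + 1) (by omega),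
          ih r (by omega)]
        congr 2
        · congr 2
          funext c
          rw [PartPerm.swap_comm b a]
          ring
        · funext c
          exact monoSum_step_comm hab (by simpa using ha) (by simpa using hb) F c
  | trans h1 h2 ih1 ih2 => rw [ih1 hnd, ih2 (h1.nodup_iff.1 hnd)]

end Perm

theorem monoSum_map {J : Type*} [DecidableEq J] (e : I ↪ J) (ι : PartPerm I → PartPerm J)
    (h1 : ι 1 = 1) (hs : ∀ x y a, ι (PartPerm.swap x y * a) = PartPerm.swap (e x) (e y) * ι a)
    (r : ℕ) (L : List I) (F : PartPerm J → ℂ) :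
    monoSum r (L.map e) F = monoSum r L (fun a => F (ι a)) := by
  induction r, L using monoSum_induction generalizing F with
  | zero L => rw [monoSum_zero, monoSum_zero, h1]
  | nil r => rw [List.map_nil, monoSum_nil, monoSum_nil]
  | cons r d L ih1 ih2 =>
    rw [List.map_cons, monoSum_cons, monoSum_cons, ih1]
    have : (L.map e).toFinset = L.toFinset.map e := by ext; simp
    rw [this, Finset.sum_map]
    simp only [hs]
    congr 1
    refine Finset.sum_congr rfl fun y _ => ?_
    rw [← List.map_cons, ih2]

/-! ### Factorization over two complementary sets of points. -/

section Split

theorem PartPerm.SuppIn.swap_mul {S : Set I} {a : PartPerm I} (ha : a.SuppIn S) {x y : I}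
    (hx : x ∈ S) (hy : y ∈ S) : (PartPerm.swap x y * a).SuppIn S :=
  ⟨orb_mul_le ((orb_swap_le x y).trans le_sup_left) (ha.1.trans le_sup_right),
    sup_le (joinPair_le_iff.2 (Or.inr ⟨hx, hy⟩)) ha.2⟩

theorem monoSum_congr {r : ℕ} {L : List I} (hnd : L.Nodup) {F G : PartPerm I → ℂ}
    (hFG : ∀ a, a.SuppIn {x | x ∈ L} → F a = G a) : monoSum r L F = monoSum r L G :=
  monoSum_congr_of (S := {x | x ∈ L}) (P := fun _ a => a.SuppIn {x | x ∈ L})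
    (PartPerm.suppIn_one _) (fun _ _ _ _ hx hy _ ha => ha.swap_mul hx hy) (fun _ h => h) hnd hFG

theorem PartPerm.swap_mul_comm_of_suppIn {S : Set I} {a : PartPerm I} (ha : a.SuppIn S) {x y : I}
    (hx : x ∉ S) (hy : y ∉ S) : PartPerm.swap x y * a = a * PartPerm.swap x y := by
  refine PartPerm.ext (sup_comm _ _) ?_
  simp only [PartPerm.mul_perm, PartPerm.swap_perm]
  ext z
  rw [Equiv.Perm.mul_apply, Equiv.Perm.mul_apply]
  have hx' := ha.perm_apply hx
  have hy' := ha.perm_apply hy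
  by_cases h1 : z = x
  · subst h1; rw [hx', Equiv.swap_apply_left, hy']
  by_cases h2 : z = y
  · subst h2; rw [hy', Equiv.swap_apply_right, hx']
  rw [Equiv.swap_apply_of_ne_of_ne h1 h2, Equiv.swap_apply_of_ne_of_ne]
  · intro h; exact h1 (a.perm.injective (h.trans hx'.symm))
  · intro h; exact h2 (a.perm.injective (h.trans hy'.symm))

/-- The sequences of transpositions which preserve a set and its complement. -/
theorem monoSum_split (p : I → Bool) {L : List I} (hnd : L.Nodup) (r : ℕ) {F : PartPerm I → ℂ}
    (hF : ∀ a, ¬ a.part ≤ Setoid.ker p → F a = 0) :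
    monoSum r L F = ∑ q ∈ Finset.HasAntidiagonal.antidiagonal r,
      monoSum q.1 (L.filter fun x => p x) fun a =>
        monoSum q.2 (L.filter fun x => !p x) fun b => F (a * b) := by
  induction r, L using monoSum_induction generalizing F with
  | zero L => simp [monoSum_zero]
  | nil r =>
    rw [monoSum_nil]
    refine (Finset.sum_eq_zero fun q hq => ?_).symm
    obtain ⟨q1, q2⟩ := q
    rw [Finset.HasAntidiagonal.mem_antidiagonal] at hq
    simp only at hq
    rcases q1 with _ | q1
    · obtain rfl : q2 = r + 1 := by omega
      simp [monoSum_zero, monoSum_nil]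
    · simp [monoSum_nil]
  | cons r d L ih1 ih2 =>
    have hnd' := List.nodup_cons.1 hnd
    have hF' : ∀ y a, ¬ a.part ≤ Setoid.ker p → F (PartPerm.swap y d * a) = 0 :=
      fun y a ha => hF _ fun h => ha (le_sup_right.trans h)
    have hF'' : ∀ y a, p y ≠ p d → F (PartPerm.swap y d * a) = 0 :=
      fun y a hy => hF _ fun h => hy (joinPair_le_iff.1 (le_sup_left.trans h))
    rw [monoSum_cons, ih1 hnd'.2 hF]
    -- A nonzero term uses a last transposition on the side of its largest element `d`, so it comes
    -- off the factor of that side. Two monotone sequences on the two sides interleave in only one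
    -- way.
    by_cases hd : p d = true
    · have e1 : (d :: L).filter (fun x => p x) = d :: L.filter (fun x => p x) := by simp [hd]
      have e2 : (d :: L).filter (fun x => !p x) = L.filter (fun x => !p x) := by simp [hd]
      have hsum : ∑ y ∈ L.toFinset, monoSum r (d :: L) (fun a => F (PartPerm.swap y d * a)) =
          ∑ y ∈ (L.filter fun x => p x).toFinset,
            monoSum r (d :: L) (fun a => F (PartPerm.swap y d * a)) := by
        refine (Finset.sum_subset (fun y hy => ?_) fun y hy hy' => ?_).symm
        · simp only [List.mem_toFinset, List.mem_filter] at hy ⊢; exact hy.1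
        · simp only [List.mem_toFinset, List.mem_filter, not_and] at hy hy'
          have : p y ≠ p d := fun h => hy' hy (h.trans hd)
          simp only [hF'' y _ this, monoSum_zero_fun]
      rw [hsum, Finset.sum_congr rfl fun y _ => ih2 hnd (hF' y), e1, e2,
        Finset.Nat.antidiagonal_succ, Finset.sum_cons, Finset.sum_cons, Finset.sum_map,
        Finset.sum_map, Finset.sum_comm]
      simp only [Function.Embedding.prodMap, Function.Embedding.coeFn_mk, Prod.map, Nat.succ_eq_add_one,
        Function.Embedding.refl_apply, monoSum_zero, monoSum_cons, Finset.sum_add_distrib,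
        mul_assoc, add_assoc]
    · have hd' : p d = false := by simpa using hd
      have e1 : (d :: L).filter (fun x => p x) = L.filter (fun x => p x) := by simp [hd']
      have e2 : (d :: L).filter (fun x => !p x) = d :: L.filter (fun x => !p x) := by simp [hd']
      have hsum : ∑ y ∈ L.toFinset, monoSum r (d :: L) (fun a => F (PartPerm.swap y d * a)) =
          ∑ y ∈ (L.filter fun x => !p x).toFinset,
            monoSum r (d :: L) (fun a => F (PartPerm.swap y d * a)) := by
        refine (Finset.sum_subset (fun y hy => ?_) fun y hy hy' => ?_).symm
        · simp only [List.mem_toFinset, List.mem_filter] at hy ⊢; exact hy.1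
        · simp only [List.mem_toFinset, List.mem_filter, not_and] at hy hy'
          have : p y ≠ p d := fun h => hy' hy (by simp [h.trans hd'])
          simp only [hF'' y _ this, monoSum_zero_fun]
      rw [hsum, Finset.sum_congr rfl fun y _ => ih2 hnd (hF' y), e1, e2,
        Finset.Nat.antidiagonal_succ', Finset.sum_cons, Finset.sum_cons, Finset.sum_map,
        Finset.sum_map, Finset.sum_comm]
      simp only [Function.Embedding.prodMap, Function.Embedding.coeFn_mk, Prod.map, Nat.succ_eq_add_one,
        Function.Embedding.refl_apply, monoSum_zero, monoSum_cons, monoSum_add, monoSum_sum,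
        Finset.sum_add_distrib, add_assoc]
      congr 2
      refine Finset.sum_congr rfl fun q _ => Finset.sum_congr rfl fun y hy => ?_
      refine monoSum_congr (hnd'.2.filter _) fun a ha => ?_
      congr 1
      funext b
      simp only [List.mem_toFinset, List.mem_filter] at hy
      -- The transposition belongs to the second factor and must cross the first one, whose support
      -- is on the other side.
      rw [← mul_assoc, ← mul_assoc, PartPerm.swap_mul_comm_of_suppIn ha]
      · intro h
        have := (List.mem_filter.1 h).2
        simp [this] at hy
      · intro h
        have := (List.mem_filter.1 h).2
        simp [this] at hd

end Split

end MonoSum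

end

noncomputable section

/-! ## Sums over matchings and monotone sequences of transpositions -/

section SetoidMap

variable {I J : Type*}

/-- Image and preimage of partitions form a Galois connection, so images commute with joins. -/
theorem setoid_map_le_iff {θ : Setoid I} {f : I → J} {η : Setoid J} :
    θ.map f ≤ η ↔ θ ≤ Setoid.comap f η := by
  constructor
  · intro h x y hxy
    exact h (Relation.EqvGen.rel _ _ ⟨x, y, hxy, rfl, rfl⟩)
  · intro h
    apply Setoid.eqvGen_le
    rintro _ _ ⟨x, y, hxy, rfl, rfl⟩
    exact h hxy

theorem setoid_map_sup (θ η : Setoid I) (f : I → J) : (θ ⊔ η).map f = θ.map f ⊔ η.map f :=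
  eq_of_forall_ge_iff fun ζ => by
    rw [setoid_map_le_iff, sup_le_iff, sup_le_iff, setoid_map_le_iff, setoid_map_le_iff]

theorem setoid_map_bot (f : I → J) : (⊥ : Setoid I).map f = ⊥ :=
  le_bot_iff.1 (setoid_map_le_iff.2 bot_le)

theorem joinPair_map (x y : I) (f : I → J) : (joinPair x y).map f = joinPair (f x) (f y) :=
  eq_of_forall_ge_iff fun ζ => by
    rw [setoid_map_le_iff, joinPair_le_iff, joinPair_le_iff, Setoid.comap_rel]

theorem orb_map_of_semiconj (e : I ≃ J) {f : Equiv.Perm I} {g : Equiv.Perm J}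
    (h : ∀ x, e (f x) = g (e x)) : (orb f).map e = orb g :=
  eq_of_forall_ge_iff fun ζ => by
    rw [setoid_map_le_iff, orb_le_iff, orb_le_iff, e.symm.forall_congr_left]
    simp only [Setoid.comap_rel, h, Equiv.symm_symm]

end SetoidMap

namespace PartPerm

variable {I J : Type*} [DecidableEq I] [DecidableEq J]

/-- The extension of a permutation and of a partition by a trivial one. -/
def map (e : I ↪ J) (a : PartPerm I) : PartPerm J :=
  open Classical in ⟨a.part.map e, a.perm.viaEmbedding e⟩

theorem map_perm_apply (e : I ↪ J) (a : PartPerm I) (x : I) :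
    (a.map e).perm (e x) = e (a.perm x) := by
  classical exact Equiv.Perm.viaEmbedding_apply _ _ _

theorem map_perm_apply_of_notMem (e : I ↪ J) (a : PartPerm I) {y : J} (hy : y ∉ Set.range e) :
    (a.map e).perm y = y := by
  classical exact Equiv.Perm.viaEmbedding_apply_of_notMem _ _ _ hy

theorem map_one (e : I ↪ J) : (1 : PartPerm I).map e = 1 := by
  refine PartPerm.ext (setoid_map_bot e) (Equiv.ext fun y => ?_)
  by_cases hy : y ∈ Set.range e
  · obtain ⟨x, rfl⟩ := hy
    rw [map_perm_apply]; rfl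
  · rw [map_perm_apply_of_notMem e _ hy]; rfl

theorem map_swap_mul (e : I ↪ J) (x y : I) (a : PartPerm I) :
    (swap x y * a).map e = swap (e x) (e y) * a.map e := by
  refine PartPerm.ext ?_ (Equiv.ext fun z => ?_)
  · change (joinPair x y ⊔ a.part).map e = joinPair (e x) (e y) ⊔ a.part.map e
    rw [setoid_map_sup, joinPair_map]
  · by_cases hz : z ∈ Set.range e
    · obtain ⟨z, rfl⟩ := hz
      rw [map_perm_apply, mul_perm, mul_perm, Equiv.Perm.mul_apply, Equiv.Perm.mul_apply,
        map_perm_apply, swap_perm, swap_perm, e.injective.map_swap]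
    · rw [map_perm_apply_of_notMem e _ hz, mul_perm, Equiv.Perm.mul_apply,
        map_perm_apply_of_notMem e _ hz, swap_perm, Equiv.swap_apply_of_ne_of_ne]
      · rintro rfl; exact hz ⟨x, rfl⟩
      · rintro rfl; exact hz ⟨y, rfl⟩

end PartPerm

section MapCount

variable {I J : Type*} [Fintype I] [DecidableEq I] [Fintype J] [DecidableEq J] {N : ℕ}

open Classical in
/-- The pairings between the points of sign `1` and those of sign `-1`. -/
def matchings (ε : I → SignType) : Finset (Equiv.Perm I) :=
  Finset.univ.filter fun T => T * T = 1 ∧ (∀ x, ε (T x) = -ε x) ∧ ∀ x, ε x = 0 → T x = x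

theorem mem_matchings {ε : I → SignType} {T : Equiv.Perm I} :
    T ∈ matchings ε ↔ T * T = 1 ∧ (∀ x, ε (T x) = -ε x) ∧ ∀ x, ε x = 0 → T x = x := by
  simp [matchings]

/-- The points of sign `1`. -/
def plusSet (ε : I → SignType) : Finset I := Finset.univ.filter fun x => ε x = 1

@[simp] theorem mem_plusSet {ε : I → SignType} {x : I} : x ∈ plusSet ε ↔ ε x = 1 := by
  simp [plusSet]

/-- The Euler characteristic of the map given by the rotation `γ⁻¹` around the white vertices, the
matching `T` and the product `a` of `r` transpositions. -/
def eulerChar (r : ℕ) (γ : Equiv.Perm I) (ε : I → SignType) (T : Equiv.Perm I) (a : PartPerm I) :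
    ℤ :=
  numCycles γ + numCycles (a.perm * T * γ⁻¹) - (plusSet ε).card - r

/-- The trace attached to the faces of a map. -/
def faceTrace (γ T : Equiv.Perm I) (B : I → Matrix (Fin N) (Fin N) ℂ) (a : PartPerm I) : ℂ :=
  ntrPerm (a.perm * T * γ⁻¹)⁻¹ B

open Classical in
/-- The sum over the maps with `r` black vertices, Euler characteristic `χ` and partition
into connected components `η`. -/
def mapCount (r : ℕ) (χ : ℤ) (η : Setoid I) (γ : Equiv.Perm I) (ε : I → SignType)
    (B : I → Matrix (Fin N) (Fin N) ℂ) : ℂ :=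
  ∑ T ∈ matchings ε, monoSum r (plusSet ε).toList fun a =>
    if orb γ ⊔ orb T ⊔ a.part = η ∧ eulerChar r γ ε T a = χ then faceTrace γ T B a else 0

theorem monoSum_toList {S : Finset I} {L : List I} (hnd : L.Nodup) (h : ∀ x, x ∈ L ↔ x ∈ S)
    (r : ℕ) (F : PartPerm I → ℂ) : monoSum r S.toList F = monoSum r L F := by
  refine monoSum_perm ?_ S.nodup_toList r F
  rw [List.perm_ext_iff_of_nodup S.nodup_toList hnd]
  simp [h]

/-- The relabelling need not respect any order, because `monoSum` does not depend on one. This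
freedom is needed after surgery, when the words, hence the labels, are rearranged. -/
theorem mapCount_equiv (e : I ≃ J) {γ : Equiv.Perm I} {γ' : Equiv.Perm J} {ε : I → SignType}
    {ε' : J → SignType} {B : I → Matrix (Fin N) (Fin N) ℂ} {B' : J → Matrix (Fin N) (Fin N) ℂ}
    {η : Setoid I} {η' : Setoid J} (hγ : ∀ x, e (γ x) = γ' (e x)) (hε : ∀ x, ε' (e x) = ε x)
    (hB : ∀ x, B' (e x) = B x) (hη : ∀ x y, η' (e x) (e y) ↔ η x y) (r : ℕ) (χ : ℤ) :
    mapCount r χ η' γ' ε' B' = mapCount r χ η γ ε B := by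
  classical
  have hη' : η.map e = η' := by
    refine le_antisymm (setoid_map_le_iff.2 fun {x y} h => (hη x y).2 h) fun {x y} h => ?_
    obtain ⟨x, rfl⟩ := e.surjective x
    obtain ⟨y, rfl⟩ := e.surjective y
    exact Relation.EqvGen.rel _ _ ⟨x, y, (hη x y).1 h, rfl, rfl⟩
  have hcard : (plusSet ε').card = (plusSet ε).card := by
    refine (Finset.card_bij (fun x _ => e x) ?_ ?_ ?_).symm
    · intro x hx; simpa [hε] using hx
    · intro x _ y _ h; exact e.injective h
    · intro y hy
      exact ⟨e.symm y, by rw [mem_plusSet, ← hε]; simpa using hy, by simp⟩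
  symm
  refine Finset.sum_bij (fun T _ => e.permCongr T) ?_ ?_ ?_ ?_
  · intro T hT
    rw [mem_matchings] at hT ⊢
    refine ⟨?_, fun y => ?_, fun y hy => ?_⟩
    · ext y
      have := Equiv.ext_iff.1 hT.1 (e.symm y)
      simp only [Equiv.Perm.mul_apply, Equiv.Perm.one_apply] at this
      simp [this]
    · rw [Equiv.permCongr_apply, hε, hT.2.1, ← hε, Equiv.apply_symm_apply]
    · rw [Equiv.permCongr_apply, hT.2.2, Equiv.apply_symm_apply]
      rw [← hε, Equiv.apply_symm_apply, hy]
  · intro T _ T' _ h; exact e.permCongr.injective h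
  · intro T hT
    refine ⟨e.permCongr.symm T, ?_, e.permCongr.apply_symm_apply T⟩
    rw [mem_matchings] at hT ⊢
    refine ⟨?_, fun y => ?_, fun y hy => ?_⟩
    · ext y
      have := Equiv.ext_iff.1 hT.1 (e y)
      simp only [Equiv.Perm.mul_apply, Equiv.Perm.one_apply] at this
      simp [Equiv.permCongr_symm, this]
    · rw [Equiv.permCongr_symm, Equiv.permCongr_apply, ← hε, Equiv.apply_symm_apply,
        Equiv.symm_symm, hT.2.1, hε]
    · rw [Equiv.permCongr_symm, Equiv.permCongr_apply, Equiv.symm_symm, hT.2.2 _ (by rw [hε, hy]),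
        Equiv.symm_apply_apply]
  · intro T _
    rw [monoSum_toList (S := plusSet ε') (L := (plusSet ε).toList.map e.toEmbedding)
      ((Finset.nodup_toList _).map e.injective) ?_,
      monoSum_map e.toEmbedding (PartPerm.map e.toEmbedding) (PartPerm.map_one _)
        (PartPerm.map_swap_mul _)]
    · congr 1
      funext a
      have hT : ∀ x, e (T x) = e.permCongr T (e x) := fun x => by simp
      have hf : ∀ x, e ((a.perm * T * γ⁻¹) x) =
          ((a.map e.toEmbedding).perm * e.permCongr T * γ'⁻¹) (e x) := by
        intro x
        have h1 : γ'⁻¹ (e x) = e (γ⁻¹ x) := by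
          rw [Equiv.Perm.inv_eq_iff_eq, ← hγ]; simp
        rw [Equiv.Perm.mul_apply, Equiv.Perm.mul_apply, Equiv.Perm.mul_apply,
          Equiv.Perm.mul_apply, h1, ← hT]
        exact (PartPerm.map_perm_apply e.toEmbedding a _).symm
      have hf' : ∀ x, e ((a.perm * T * γ⁻¹)⁻¹ x) =
          ((a.map e.toEmbedding).perm * e.permCongr T * γ'⁻¹)⁻¹ (e x) := by
        intro x
        rw [eq_comm, Equiv.Perm.inv_eq_iff_eq, ← hf]; simp
      have h1 : eulerChar r γ' ε' (e.permCongr T) (a.map e.toEmbedding) = eulerChar r γ ε T a := by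
        rw [eulerChar, eulerChar, hcard, numCycles_conj e _ _ hf, numCycles_conj e _ _ hγ]
      have h2 : faceTrace γ' (e.permCongr T) B' (a.map e.toEmbedding) = faceTrace γ T B a := by
        rw [faceTrace, faceTrace, ntrPerm_conj e _ _ hf']
        simp only [hB]
      have h3 : orb γ' ⊔ orb (e.permCongr T) ⊔ (a.map e.toEmbedding).part = η' ↔
          orb γ ⊔ orb T ⊔ a.part = η := by
        have h4 : orb γ' ⊔ orb (e.permCongr T) ⊔ (a.map e.toEmbedding).part =
            (orb γ ⊔ orb T ⊔ a.part).map e := by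
          rw [setoid_map_sup, setoid_map_sup, orb_map_of_semiconj e hγ, orb_map_of_semiconj e hT]
          rfl
        rw [h4, ← hη']
        constructor
        · intro h
          have := congrArg (Setoid.comap e) h
          rwa [Setoid.comap_map_eq _ _ e.injective, Setoid.comap_map_eq _ _ e.injective] at this
        · intro h; rw [h]
      rw [h1, h2, if_congr (and_congr_left fun _ => h3) rfl rfl]
    · intro y
      simp only [List.mem_map, Finset.mem_toList, mem_plusSet, Equiv.coe_toEmbedding]
      constructor
      · rintro ⟨x, hx, rfl⟩; rw [hε, hx]
      · intro hy
        exact ⟨e.symm y, by rw [← hε, Equiv.apply_symm_apply, hy], by simp⟩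

/-! ### Nonnegativity of the genus. -/

section Genus

/-- The signs after the removal of two points. -/
def killPair (ε : I → SignType) (x y : I) : I → SignType :=
  fun z => if z = x ∨ z = y then 0 else ε z

theorem mul_swap_mem_matchings {ε : I → SignType} {T : Equiv.Perm I} (hT : T ∈ matchings ε)
    (x d : I) (hTd : T d = x) : T * Equiv.swap x d ∈ matchings (killPair ε x d) := by
  rw [mem_matchings] at hT ⊢
  obtain ⟨h1, h2, h3⟩ := hT
  have hTT : ∀ z, T (T z) = z := fun z => Equiv.ext_iff.1 h1 z
  have hTx : T x = d := by rw [← hTd, hTT]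
  have hfix : ∀ z, z = x ∨ z = d → (T * Equiv.swap x d) z = z := by
    rintro z (rfl | rfl)
    · rw [Equiv.Perm.mul_apply, Equiv.swap_apply_left, hTd]
    · rw [Equiv.Perm.mul_apply, Equiv.swap_apply_right, hTx]
  have hmove : ∀ z, ¬ (z = x ∨ z = d) → (T * Equiv.swap x d) z = T z := by
    intro z hz
    rw [not_or] at hz
    rw [Equiv.Perm.mul_apply, Equiv.swap_apply_of_ne_of_ne hz.1 hz.2]
  have hmem : ∀ z, ¬ (z = x ∨ z = d) → ¬ (T z = x ∨ T z = d) := by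
    rintro z hz (h | h)
    · exact hz (Or.inr (T.injective (h.trans hTd.symm)))
    · exact hz (Or.inl (T.injective (h.trans hTx.symm)))
  refine ⟨?_, fun z => ?_, fun z hz => ?_⟩
  · ext z
    rw [Equiv.Perm.mul_apply, Equiv.Perm.one_apply]
    by_cases hz : z = x ∨ z = d
    · rw [hfix z hz, hfix z hz]
    · rw [hmove z hz, hmove _ (hmem z hz), hTT]
  · by_cases hz : z = x ∨ z = d
    · rw [hfix z hz, killPair, if_pos hz]; decide
    · rw [hmove z hz, killPair, killPair, if_neg hz, if_neg (hmem z hz), h2]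
  · by_cases hz' : z = x ∨ z = d
    · exact hfix z hz'
    · rw [hmove z hz']
      rw [killPair, if_neg hz'] at hz
      exact h3 z hz

theorem plusSet_killPair {ε : I → SignType} {x d : I} (hx : ε x ≠ 1) :
    plusSet (killPair ε x d) = (plusSet ε).erase d := by
  ext z
  rw [Finset.mem_erase, mem_plusSet, mem_plusSet, killPair]
  by_cases hz : z = x ∨ z = d
  · rw [if_pos hz]
    rcases hz with rfl | rfl
    · simp [hx]
    · simp
  · rw [if_neg hz]
    rw [not_or] at hz
    simp [hz.2]

theorem orb_mul_swap {T : Equiv.Perm I} {x d : I} (hTd : T d = x) :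
    orb T = orb (T * Equiv.swap x d) ⊔ joinPair x d := by
  have hx : joinPair x d ≤ orb T := by
    rw [joinPair_le_iff, ← hTd]; exact Setoid.symm' _ (orb_rel T d)
  refine le_antisymm ?_ (sup_le (orb_mul_le le_rfl ((orb_swap_le x d).trans hx)) hx)
  have : T = T * Equiv.swap x d * Equiv.swap x d := by
    rw [mul_assoc, Equiv.swap_mul_self, mul_one]
  conv_lhs => rw [this]
  exact orb_mul_le le_sup_left ((orb_swap_le x d).trans le_sup_right)

theorem swap_mul_eq_mul_swap {T : Equiv.Perm I} {x d : I} (hd : T d = d) (hx : T x = x) :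
    Equiv.swap x d * T = T * Equiv.swap x d := by
  rw [Equiv.swap_mul_eq_mul_swap]
  have h1 : T⁻¹ x = x := by rw [Equiv.Perm.inv_eq_iff_eq, hx]
  have h2 : T⁻¹ d = d := by rw [Equiv.Perm.inv_eq_iff_eq, hd]
  rw [h1, h2]

/-- The matched pairs are added one at a time, each multiplying the face permutation by a
transposition, so `euler_step` applies. Without pairs the faces are the inverses of the vertices and
the Euler characteristic is twice the number of components. -/
theorem euler_matching (γ : Equiv.Perm I) (n : ℕ) {ε : I → SignType} {T : Equiv.Perm I}
    (hT : T ∈ matchings ε) (hn : (plusSet ε).card = n) :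
    (numCycles γ - n + numCycles (T * γ⁻¹) : ℤ) ≤ 2 * numClasses (orb γ ⊔ orb T) ∧
      Even (numCycles γ - n + numCycles (T * γ⁻¹) : ℤ) := by
  induction n generalizing ε T with
  | zero =>
    rw [mem_matchings] at hT
    have h1 : ∀ x, ε x ≠ 1 := by
      intro x hx
      have : x ∈ plusSet ε := mem_plusSet.2 hx
      rw [Finset.card_eq_zero] at hn
      simp [hn] at this
    have hT1 : T = 1 := by
      ext x
      refine hT.2.2 x ?_
      rcases hx : ε x with _ | _ | _
      · rfl
      · refine absurd ?_ (h1 (T x))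
        rw [hT.2.1, hx]; rfl
      · exact absurd hx (h1 x)
    have h2 : orb (1 : Equiv.Perm I) = ⊥ := le_bot_iff.1 (orb_le_iff.2 fun _ => rfl)
    rw [hT1, one_mul, numCycles_eq γ⁻¹, orb_inv, h2, sup_bot_eq, ← numCycles_eq]
    push_cast
    exact ⟨by linarith, numCycles γ, by ring⟩
  | succ n ih =>
    obtain ⟨d, hd⟩ : (plusSet ε).Nonempty := Finset.card_pos.1 (by omega)
    have hdε := mem_plusSet.1 hd
    obtain ⟨x, hx⟩ : ∃ x, T d = x := ⟨_, rfl⟩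
    have hT' := mem_matchings.1 hT
    have hxε : ε x = -1 := by rw [← hx, hT'.2.1, hdε]
    have hxd : x ≠ d := by
      rintro rfl; rw [hdε] at hxε; exact absurd hxε (by decide)
    have hm := mul_swap_mem_matchings hT x d hx
    have hcard : (plusSet (killPair ε x d)).card = n := by
      rw [plusSet_killPair (by rw [hxε]; decide), Finset.card_erase_of_mem hd, hn]; rfl
    obtain ⟨i1, i2⟩ := ih hm hcard
    have hm' := mem_matchings.1 hm
    have hcomm := swap_mul_eq_mul_swap (x := x) (d := d)
      (hm'.2.2 d (by simp [killPair])) (hm'.2.2 x (by simp [killPair]))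
    -- The matching with its pair `x`, `d` deleted fixes both points, so it commutes with their
    -- transposition, which can be put in front.
    have hTs : T * γ⁻¹ = Equiv.swap x d * (T * Equiv.swap x d * γ⁻¹) := by
      rw [← mul_assoc, hcomm, mul_assoc T, Equiv.swap_mul_self, mul_one]
    have := euler_step (f := T * Equiv.swap x d * γ⁻¹)
      (θ := orb γ ⊔ orb (T * Equiv.swap x d))
      (orb_mul_le le_sup_right (by rw [orb_inv]; exact le_sup_left)) hxd i1 i2
    rw [← hTs, sup_assoc, ← orb_mul_swap hx] at this
    push_cast
    refine ⟨le_trans (le_of_eq ?_) this.1, ?_⟩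
    · ring
    · obtain ⟨k, hk⟩ := this.2
      exact ⟨k, by rw [← hk]; ring⟩

/-- The Euler characteristic is even, and at most twice the number of components. -/
def EulerBound (γ : Equiv.Perm I) (ε : I → SignType) (T : Equiv.Perm I) (r : ℕ)
    (a : PartPerm I) : Prop :=
  orb a.perm ≤ a.part ∧ eulerChar r γ ε T a ≤ 2 * numClasses (orb γ ⊔ orb T ⊔ a.part) ∧
    Even (eulerChar r γ ε T a)

theorem eulerBound_one (γ : Equiv.Perm I) {ε : I → SignType} {T : Equiv.Perm I}
    (hT : T ∈ matchings ε) : EulerBound γ ε T 0 1 := by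
  obtain ⟨h1, h2⟩ := euler_matching γ _ hT rfl
  have he : eulerChar 0 γ ε T 1 = numCycles γ - (plusSet ε).card + numCycles (T * γ⁻¹) := by
    rw [eulerChar, PartPerm.one_perm, one_mul]; push_cast; ring
  refine ⟨orb_le_iff.2 fun _ => rfl, ?_, ?_⟩
  · rw [he, PartPerm.one_part, sup_bot_eq]; exact h1
  · rw [he]; exact h2

/-- A further black vertex multiplies the face permutation by a transposition, and the term −r loses
one more: exactly the situation of `euler_step`. -/
theorem EulerBound.swap_mul {γ : Equiv.Perm I} {ε : I → SignType} {T : Equiv.Perm I} {r : ℕ}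
    {a : PartPerm I} (h : EulerBound γ ε T r a) {x y : I} (hxy : x ≠ y) :
    EulerBound γ ε T (r + 1) (PartPerm.swap x y * a) := by
  obtain ⟨h0, h1, h2⟩ := h
  have := euler_step (f := a.perm * T * γ⁻¹) (θ := orb γ ⊔ orb T ⊔ a.part)
    (orb_mul_le (orb_mul_le (h0.trans le_sup_right) (le_sup_right.trans le_sup_left))
      (by rw [orb_inv]; exact le_sup_left.trans le_sup_left)) hxy
    (c := numCycles γ - (plusSet ε).card - r)
    (by rw [eulerChar] at h1; linarith)
    (by obtain ⟨k, hk⟩ := h2; exact ⟨k, by rw [eulerChar] at hk; linarith⟩)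
  have he : eulerChar (r + 1) γ ε T (PartPerm.swap x y * a) =
      numCycles γ - (plusSet ε).card - r +
        numCycles (Equiv.swap x y * (a.perm * T * γ⁻¹)) - 1 := by
    rw [eulerChar, PartPerm.mul_perm, PartPerm.swap_perm, mul_assoc, mul_assoc, mul_assoc]
    push_cast; ring
  refine ⟨orb_mul_le ((orb_swap_le x y).trans le_sup_left) (h0.trans le_sup_right), ?_, ?_⟩
  · rw [he, PartPerm.mul_part, PartPerm.swap_part, sup_comm (joinPair x y), ← sup_assoc]
    exact this.1
  · rw [he]; exact this.2

theorem monoSum_congr_euler (γ : Equiv.Perm I) {ε : I → SignType} {T : Equiv.Perm I}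
    (hT : T ∈ matchings ε) {r : ℕ} {L : List I} (hnd : L.Nodup) {F G : PartPerm I → ℂ}
    (hFG : ∀ a, EulerBound γ ε T r a → F a = G a) : monoSum r L F = monoSum r L G :=
  monoSum_congr_of (S := Set.univ) (P := fun r a => EulerBound γ ε T r a) (eulerBound_one γ hT)
    (fun _ _ _ _ _ _ hxy h => h.swap_mul hxy) (fun _ _ => Set.mem_univ _) hnd hFG

/-- There are no connected maps of negative genus. -/
theorem mapCount_top_eq_zero [Nonempty I] (r : ℕ) {χ : ℤ} (hχ : 2 < χ) (γ : Equiv.Perm I)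
    (ε : I → SignType) (B : I → Matrix (Fin N) (Fin N) ℂ) : mapCount r χ ⊤ γ ε B = 0 := by
  classical
  refine Finset.sum_eq_zero fun T hT => ?_
  rw [monoSum_congr_euler γ hT (Finset.nodup_toList _) (G := fun _ => 0), monoSum_zero_fun]
  intro a ha
  rw [if_neg]
  rintro ⟨h1, h2⟩
  have := ha.2.1
  rw [h1, numClasses_top, h2] at this
  push_cast at this
  linarith

theorem numCycles_le_card (f : Equiv.Perm I) : numCycles f ≤ Fintype.card I := by
  rw [← Nat.card_eq_fintype_card]
  exact Nat.card_le_card_of_surjective _ Quotient.mk_surjective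

/-- The number of black vertices is bounded in terms of the genus. -/
theorem mapCount_eq_zero_of_lt (r : ℕ) {χ : ℤ} (η : Setoid I) (γ : Equiv.Perm I)
    (ε : I → SignType) (B : I → Matrix (Fin N) (Fin N) ℂ)
    (h : 2 * (Fintype.card I : ℤ) < r + χ) : mapCount r χ η γ ε B = 0 := by
  classical
  refine Finset.sum_eq_zero fun T hT => ?_
  have : ∀ a : PartPerm I, eulerChar r γ ε T a ≠ χ := by
    intro a ha
    have h1 := numCycles_le_card γ
    have h2 := numCycles_le_card (a.perm * T * γ⁻¹)
    rw [eulerChar] at ha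
    have h1' : (numCycles γ : ℤ) ≤ Fintype.card I := by exact_mod_cast h1
    have h2' : (numCycles (a.perm * T * γ⁻¹) : ℤ) ≤ Fintype.card I := by exact_mod_cast h2
    have : (0 : ℤ) ≤ (plusSet ε).card := by positivity
    linarith
  simp only [this, and_false, if_false, monoSum_zero_fun]

end Genus

end MapCount

end

noncomputable section

/-! ## Removal of a black vertex or of an edge -/

section Peel

variable {I : Type*} [Fintype I] [DecidableEq I] {N : ℕ}

open Classical in
/-- The sum over the maps which become connected when `x` and `d` are connected. -/
def cutCount (r : ℕ) (χ : ℤ) (γ : Equiv.Perm I) (ε : I → SignType)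
    (B : I → Matrix (Fin N) (Fin N) ℂ) (x d : I) : ℂ :=
  ∑ T ∈ matchings ε, monoSum r (plusSet ε).toList fun a =>
    if orb γ ⊔ orb T ⊔ a.part ⊔ joinPair x d = ⊤ ∧ eulerChar r γ ε T a = χ
    then faceTrace γ T B a else 0

/-- The points of sign `-1`. -/
def minusSet (ε : I → SignType) : Finset I := Finset.univ.filter fun x => ε x = -1

@[simp] theorem mem_minusSet {ε : I → SignType} {x : I} : x ∈ minusSet ε ↔ ε x = -1 := by
  simp [minusSet]

theorem numCycles_swap_conj (f : Equiv.Perm I) (x d : I) (g : Equiv.Perm I)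
    (h : Equiv.swap x d * f = g * Equiv.swap x d) : numCycles g = numCycles f :=
  numCycles_conj (Equiv.swap x d) f g fun z => Equiv.ext_iff.1 h z

theorem ntrPerm_swap_conj (f : Equiv.Perm I) (x d : I) (g : Equiv.Perm I)
    (h : Equiv.swap x d * f = g * Equiv.swap x d) (B : I → Matrix (Fin N) (Fin N) ℂ) :
    ntrPerm g⁻¹ (fun z => B (Equiv.swap x d z)) = ntrPerm f⁻¹ B := by
  rw [ntrPerm_conj (Equiv.swap x d) f⁻¹ g⁻¹]
  · simp only [Equiv.swap_apply_self]
  · intro z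
    rw [eq_comm, Equiv.Perm.inv_eq_iff_eq, ← Equiv.Perm.mul_apply g, ← h]
    simp

variable {γ : Equiv.Perm I} {ε : I → SignType} {B : I → Matrix (Fin N) (Fin N) ℂ}

/-- The terms in which no transposition touches `d`, sorted by its partner `x = T d`. Deleting the
pair from the matching and putting the transposition into the rotation conjugates the face
permutation, which is why the matrices of `x` and `d` are exchanged. Connectedness is kept by
remembering that `x` and `d` are linked. -/
theorem sum_unmatched_eq_cutCount {d : I} (hd : ε d = 1) (r : ℕ) (χ : ℤ) :
    open Classical in
    ∑ T ∈ matchings ε, monoSum r ((plusSet ε).erase d).toList (fun a =>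
      if orb γ ⊔ orb T ⊔ a.part = ⊤ ∧ eulerChar r γ ε T a = χ then faceTrace γ T B a else 0) =
    ∑ x ∈ minusSet ε,
      cutCount r (χ + 1 + numCycles (Equiv.swap x d * γ) - numCycles γ) (Equiv.swap x d * γ)
        (killPair ε x d) (fun z => B (Equiv.swap x d z)) x d := by
  classical
  rw [← Finset.sum_fiberwise_of_maps_to (s := matchings ε) (t := minusSet ε) (g := fun T => T d)
    (fun T hT => by rw [mem_minusSet, (mem_matchings.1 hT).2.1, hd])]
  refine Finset.sum_congr rfl fun x hx => ?_
  rw [mem_minusSet] at hx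
  have hx1 : ε x ≠ 1 := by rw [hx]; decide
  have hplus := plusSet_killPair (d := d) hx1
  have hxd : x ≠ d := by rintro rfl; exact hx1 hd
  have hcard : ((plusSet ε).card : ℤ) = (plusSet (killPair ε x d)).card + 1 := by
    rw [hplus]
    have := Finset.card_erase_add_one (mem_plusSet.2 hd)
    exact_mod_cast this.symm
  rw [cutCount]
  refine Finset.sum_bij (fun T _ => T * Equiv.swap x d) ?_ ?_ ?_ ?_
  · intro T hT
    rw [Finset.mem_filter] at hT
    exact mul_swap_mem_matchings hT.1 x d hT.2
  · intro T _ T' _ h; exact mul_right_cancel h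
  · intro T hT
    refine ⟨T * Equiv.swap x d, ?_, by rw [mul_assoc, Equiv.swap_mul_self, mul_one]⟩
    rw [mem_matchings] at hT
    obtain ⟨h1, h2, h3⟩ := hT
    have hTT : ∀ z, T (T z) = z := fun z => Equiv.ext_iff.1 h1 z
    have hTx : T x = x := h3 x (by simp [killPair])
    have hTd : T d = d := h3 d (by simp [killPair])
    have hmem : ∀ z, z ≠ x → z ≠ d → T z ≠ x ∧ T z ≠ d := fun z hz1 hz2 =>
      ⟨fun h => hz1 (T.injective (h.trans hTx.symm)),
        fun h => hz2 (T.injective (h.trans hTd.symm))⟩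
    have hε' : ∀ z, z ≠ x → z ≠ d → killPair ε x d z = ε z := fun z hz1 hz2 => by
      rw [killPair, if_neg]; rintro (h | h) <;> contradiction
    rw [Finset.mem_filter, mem_matchings]
    refine ⟨⟨?_, ?_, ?_⟩, ?_⟩
    · rw [mul_assoc, ← mul_assoc (Equiv.swap x d), swap_mul_eq_mul_swap hTd hTx, mul_assoc,
        Equiv.swap_mul_self, mul_one, h1]
    · intro z
      rw [Equiv.Perm.mul_apply]
      by_cases hz1 : z = x
      · subst hz1; rw [Equiv.swap_apply_left, hTd, hd, hx]; decide
      by_cases hz2 : z = d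
      · subst hz2; rw [Equiv.swap_apply_right, hTx, hd, hx]
      rw [Equiv.swap_apply_of_ne_of_ne hz1 hz2, ← hε' z hz1 hz2, ← h2,
        hε' _ (hmem z hz1 hz2).1 (hmem z hz1 hz2).2]
    · intro z hz
      have hz1 : z ≠ x := by rintro rfl; rw [hx] at hz; exact absurd hz (by decide)
      have hz2 : z ≠ d := by rintro rfl; rw [hd] at hz; exact absurd hz (by decide)
      rw [Equiv.Perm.mul_apply, Equiv.swap_apply_of_ne_of_ne hz1 hz2]
      exact h3 z (by rw [hε' z hz1 hz2, hz])
    · rw [Equiv.Perm.mul_apply, Equiv.swap_apply_right, hTx]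
  · intro T hT
    rw [Finset.mem_filter] at hT
    obtain ⟨hT, hTd⟩ := hT
    have hm := mem_matchings.1 (mul_swap_mem_matchings hT x d hTd)
    rw [hplus]
    refine monoSum_congr (Finset.nodup_toList _) fun a ha => ?_
    have had : a.perm d = d := ha.perm_apply (by simp)
    have hax : a.perm x = x := ha.perm_apply (by simp [hx1])
    -- Both factors fix `x` and `d`: the product `a` moves only points of sign 1 other than `d`, and
    -- `x` has sign −1.
    have hcomm : Equiv.swap x d * (a.perm * (T * Equiv.swap x d)) =
        a.perm * (T * Equiv.swap x d) * Equiv.swap x d := by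
      refine swap_mul_eq_mul_swap ?_ ?_
      · rw [Equiv.Perm.mul_apply, hm.2.2 d (by simp [killPair]), had]
      · rw [Equiv.Perm.mul_apply, hm.2.2 x (by simp [killPair]), hax]
    have hconj : Equiv.swap x d * (a.perm * T * γ⁻¹) =
        a.perm * (T * Equiv.swap x d) * (Equiv.swap x d * γ)⁻¹ * Equiv.swap x d := by
      have h1 : Equiv.swap x d * (a.perm * T) = a.perm * (T * Equiv.swap x d) := by
        have h2 : a.perm * T = a.perm * (T * Equiv.swap x d) * Equiv.swap x d := by
          rw [mul_assoc, mul_assoc, Equiv.swap_mul_self, mul_one]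
        rw [h2, ← hcomm, ← mul_assoc, Equiv.swap_mul_self, one_mul]
      rw [mul_inv_rev, Equiv.swap_inv, ← mul_assoc, h1]
      simp only [mul_assoc, Equiv.swap_mul_self, mul_one]
    refine if_congr (and_congr ?_ ?_) ?_ rfl
    · rw [orb_mul_swap hTd]
      have := orb_swap_mul_sup γ x d
      have e1 : orb γ ⊔ (orb (T * Equiv.swap x d) ⊔ joinPair x d) ⊔ a.part =
          (orb γ ⊔ joinPair x d) ⊔ (orb (T * Equiv.swap x d) ⊔ a.part) := by
        ac_rfl
      have e2 : orb (Equiv.swap x d * γ) ⊔ orb (T * Equiv.swap x d) ⊔ a.part ⊔ joinPair x d =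
          (orb (Equiv.swap x d * γ) ⊔ joinPair x d) ⊔ (orb (T * Equiv.swap x d) ⊔ a.part) := by
        ac_rfl
      rw [e1, e2, this]
    · rw [eulerChar, eulerChar, numCycles_swap_conj _ _ _ _ hconj, hcard]
      constructor <;> intro h <;> linarith
    · rw [faceTrace, faceTrace, ntrPerm_swap_conj _ _ _ _ hconj]

/-- The leftmost transposition is moved into the rotation by conjugating the face permutation with
it. The signs of `x` and `d` stay, only the number of black vertices drops. -/
theorem monoSum_swap_mul_eq_cut {x d : I} {T : Equiv.Perm I} (r : ℕ) (χ : ℤ) :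
    open Classical in
    monoSum r (plusSet ε).toList (fun a =>
      if orb γ ⊔ orb T ⊔ (PartPerm.swap x d * a).part = ⊤ ∧
        eulerChar (r + 1) γ ε T (PartPerm.swap x d * a) = χ
      then faceTrace γ T B (PartPerm.swap x d * a) else 0) =
    monoSum r (plusSet ε).toList (fun a =>
      if orb (Equiv.swap x d * γ) ⊔ orb T ⊔ a.part ⊔ joinPair x d = ⊤ ∧
        eulerChar r (Equiv.swap x d * γ) ε T a =
          χ + 1 + numCycles (Equiv.swap x d * γ) - numCycles γ
      then faceTrace (Equiv.swap x d * γ) T (fun z => B (Equiv.swap x d z)) a else 0) := by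
  classical
  congr 1
  funext a
  have hconj : Equiv.swap x d * ((PartPerm.swap x d * a).perm * T * γ⁻¹) =
      a.perm * T * (Equiv.swap x d * γ)⁻¹ * Equiv.swap x d := by
    rw [PartPerm.mul_perm, PartPerm.swap_perm, mul_inv_rev, Equiv.swap_inv]
    simp only [mul_assoc, Equiv.swap_mul_self, mul_one]
    rw [← mul_assoc, Equiv.swap_mul_self, one_mul]
  refine if_congr (and_congr ?_ ?_) ?_ rfl
  · rw [PartPerm.mul_part, PartPerm.swap_part]
    have := orb_swap_mul_sup γ x d
    have e1 : orb γ ⊔ orb T ⊔ (joinPair x d ⊔ a.part) =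
        (orb γ ⊔ joinPair x d) ⊔ (orb T ⊔ a.part) := by
      ac_rfl
    have e2 : orb (Equiv.swap x d * γ) ⊔ orb T ⊔ a.part ⊔ joinPair x d =
        (orb (Equiv.swap x d * γ) ⊔ joinPair x d) ⊔ (orb T ⊔ a.part) := by
      ac_rfl
    rw [e1, e2, this]
  · rw [eulerChar, eulerChar, numCycles_swap_conj _ _ _ _ hconj]
    push_cast
    constructor <;> intro h <;> linarith
  · rw [faceTrace, faceTrace, ntrPerm_swap_conj _ _ _ _ hconj]

/-- The maps without black vertices, by the edge of `d`. -/
theorem mapCount_zero_eq {d : I} (hd : ε d = 1) (χ : ℤ) :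
    mapCount 0 χ ⊤ γ ε B = ∑ x ∈ minusSet ε,
      cutCount 0 (χ + 1 + numCycles (Equiv.swap x d * γ) - numCycles γ) (Equiv.swap x d * γ)
        (killPair ε x d) (fun z => B (Equiv.swap x d z)) x d := by
  classical
  rw [← sum_unmatched_eq_cutCount hd, mapCount]
  simp only [monoSum_zero]

/-- The maps with black vertices: the edge of `d` ends at a white vertex, or the last black vertex
is the transposition of `d` with some `x`. -/
theorem mapCount_succ_eq {d : I} (hd : ε d = 1) (r : ℕ) (χ : ℤ) :
    mapCount (r + 1) χ ⊤ γ ε B = ∑ x ∈ minusSet ε,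
        cutCount (r + 1) (χ + 1 + numCycles (Equiv.swap x d * γ) - numCycles γ)
          (Equiv.swap x d * γ) (killPair ε x d) (fun z => B (Equiv.swap x d z)) x d +
      ∑ x ∈ (plusSet ε).erase d,
        cutCount r (χ + 1 + numCycles (Equiv.swap x d * γ) - numCycles γ)
          (Equiv.swap x d * γ) ε (fun z => B (Equiv.swap x d z)) x d := by
  classical
  -- Since the order is irrelevant, `d` is placed first, as the largest element; every transposition
  -- involving it then comes at the end of the sequence.
  have hnd : (d :: ((plusSet ε).erase d).toList).Nodup := by
    rw [List.nodup_cons]; exact ⟨by simp, Finset.nodup_toList _⟩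
  have hmem : ∀ z, z ∈ (d :: ((plusSet ε).erase d).toList) ↔ z ∈ plusSet ε := by
    intro z
    by_cases hz : z = d
    · subst hz; simp [hd]
    · simp [hz]
  rw [← sum_unmatched_eq_cutCount hd, mapCount]
  simp only [cutCount]
  rw [Finset.sum_comm, ← Finset.sum_add_distrib]
  refine Finset.sum_congr rfl fun T hT => ?_
  rw [monoSum_toList hnd hmem, monoSum_cons, Finset.toList_toFinset]
  congr 1
  refine Finset.sum_congr rfl fun x hx => ?_
  rw [← monoSum_swap_mul_eq_cut, monoSum_toList hnd hmem]

/-- The case of a join: `x` and `d` lie on a common vertex, and linking them adds nothing. -/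
theorem cutCount_of_rel {x d : I} (h : orb γ x d) (r : ℕ) (χ : ℤ) :
    cutCount r χ γ ε B x d = mapCount r χ ⊤ γ ε B := by
  classical
  have h' : joinPair x d ≤ orb γ := joinPair_le_iff.2 h
  rw [cutCount, mapCount]
  refine Finset.sum_congr rfl fun T _ => ?_
  congr 1
  funext a
  rw [sup_eq_left.2 (h'.trans (le_sup_left.trans le_sup_left))]

open Classical in
/-- The colouring of the points given by a set of vertices. -/
def sideOf {n : ℕ} (ν : I → Fin n ⊕ Bool) (K : Finset (Fin n)) (z : I) : Bool :=
  Sum.elim (fun j => decide (j ∈ K)) id (ν z)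

open Classical in
-- If linking `x` and `d` makes everything connected, then there is already one class, or there are
-- two which separate `x` from `d`. Two such classes are unions of vertices, and the set `K` of
-- vertices on the side of `x`, besides its own, determines them. The two values of `Bool` are the
-- vertices of `x` and of `d`.
theorem ite_sup_joinPair_eq {n : ℕ} {ν : I → Fin n ⊕ Bool} (hν : Function.Surjective ν)
    {x d : I} (hx : ν x = Sum.inr true) (hd : ν d = Sum.inr false) {θ : Setoid I}
    (hθ : Setoid.ker ν ≤ θ) (v : ℂ) :
    (if θ ⊔ joinPair x d = ⊤ then v else 0) = (if θ = ⊤ then v else 0) +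
      ∑ K : Finset (Fin n), if θ = Setoid.ker (sideOf ν K) then v else 0 := by
  have hsx : ∀ K, sideOf ν K x = true := fun K => by simp [sideOf, hx]
  have hsd : ∀ K, sideOf ν K d = false := fun K => by simp [sideOf, hd]
  by_cases h1 : θ = ⊤
  · have : ∀ K : Finset (Fin n), θ ≠ Setoid.ker (sideOf ν K) := by
      intro K hK
      have : Setoid.ker (sideOf ν K) x d := by rw [← hK, h1]; trivial
      rw [Setoid.ker_def, hsx, hsd] at this
      exact absurd this (by decide)
    simp [h1]
    rw [Finset.sum_eq_zero]
    intro K _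
    rw [if_neg]
    rw [← h1]; exact this K
  · rw [if_neg h1, zero_add]
    by_cases h2 : θ ⊔ joinPair x d = ⊤
    · rw [if_pos h2]
      have hcase : ∀ z, θ z x ∨ θ z d := by
        intro z
        have : (θ ⊔ joinPair x d) z x := by rw [h2]; trivial
        rcases sup_joinPair_rel.1 this with h | ⟨h, h'⟩ | ⟨h, h'⟩
        · exact Or.inl h
        · exact Or.inl h
        · exact Or.inr h
      have hxd : ¬ θ x d := by
        intro h
        refine h1 (Setoid.eq_top_iff.2 fun u v => ?_)
        have : ∀ z, θ z x := fun z => (hcase z).elim id fun hz => θ.trans' hz (θ.symm' h)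
        exact θ.trans' (this u) (θ.symm' (this v))
      -- The only set that can contribute: the vertices with a point in the class of `x`.
      let K₀ : Finset (Fin n) :=
        Finset.univ.filter fun j => ∃ z, ν z = Sum.inl j ∧ θ z x
      have hside : ∀ z, sideOf ν K₀ z = true ↔ θ z x := by
        intro z
        rcases hz : ν z with j | b
        · simp only [sideOf, hz, Sum.elim_inl, decide_eq_true_eq, K₀, Finset.mem_filter,
            Finset.mem_univ, true_and]
          constructor
          · rintro ⟨w, hw, hwx⟩
            exact θ.trans' (hθ (show ν z = ν w by rw [hz, hw])) hwx
          · intro h; exact ⟨z, hz, h⟩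
        · cases b
          · have hzd : θ z d := hθ (show ν z = ν d by rw [hz, hd])
            simp only [sideOf, hz, Sum.elim_inr, id]
            constructor
            · intro h; exact absurd h (by decide)
            · intro h; exact absurd (θ.trans' (θ.symm' h) hzd) hxd
          · have hzx : θ z x := hθ (show ν z = ν x by rw [hz, hx])
            simp [sideOf, hz, hzx]
      have hK₀ : θ = Setoid.ker (sideOf ν K₀) := by
        refine Setoid.ext fun u v => ?_
        rw [Setoid.ker_def]
        constructor
        · intro huv
          rw [Bool.eq_iff_iff, hside, hside]
          exact ⟨fun h => θ.trans' (θ.symm' huv) h, fun h => θ.trans' huv h⟩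
        · intro h
          rw [Bool.eq_iff_iff, hside, hside] at h
          rcases hcase u with hu | hu
          · exact θ.trans' hu (θ.symm' (h.1 hu))
          · rcases hcase v with hv | hv
            · exact θ.trans' (h.2 hv) (θ.symm' hv)
            · exact θ.trans' hu (θ.symm' hv)
      rw [Finset.sum_eq_single K₀]
      · rw [if_pos hK₀]
      · intro K _ hK
        rw [if_neg]
        intro hθK
        refine hK (Finset.ext fun j => ?_)
        obtain ⟨z, hz⟩ := hν (Sum.inl j)
        have e1 : sideOf ν K z = true ↔ j ∈ K := by simp [sideOf, hz]
        have e2 : sideOf ν K₀ z = true ↔ j ∈ K₀ := by simp [sideOf, hz]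
        rw [← e1, ← e2, hside z]
        conv_rhs => rw [hθK]
        rw [Setoid.ker_def, hsx]
      · intro h; exact absurd (Finset.mem_univ _) h
    · rw [if_neg h2]
      refine (Finset.sum_eq_zero fun K _ => ?_).symm
      rw [if_neg]
      intro hθK
      refine h2 (Setoid.eq_top_iff.2 fun u v => ?_)
      have key : ∀ z, (θ ⊔ joinPair x d) z x := by
        intro z
        rw [sup_joinPair_rel]
        by_cases hz : sideOf ν K z = true
        · left; rw [hθK, Setoid.ker_def, hz, hsx]
        · right; right
          refine ⟨?_, θ.refl' x⟩
          rw [hθK, Setoid.ker_def, hsd]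
          simpa using hz
      exact Setoid.trans' _ (key u) (Setoid.symm' _ (key v))

/-- The case of a cut, the source of the two kinds of quadratic terms: the map stays connected, or
it falls into two components. -/
theorem cutCount_of_not_rel {n : ℕ} {ν : I → Fin n ⊕ Bool} (hν : Function.Surjective ν)
    {x d : I} (hx : ν x = Sum.inr true) (hd : ν d = Sum.inr false)
    (hγ : orb γ = Setoid.ker ν) (r : ℕ) (χ : ℤ) :
    cutCount r χ γ ε B x d = mapCount r χ ⊤ γ ε B +
      ∑ K : Finset (Fin n), mapCount r χ (Setoid.ker (sideOf ν K)) γ ε B := by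
  classical
  simp only [cutCount, mapCount]
  rw [Finset.sum_comm, ← Finset.sum_add_distrib]
  refine Finset.sum_congr rfl fun T _ => ?_
  rw [← monoSum_sum, ← monoSum_add]
  congr 1
  funext a
  by_cases h : eulerChar r γ ε T a = χ
  · simp only [h, and_true]
    refine ite_sup_joinPair_eq hν hx hd ?_ _
    rw [← hγ]
    exact le_sup_left.trans le_sup_left
  · simp [h]

end Peel

end

noncomputable section

/-! ## Maps with two connected components -/

section TwoComponents

variable {I J : Type*} [Fintype I] [DecidableEq I] [Fintype J] [DecidableEq J] {N : ℕ}

theorem sumSetoid_eq_sup (θ : Setoid I) (η : Setoid J) :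
    sumSetoid θ η = θ.map Sum.inl ⊔ η.map Sum.inr :=
  eq_of_forall_ge_iff fun ζ => by
    rw [sumSetoid_le_iff, sup_le_iff, setoid_map_le_iff, setoid_map_le_iff]

theorem sumSetoid_sup (θ θ' : Setoid I) (η η' : Setoid J) :
    sumSetoid θ η ⊔ sumSetoid θ' η' = sumSetoid (θ ⊔ θ') (η ⊔ η') := by
  simp only [sumSetoid_eq_sup, setoid_map_sup]
  ac_rfl

theorem sumSetoid_eq_ker_isLeft_iff {θ : Setoid I} {η : Setoid J} :
    sumSetoid θ η = Setoid.ker (Sum.isLeft : I ⊕ J → Bool) ↔ θ = ⊤ ∧ η = ⊤ := by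
  constructor
  · intro h
    constructor
    · refine Setoid.eq_top_iff.2 fun x y => ?_
      rw [← sumSetoid_inl θ η, h]; rfl
    · refine Setoid.eq_top_iff.2 fun x y => ?_
      rw [← sumSetoid_inr θ η, h]; rfl
  · rintro ⟨rfl, rfl⟩
    refine Setoid.ext ?_
    rintro (x | x) (y | y)
    · simp [Setoid.ker_def]
    · simp [Setoid.ker_def]
    · simp [Setoid.ker_def]
    · simp [Setoid.ker_def]

theorem sumCongr_inv (f : Equiv.Perm I) (g : Equiv.Perm J) :
    (Equiv.sumCongr f g : Equiv.Perm (I ⊕ J))⁻¹ = Equiv.sumCongr f⁻¹ g⁻¹ := rfl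

theorem sumCongr_mul (f f' : Equiv.Perm I) (g g' : Equiv.Perm J) :
    (Equiv.sumCongr f g * Equiv.sumCongr f' g' : Equiv.Perm (I ⊕ J)) =
      Equiv.sumCongr (f * f') (g * g') := by
  ext (x | x) <;> rfl

/-- The embedding of the left part. -/
abbrev inlPP (a : PartPerm I) : PartPerm (I ⊕ J) := a.map Function.Embedding.inl

/-- The embedding of the right part. -/
abbrev inrPP (b : PartPerm J) : PartPerm (I ⊕ J) := b.map Function.Embedding.inr

theorem inl_mul_inr_perm (a : PartPerm I) (b : PartPerm J) :
    (inlPP a * inrPP b : PartPerm (I ⊕ J)).perm = Equiv.sumCongr a.perm b.perm := by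
  ext (x | x)
  · rw [PartPerm.mul_perm, Equiv.Perm.mul_apply,
      PartPerm.map_perm_apply_of_notMem _ b (y := Sum.inl x) (by simp)]
    exact PartPerm.map_perm_apply Function.Embedding.inl a x
  · rw [PartPerm.mul_perm, Equiv.Perm.mul_apply]
    have h := PartPerm.map_perm_apply (J := I ⊕ J) Function.Embedding.inr b x
    rw [Function.Embedding.inr_apply] at h
    rw [h, PartPerm.map_perm_apply_of_notMem _ a (by simp)]
    rfl

variable {γ₁ : Equiv.Perm I} {γ₂ : Equiv.Perm J} {ε : I ⊕ J → SignType}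
  {B : I ⊕ J → Matrix (Fin N) (Fin N) ℂ}

theorem card_plusSet_sum (ε : I ⊕ J → SignType) :
    (plusSet ε).card =
      (plusSet fun x => ε (Sum.inl x)).card + (plusSet fun x => ε (Sum.inr x)).card := by
  simp only [plusSet, Finset.card_filter, Fintype.sum_sum_type]

theorem phi_sum (T₁ : Equiv.Perm I) (T₂ : Equiv.Perm J) (a : PartPerm I) (b : PartPerm J) :
    (inlPP a * inrPP b : PartPerm (I ⊕ J)).perm * Equiv.sumCongr T₁ T₂ *
      (Equiv.sumCongr γ₁ γ₂)⁻¹ = Equiv.sumCongr (a.perm * T₁ * γ₁⁻¹) (b.perm * T₂ * γ₂⁻¹) := by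
  rw [inl_mul_inr_perm, sumCongr_inv, sumCongr_mul, sumCongr_mul]

theorem eulerChar_sum (T₁ : Equiv.Perm I) (T₂ : Equiv.Perm J) (a : PartPerm I) (b : PartPerm J)
    (r₁ r₂ : ℕ) :
    eulerChar (r₁ + r₂) (Equiv.sumCongr γ₁ γ₂) ε (Equiv.sumCongr T₁ T₂) (inlPP a * inrPP b) =
      eulerChar r₁ γ₁ (fun x => ε (Sum.inl x)) T₁ a +
        eulerChar r₂ γ₂ (fun x => ε (Sum.inr x)) T₂ b := by
  rw [eulerChar, eulerChar, eulerChar, phi_sum, numCycles_sumCongr, numCycles_sumCongr,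
    card_plusSet_sum]
  push_cast
  ring

theorem faceTrace_sum (T₁ : Equiv.Perm I) (T₂ : Equiv.Perm J) (a : PartPerm I)
    (b : PartPerm J) :
    faceTrace (Equiv.sumCongr γ₁ γ₂) (Equiv.sumCongr T₁ T₂) B (inlPP a * inrPP b) =
      faceTrace γ₁ T₁ (fun x => B (Sum.inl x)) a * faceTrace γ₂ T₂ (fun x => B (Sum.inr x)) b := by
  rw [faceTrace, faceTrace, faceTrace, phi_sum, sumCongr_inv, ntrPerm_sumCongr]

open Classical in
/-- The contribution of a map to `mapCount`, for connected maps of genus `g`. -/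
def connTerm (r g : ℕ) (γ : Equiv.Perm I) (ε : I → SignType) (B : I → Matrix (Fin N) (Fin N) ℂ)
    (T : Equiv.Perm I) (a : PartPerm I) : ℂ :=
  if orb γ ⊔ orb T ⊔ a.part = ⊤ ∧ eulerChar r γ ε T a = 2 - 2 * g then faceTrace γ T B a else 0

theorem mapCount_eq_connTerm (r g : ℕ) (γ : Equiv.Perm I) (ε : I → SignType)
    (B : I → Matrix (Fin N) (Fin N) ℂ) :
    mapCount r (2 - 2 * g) ⊤ γ ε B =
      ∑ T ∈ matchings ε, monoSum r (plusSet ε).toList (connTerm r g γ ε B T) := rfl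

/-- By `EulerBound` each component has Euler characteristic 2 − 2g₁, resp. 2 − 2g₂, with natural
numbers g₁ and g₂. So precisely one pair of genera is possible, and it occurs in the sum exactly
when its total is `g`. -/
theorem sum_antidiagonal_connTerm [Nonempty I] [Nonempty J] {T₁ : Equiv.Perm I}
    {T₂ : Equiv.Perm J} {a : PartPerm I} {b : PartPerm J} {r₁ r₂ : ℕ}
    (ha : EulerBound γ₁ (fun x => ε (Sum.inl x)) T₁ r₁ a)
    (hb : EulerBound γ₂ (fun x => ε (Sum.inr x)) T₂ r₂ b) (g : ℕ) :
    open Classical in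
    (if orb (Equiv.sumCongr γ₁ γ₂) ⊔ orb (Equiv.sumCongr T₁ T₂) ⊔ (inlPP a * inrPP b).part =
        Setoid.ker Sum.isLeft ∧
        eulerChar (r₁ + r₂) (Equiv.sumCongr γ₁ γ₂) ε (Equiv.sumCongr T₁ T₂)
          (inlPP a * inrPP b) = 4 - 2 * (g : ℤ)
      then faceTrace (Equiv.sumCongr γ₁ γ₂) (Equiv.sumCongr T₁ T₂) B (inlPP a * inrPP b)
      else 0) =
    ∑ q ∈ Finset.HasAntidiagonal.antidiagonal g,
      connTerm r₁ q.1 γ₁ (fun x => ε (Sum.inl x)) (fun x => B (Sum.inl x)) T₁ a *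
        connTerm r₂ q.2 γ₂ (fun x => ε (Sum.inr x)) (fun x => B (Sum.inr x)) T₂ b := by
  classical
  have hpart : orb (Equiv.sumCongr γ₁ γ₂) ⊔ orb (Equiv.sumCongr T₁ T₂) ⊔
      (inlPP a * inrPP b).part =
      sumSetoid (orb γ₁ ⊔ orb T₁ ⊔ a.part) (orb γ₂ ⊔ orb T₂ ⊔ b.part) := by
    have : (inlPP a * inrPP b : PartPerm (I ⊕ J)).part = sumSetoid a.part b.part :=
      (sumSetoid_eq_sup _ _).symm
    rw [this, orb_sumCongr, orb_sumCongr, sumSetoid_sup, sumSetoid_sup]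
  rw [hpart, sumSetoid_eq_ker_isLeft_iff, eulerChar_sum, faceTrace_sum]
  simp only [connTerm]
  by_cases h1 : orb γ₁ ⊔ orb T₁ ⊔ a.part = ⊤
  swap
  · simp [h1]
  by_cases h2 : orb γ₂ ⊔ orb T₂ ⊔ b.part = ⊤
  swap
  · simp [h2]
  simp only [h1, h2, true_and, and_true]
  obtain ⟨-, hle1, k1, hk1⟩ := ha
  obtain ⟨-, hle2, k2, hk2⟩ := hb
  rw [h1, numClasses_top] at hle1
  rw [h2, numClasses_top] at hle2
  rw [hk1] at hle1 ⊢
  rw [hk2] at hle2 ⊢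
  -- Evenness provides the half `k1` of the Euler characteristic, and connectedness bounds it by 1.
  obtain ⟨g1, hg1⟩ : ∃ g1 : ℕ, k1 = 1 - g1 := ⟨(1 - k1).toNat, by push_cast at hle1; omega⟩
  obtain ⟨g2, hg2⟩ : ∃ g2 : ℕ, k2 = 1 - g2 := ⟨(1 - k2).toNat, by push_cast at hle2; omega⟩
  subst hg1 hg2
  by_cases hg : g1 + g2 = g
  · rw [if_pos (by push_cast [← hg]; ring), Finset.sum_eq_single (g1, g2)]
    · rw [if_pos (by ring), if_pos (by ring)]
    · rintro ⟨q1, q2⟩ _ hq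
      simp only at *
      by_cases hq1 : q1 = g1
      · have : q2 ≠ g2 := by rintro rfl; exact hq (by rw [hq1])
        rw [if_neg (c := (1 - (g2 : ℤ) + (1 - g2) = 2 - 2 * q2)), mul_zero]
        omega
      · rw [if_neg, zero_mul]
        omega
    · intro h
      exact absurd (Finset.HasAntidiagonal.mem_antidiagonal.2 hg) h
  · rw [if_neg (by omega)]
    refine (Finset.sum_eq_zero ?_).symm
    rintro ⟨q1, q2⟩ hq
    rw [Finset.HasAntidiagonal.mem_antidiagonal] at hq
    simp only at *
    by_cases hq1 : q1 = g1
    · rw [if_neg (c := (1 - (g2 : ℤ) + (1 - g2) = 2 - 2 * q2)), mul_zero]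
      omega
    · rw [if_neg, zero_mul]
      omega

theorem monoSum_sum_type (r : ℕ) {F : PartPerm (I ⊕ J) → ℂ}
    (hF : ∀ a, ¬ a.part ≤ Setoid.ker Sum.isLeft → F a = 0) :
    monoSum r (plusSet ε).toList F = ∑ s ∈ Finset.HasAntidiagonal.antidiagonal r,
      monoSum s.1 (plusSet fun x => ε (Sum.inl x)).toList fun a =>
        monoSum s.2 (plusSet fun x => ε (Sum.inr x)).toList fun b => F (inlPP a * inrPP b) := by
  set L₁ := (plusSet fun x => ε (Sum.inl x)).toList with hL₁
  set L₂ := (plusSet fun x => ε (Sum.inr x)).toList with hL₂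
  have hnd : (L₁.map Function.Embedding.inl ++
      L₂.map (Function.Embedding.inr : J ↪ I ⊕ J)).Nodup := by
    refine List.Nodup.append ((Finset.nodup_toList _).map (Function.Embedding.injective _))
      ((Finset.nodup_toList _).map (Function.Embedding.injective _)) ?_
    intro x hx hy
    rw [List.mem_map] at hx hy
    obtain ⟨x1, _, rfl⟩ := hx
    obtain ⟨y1, _, h⟩ := hy
    exact absurd h (by simp)
  rw [monoSum_toList hnd, monoSum_split Sum.isLeft hnd r hF]
  · have e1 : (L₁.map Function.Embedding.inl ++
        L₂.map (Function.Embedding.inr : J ↪ I ⊕ J)).filter (fun x => Sum.isLeft x) =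
        L₁.map Function.Embedding.inl := by
      rw [List.filter_append, List.filter_eq_self.2, List.filter_eq_nil_iff.2, List.append_nil]
      · intro x hx; rw [List.mem_map] at hx; obtain ⟨y, _, rfl⟩ := hx; simp
      · intro x hx; rw [List.mem_map] at hx; obtain ⟨y, _, rfl⟩ := hx; simp
    have e2 : (L₁.map Function.Embedding.inl ++
        L₂.map (Function.Embedding.inr : J ↪ I ⊕ J)).filter (fun x => !Sum.isLeft x) =
        L₂.map Function.Embedding.inr := by
      rw [List.filter_append, List.filter_eq_nil_iff.2, List.filter_eq_self.2, List.nil_append]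
      · intro x hx; rw [List.mem_map] at hx; obtain ⟨y, _, rfl⟩ := hx; simp
      · intro x hx; rw [List.mem_map] at hx; obtain ⟨y, _, rfl⟩ := hx; simp
    rw [e1, e2]
    refine Finset.sum_congr rfl fun s _ => ?_
    rw [monoSum_map _ (PartPerm.map Function.Embedding.inl) (PartPerm.map_one _)
      (PartPerm.map_swap_mul _)]
    congr 1
    funext a
    rw [monoSum_map _ (PartPerm.map Function.Embedding.inr) (PartPerm.map_one _)
      (PartPerm.map_swap_mul _)]
  · rintro (x | x) <;> simp [L₁, L₂]

/-- Matching, monotone sequence, Euler characteristic and trace all split between the two sides, so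
the count is a convolution over the genus and over the number of black vertices. -/
theorem mapCount_sum [Nonempty I] [Nonempty J] (γ₁ : Equiv.Perm I) (γ₂ : Equiv.Perm J)
    (ε : I ⊕ J → SignType) (B : I ⊕ J → Matrix (Fin N) (Fin N) ℂ) (r g : ℕ) :
    mapCount r (4 - 2 * g) (Setoid.ker Sum.isLeft) (Equiv.sumCongr γ₁ γ₂) ε B =
      ∑ q ∈ Finset.HasAntidiagonal.antidiagonal g, ∑ s ∈ Finset.HasAntidiagonal.antidiagonal r,
        mapCount s.1 (2 - 2 * q.1) ⊤ γ₁ (fun x => ε (Sum.inl x)) (fun x => B (Sum.inl x)) *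
          mapCount s.2 (2 - 2 * q.2) ⊤ γ₂ (fun x => ε (Sum.inr x)) (fun x => B (Sum.inr x)) := by
  classical
  set ε₁ := fun x => ε (Sum.inl x) with hε₁
  set ε₂ := fun x => ε (Sum.inr x) with hε₂
  -- The matchings which preserve both sides; any other one links the sides and contributes nothing.
  let S : Finset (Equiv.Perm (I ⊕ J)) :=
    (matchings ε₁ ×ˢ matchings ε₂).image fun p => Equiv.sumCongr p.1 p.2
  have hS : S ⊆ matchings ε := by
    intro T hT
    obtain ⟨⟨T₁, T₂⟩, hp, rfl⟩ := Finset.mem_image.1 hT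
    rw [Finset.mem_product, mem_matchings, mem_matchings] at hp
    obtain ⟨⟨h1, h2, h3⟩, k1, k2, k3⟩ := hp
    rw [mem_matchings]
    refine ⟨?_, ?_, ?_⟩
    · rw [sumCongr_mul, h1, k1]; ext (x | x) <;> rfl
    · rintro (x | x)
      · exact h2 x
      · exact k2 x
    · rintro (x | x) hx
      · exact congrArg Sum.inl (h3 x hx)
      · exact congrArg Sum.inr (k3 x hx)
  rw [mapCount, ← Finset.sum_subset hS]
  · rw [Finset.sum_image, Finset.sum_product]
    · have key : ∀ T₁ ∈ matchings ε₁, ∀ T₂ ∈ matchings ε₂,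
          monoSum r (plusSet ε).toList (fun a =>
            if orb (Equiv.sumCongr γ₁ γ₂) ⊔ orb (Equiv.sumCongr T₁ T₂) ⊔ a.part =
              Setoid.ker Sum.isLeft ∧
              eulerChar r (Equiv.sumCongr γ₁ γ₂) ε (Equiv.sumCongr T₁ T₂) a = 4 - 2 * (g : ℤ)
            then faceTrace (Equiv.sumCongr γ₁ γ₂) (Equiv.sumCongr T₁ T₂) B a else 0) =
          ∑ q ∈ Finset.HasAntidiagonal.antidiagonal g,
            ∑ s ∈ Finset.HasAntidiagonal.antidiagonal r,
              monoSum s.1 (plusSet ε₁).toList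
                (connTerm s.1 q.1 γ₁ ε₁ (fun x => B (Sum.inl x)) T₁) *
              monoSum s.2 (plusSet ε₂).toList
                (connTerm s.2 q.2 γ₂ ε₂ (fun x => B (Sum.inr x)) T₂) := by
        intro T₁ hT₁ T₂ hT₂
        rw [monoSum_sum_type, Finset.sum_comm]
        · refine Finset.sum_congr rfl fun s hs => ?_
          rw [Finset.HasAntidiagonal.mem_antidiagonal] at hs
          rw [monoSum_congr_euler γ₁ hT₁ (Finset.nodup_toList _)
            (G := fun a => ∑ q ∈ Finset.HasAntidiagonal.antidiagonal g,
              monoSum s.2 (plusSet ε₂).toList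
                (connTerm s.2 q.2 γ₂ ε₂ (fun x => B (Sum.inr x)) T₂) *
              connTerm s.1 q.1 γ₁ ε₁ (fun x => B (Sum.inl x)) T₁ a)]
          · rw [monoSum_sum]
            refine Finset.sum_congr rfl fun q _ => ?_
            rw [monoSum_mul_left, mul_comm]
          · intro a ha
            rw [monoSum_congr_euler γ₂ hT₂ (Finset.nodup_toList _)
              (G := fun b => ∑ q ∈ Finset.HasAntidiagonal.antidiagonal g,
                connTerm s.1 q.1 γ₁ ε₁ (fun x => B (Sum.inl x)) T₁ a *
                  connTerm s.2 q.2 γ₂ ε₂ (fun x => B (Sum.inr x)) T₂ b)]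
            · rw [monoSum_sum]
              refine Finset.sum_congr rfl fun q _ => ?_
              rw [monoSum_mul_left, mul_comm]
            · intro b hb
              rw [← sum_antidiagonal_connTerm ha hb, hs]
        · intro a ha
          rw [if_neg]
          rintro ⟨h, -⟩
          exact ha (h ▸ le_sup_right)
      rw [Finset.sum_congr rfl fun T₁ hT₁ => Finset.sum_congr rfl fun T₂ hT₂ => key T₁ hT₁ T₂ hT₂]
      simp only [mapCount_eq_connTerm, Finset.sum_mul_sum]
      simp only [Finset.sum_comm (s := matchings ε₂)]
      rw [Finset.sum_comm]
      refine Finset.sum_congr rfl fun q _ => ?_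
      rw [Finset.sum_comm]
    · rintro ⟨T₁, T₂⟩ _ ⟨T₁', T₂'⟩ _ h
      have : ∀ x : I ⊕ J, Equiv.sumCongr T₁ T₂ x = Equiv.sumCongr T₁' T₂' x :=
        fun x => Equiv.ext_iff.1 h x
      refine Prod.ext (Equiv.ext fun x => ?_) (Equiv.ext fun x => ?_)
      · exact Sum.inl_injective (this (Sum.inl x))
      · exact Sum.inr_injective (this (Sum.inr x))
  · intro T hT hTS
    have hn : ¬ orb T ≤ Setoid.ker Sum.isLeft := by
      intro hle
      refine hTS (Finset.mem_image.2 ?_)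
      have hmaps : Set.MapsTo T (Set.range Sum.inl) (Set.range Sum.inl) := by
        rintro _ ⟨x, rfl⟩
        have := orb_le_iff.1 hle (Sum.inl x)
        rw [Setoid.ker_def] at this
        rcases hy : T (Sum.inl x) with y | y
        · exact ⟨y, rfl⟩
        · rw [hy] at this; exact absurd this (by simp)
      obtain ⟨⟨T₁, T₂⟩, rfl⟩ := Equiv.Perm.mem_sumCongrHom_range_of_perm_mapsTo_inl hmaps
      refine ⟨(T₁, T₂), ?_, rfl⟩
      rw [mem_matchings] at hT
      obtain ⟨h1, h2, h3⟩ := hT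
      rw [Finset.mem_product, mem_matchings, mem_matchings]
      refine ⟨⟨Equiv.ext fun x => ?_, fun x => h2 (Sum.inl x), fun x hx => ?_⟩,
        Equiv.ext fun x => ?_, fun x => h2 (Sum.inr x), fun x hx => ?_⟩
      · exact Sum.inl_injective (Equiv.ext_iff.1 h1 (Sum.inl x))
      · exact Sum.inl_injective (h3 (Sum.inl x) hx)
      · exact Sum.inr_injective (Equiv.ext_iff.1 h1 (Sum.inr x))
      · exact Sum.inr_injective (h3 (Sum.inr x) hx)
    have : ∀ a : PartPerm (I ⊕ J), ¬ (orb (Equiv.sumCongr γ₁ γ₂ : Equiv.Perm (I ⊕ J)) ⊔ orb T ⊔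
        a.part = Setoid.ker Sum.isLeft) := fun a h =>
      hn (h ▸ le_sup_right.trans le_sup_left)
    simp only [this, false_and, if_false, monoSum_zero_fun]

end TwoComponents

end

noncomputable section

/-! ## Points of sign zero -/

section InsertDummy

variable {I : Type*} [Fintype I] [DecidableEq I] {N : ℕ}

theorem optionCongr_mul (f g : Equiv.Perm I) :
    (Equiv.optionCongr (f * g) : Equiv.Perm (Option I)) =
      Equiv.optionCongr f * Equiv.optionCongr g := by
  ext (_ | x) : 1 <;> simp

theorem optionCongr_inv (f : Equiv.Perm I) :
    (Equiv.optionCongr f : Equiv.Perm (Option I))⁻¹ = Equiv.optionCongr f⁻¹ := by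
  rw [inv_eq_iff_mul_eq_one, ← optionCongr_mul, mul_inv_cancel]
  exact Equiv.optionCongr_refl

theorem PartPerm.map_some_perm (a : PartPerm I) :
    (a.map Function.Embedding.some).perm = Equiv.optionCongr a.perm := by
  ext (_ | x) : 1
  · rw [PartPerm.map_perm_apply_of_notMem _ _ (by simp)]; simp
  · exact PartPerm.map_perm_apply Function.Embedding.some a x

/-- Matching and transpositions fix the new point, so it enters the face permutation at the same
place, just before `y`, as the rotation. -/
theorem phi_insertPoint (γ T : Equiv.Perm I) (y : I) (a : PartPerm I) :
    ((a.map Function.Embedding.some).perm * Equiv.optionCongr T * (insertPoint γ y)⁻¹)⁻¹ =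
      insertPoint (a.perm * T * γ⁻¹)⁻¹ y := by
  rw [PartPerm.map_some_perm, ← optionCongr_mul, mul_inv_rev, inv_inv, mul_inv_rev, inv_inv,
    insertPoint, insertPoint, optionCongr_mul γ, optionCongr_inv, mul_assoc]

theorem numCycles_inv (f : Equiv.Perm I) : numCycles f⁻¹ = numCycles f := by
  rw [numCycles_eq, orb_inv, numCycles_eq]

theorem insertPoint_sup_eq_top_iff (γ T : Equiv.Perm I) (y : I) (a : PartPerm I) :
    orb (insertPoint γ y) ⊔ orb (Equiv.optionCongr T : Equiv.Perm (Option I)) ⊔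
      (a.map Function.Embedding.some).part = ⊤ ↔ orb γ ⊔ orb T ⊔ a.part = ⊤ := by
  constructor
  · intro h
    have hle : orb (insertPoint γ y) ⊔ orb (Equiv.optionCongr T : Equiv.Perm (Option I)) ⊔
        (a.map Function.Embedding.some).part ≤
        Setoid.comap (fun o => o.getD y) (orb γ ⊔ orb T ⊔ a.part) := by
      refine sup_le (sup_le (orb_le_iff.2 ?_) (orb_le_iff.2 ?_)) (setoid_map_le_iff.2 ?_)
      · have hγ : orb γ ≤ orb γ ⊔ orb T ⊔ a.part := le_sup_left.trans le_sup_left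
        rintro (_ | z)
        · rw [insertPoint_none]; exact Setoid.refl' (orb γ ⊔ orb T ⊔ a.part) y
        · by_cases hz : γ z = y
          · rw [insertPoint_some_of_eq hz, Setoid.comap_rel]
            exact hγ (by simpa [hz] using orb_rel γ z)
          · rw [insertPoint_some_of_ne hz]
            exact hγ (orb_rel γ z)
      · have hT : orb T ≤ orb γ ⊔ orb T ⊔ a.part := le_sup_right.trans le_sup_left
        rintro (_ | z)
        · exact Setoid.refl' (orb γ ⊔ orb T ⊔ a.part) y
        · exact hT (orb_rel T z)
      · exact le_sup_right
    rw [h] at hle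
    exact Setoid.eq_top_iff.2 fun u v => hle (x := some u) (y := some v) trivial
  · intro h
    have hle : orb γ ⊔ orb T ⊔ a.part ≤ Setoid.comap some
        (orb (insertPoint γ y) ⊔ orb (Equiv.optionCongr T : Equiv.Perm (Option I)) ⊔
          (a.map Function.Embedding.some).part) := by
      refine sup_le (sup_le ?_ (orb_le_iff.2 fun z => ?_)) ?_
      · intro u v huv
        exact (le_sup_left.trans le_sup_left : orb (insertPoint γ y) ≤ _)
          ((orb_insertPoint_some γ y u v).2 huv)
      · exact (le_sup_right.trans le_sup_left :
          orb (Equiv.optionCongr T : Equiv.Perm (Option I)) ≤ _)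
          (orb_rel (Equiv.optionCongr T : Equiv.Perm (Option I)) (some z))
      · exact setoid_map_le_iff.1 (le_sup_right :
          (a.map Function.Embedding.some).part ≤ _)
    have hy := (le_sup_left.trans le_sup_left : orb (insertPoint γ y) ≤
      orb (insertPoint γ y) ⊔ orb (Equiv.optionCongr T : Equiv.Perm (Option I)) ⊔
          (a.map Function.Embedding.some).part) (orb_insertPoint_none γ y)
    have key : ∀ o, (orb (insertPoint γ y) ⊔ orb (Equiv.optionCongr T : Equiv.Perm (Option I)) ⊔
          (a.map Function.Embedding.some).part) o (some y) := by
      rw [h] at hle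
      rintro (_ | z)
      · exact hy
      · exact hle (x := z) (y := y) trivial
    exact Setoid.eq_top_iff.2 fun u v => Setoid.trans' _ (key u) (Setoid.symm' _ (key v))

/-- A point of sign zero can be removed, its matrix being multiplied with the next one. -/
theorem mapCount_insertPoint (γ : Equiv.Perm I) (y : I) {ε : Option I → SignType}
    (hε : ε none = 0) {B : Option I → Matrix (Fin N) (Fin N) ℂ}
    {B' : I → Matrix (Fin N) (Fin N) ℂ} (hy : B' y = B none * B (some y))
    (hB : ∀ z, z ≠ y → B' z = B (some z)) (r : ℕ) (χ : ℤ) :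
    mapCount r χ ⊤ (insertPoint γ y) ε B = mapCount r χ ⊤ γ (fun z => ε (some z)) B' := by
  classical
  have hcard : (plusSet ε).card = (plusSet fun z => ε (some z)).card := by
    rw [plusSet, Finset.card_filter, Fintype.sum_option, plusSet, Finset.card_filter, hε]
    simp
  symm
  refine Finset.sum_bij (fun T _ => Equiv.optionCongr T) ?_ ?_ ?_ ?_
  · intro T hT
    rw [mem_matchings] at hT ⊢
    refine ⟨?_, ?_, ?_⟩
    · rw [← optionCongr_mul, hT.1]; exact Equiv.optionCongr_refl
    · rintro (_ | z)
      · simp [hε]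
      · exact hT.2.1 z
    · rintro (_ | z) hz
      · rfl
      · exact congrArg some (hT.2.2 z hz)
  · intro T _ T' _ h
    exact Equiv.ext fun z => Option.some_injective _ (Equiv.ext_iff.1 h (some z))
  · intro T hT
    rw [mem_matchings] at hT
    obtain ⟨h1, h2, h3⟩ := hT
    -- The new point has sign zero, so every matching fixes it and comes from the old points.
    have hT' : (Equiv.optionCongr (Equiv.removeNone T) : Equiv.Perm (Option I)) = T := by
      ext (_ | z) : 1
      · simpa using (h3 none hε).symm
      · have hz : T (some z) ≠ none := by
          intro hz
          have := T.injective (hz.trans (h3 none hε).symm)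
          simp at this
        obtain ⟨w, hw⟩ := Option.ne_none_iff_exists'.1 hz
        exact Equiv.removeNone_some T ⟨w, hw⟩
    have hap : ∀ z, some (Equiv.removeNone T z) = T (some z) := fun z => by
      conv_rhs => rw [← hT']
      rfl
    refine ⟨Equiv.removeNone T, ?_, hT'⟩
    rw [mem_matchings]
    refine ⟨Equiv.ext fun z => Option.some_injective _ ?_, fun z => ?_, fun z hz =>
      Option.some_injective _ ?_⟩
    · rw [Equiv.Perm.mul_apply, hap, hap]; exact Equiv.ext_iff.1 h1 (some z)
    · rw [hap]; exact h2 (some z)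
    · rw [hap]; exact h3 (some z) hz
  · intro T _
    rw [monoSum_toList (S := plusSet ε)
      (L := (plusSet fun z => ε (some z)).toList.map Function.Embedding.some)
      ((Finset.nodup_toList _).map (Function.Embedding.injective _)) ?_,
      monoSum_map _ (PartPerm.map Function.Embedding.some) (PartPerm.map_one _)
        (PartPerm.map_swap_mul _)]
    · congr 1
      funext a
      have hphi := phi_insertPoint γ T y a
      refine if_congr (and_congr ?_ ?_) ?_ rfl
      · exact (insertPoint_sup_eq_top_iff γ T y a).symm
      · rw [eulerChar, eulerChar, hcard, ← numCycles_inv (_ * _ * (insertPoint γ y)⁻¹), hphi,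
          numCycles_insertPoint, numCycles_insertPoint, numCycles_inv]
      · rw [faceTrace, faceTrace, hphi]
        exact (ntrPerm_insertPoint _ y B B' hy hB).symm
    · rintro (_ | z) <;> simp [hε]

end InsertDummy

end

noncomputable section

/-! ## Families of cyclic words -/

section Representations

variable {κ I J : Type*}

/-- The cycles of `γ` are enumerated by the lists `w k`. -/
structure IsRep (γ : Equiv.Perm I) (w : κ → List I) : Prop where
  rot : ∀ k, (w k).map γ = (w k).rotate 1
  nodup : ∀ k, (w k).Nodup
  uniq : ∀ k k' x, x ∈ w k → x ∈ w k' → k = k'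
  cover : ∀ x, ∃ k, x ∈ w k

theorem List.rot_rotate {γ : I → I} {l : List I} (h : l.map γ = l.rotate 1) (m : ℕ) :
    (l.rotate m).map γ = (l.rotate m).rotate 1 := by
  rw [List.map_rotate, h, List.rotate_rotate, List.rotate_rotate, add_comm]

theorem IsRep.rotated {γ : Equiv.Perm I} {w w' : κ → List I} (h : IsRep γ w)
    (hw : ∀ k, (w k).IsRotated (w' k)) : IsRep γ w' where
  rot k := by obtain ⟨m, hm⟩ := hw k; rw [← hm]; exact List.rot_rotate (h.rot k) m
  nodup k := (hw k).nodup_iff.1 (h.nodup k)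
  uniq k k' x hx hx' := h.uniq k k' x ((hw k).mem_iff.2 hx) ((hw k').mem_iff.2 hx')
  cover x := (h.cover x).imp fun k hk => (hw k).mem_iff.1 hk

theorem IsRep.reindex {κ' : Type*} {γ : Equiv.Perm I} {w : κ → List I} (h : IsRep γ w)
    (σ : κ' ≃ κ) : IsRep γ (fun k => w (σ k)) where
  rot k := h.rot _
  nodup k := h.nodup _
  uniq k k' x hx hx' := σ.injective (h.uniq _ _ x hx hx')
  cover x := by obtain ⟨k, hk⟩ := h.cover x; exact ⟨σ.symm k, by simpa using hk⟩

theorem IsRep.apply_mem {γ : Equiv.Perm I} {w : κ → List I} (h : IsRep γ w) {k : κ} {x : I}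
    (hx : x ∈ w k) : γ x ∈ w k := by
  have : γ x ∈ (w k).map γ := List.mem_map_of_mem hx
  rwa [h.rot, List.mem_rotate] at this

/-- The vertex of a point. -/
def IsRep.vertex {γ : Equiv.Perm I} {w : κ → List I} (h : IsRep γ w) (x : I) : κ :=
  (h.cover x).choose

theorem IsRep.mem_vertex {γ : Equiv.Perm I} {w : κ → List I} (h : IsRep γ w) (x : I) :
    x ∈ w (h.vertex x) := (h.cover x).choose_spec

theorem IsRep.vertex_eq {γ : Equiv.Perm I} {w : κ → List I} (h : IsRep γ w) {x : I} {k : κ}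
    (hx : x ∈ w k) : h.vertex x = k := h.uniq _ _ x (h.mem_vertex x) hx

theorem IsRep.vertex_surjective {γ : Equiv.Perm I} {w : κ → List I} (h : IsRep γ w)
    (hne : ∀ k, w k ≠ []) : Function.Surjective h.vertex := fun k => by
  obtain ⟨x, hx⟩ := List.exists_mem_of_ne_nil _ (hne k)
  exact ⟨x, h.vertex_eq hx⟩

/-- Inside one list, consecutive elements are successive images under `γ`, so every element is
reached from the first. -/
theorem IsRep.orb_eq {γ : Equiv.Perm I} {w : κ → List I} (h : IsRep γ w) :
    orb γ = Setoid.ker h.vertex := by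
  refine le_antisymm (orb_le_iff.2 fun x => ?_) fun {x y} hxy => ?_
  · rw [Setoid.ker_def]
    exact (h.vertex_eq (h.apply_mem (h.mem_vertex x))).symm
  · rw [Setoid.ker_def] at hxy
    have hx := h.mem_vertex x
    have hy := h.mem_vertex y
    rw [← hxy] at hy
    generalize h.vertex x = k at hx hy
    have key : ∀ i (hi : i < (w k).length), orb γ ((w k)[0]'(by omega)) (w k)[i] := by
      intro i
      induction i with
      | zero => intro _; exact Setoid.refl' _ _
      | succ i ih =>
        intro hi
        refine Setoid.trans' _ (ih (by omega)) ?_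
        have h1 : ((w k).map γ)[i]'(by simp; omega) = ((w k).rotate 1)[i]'(by simp; omega) := by
          simp only [h.rot]
        rw [List.getElem_map, List.getElem_rotate] at h1
        have h2 : (w k)[i + 1] = γ ((w k)[i]) := by
          rw [h1]
          congr 1
          rw [Nat.mod_eq_of_lt hi]
        rw [h2]
        exact orb_rel γ _
    obtain ⟨i, hi, rfl⟩ := List.getElem_of_mem hx
    obtain ⟨j, hj, rfl⟩ := List.getElem_of_mem hy
    exact Setoid.trans' _ (Setoid.symm' _ (key i hi)) (key j hj)

theorem IsRep.numCycles_eq [Finite κ] {γ : Equiv.Perm I} {w : κ → List I} (h : IsRep γ w)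
    (hne : ∀ k, w k ≠ []) : numCycles γ = Nat.card κ := by
  rw [_root_.numCycles_eq, numClasses, h.orb_eq]
  exact Nat.card_congr (Setoid.quotientKerEquivOfSurjective _ (h.vertex_surjective hne))

/-- The points are enumerated by the positions in the lists. -/
theorem IsRep.bijective_get {γ : Equiv.Perm I} {w : κ → List I} (h : IsRep γ w) :
    Function.Bijective fun p : Σ k, Fin (w k).length => (w p.1)[p.2] := by
  constructor
  · rintro ⟨k, i⟩ ⟨k', i'⟩ hp
    simp only at hp
    obtain rfl : k = k' := h.uniq k k' ((w k)[i]) (List.getElem_mem _) (by rw [hp]; exact List.getElem_mem _)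
    congr 1
    exact Fin.ext ((h.nodup k).getElem_inj_iff.1 hp)
  · intro x
    obtain ⟨k, hk⟩ := h.cover x
    obtain ⟨i, hi, rfl⟩ := List.getElem_of_mem hk
    exact ⟨⟨k, i, hi⟩, rfl⟩

/-- Two representations of the same family of cyclic words are isomorphic. -/
theorem IsRep.exists_equiv {D : Type*} {γ : Equiv.Perm I} {γ' : Equiv.Perm J} {w : κ → List I}
    {w' : κ → List J} (h : IsRep γ w) (h' : IsRep γ' w') {f : I → D} {f' : J → D}
    (hf : ∀ k, (w k).map f = (w' k).map f') :
    ∃ e : I ≃ J, (∀ k, w' k = (w k).map e) ∧ (∀ x, e (γ x) = γ' (e x)) ∧ ∀ x, f' (e x) = f x := by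
  have hlen : ∀ k, (w k).length = (w' k).length := fun k => by
    simpa using congrArg List.length (hf k)
  let e₀ : (Σ k, Fin (w k).length) ≃ Σ k, Fin (w' k).length :=
    Equiv.sigmaCongrRight fun k => finCongr (hlen k)
  let e : I ≃ J := (Equiv.ofBijective _ h.bijective_get).symm.trans
    (e₀.trans (Equiv.ofBijective _ h'.bijective_get))
  have he : ∀ k i (hi : i < (w k).length), e ((w k)[i]) = (w' k)[i]'(by rw [← hlen]; exact hi) := by
    intro k i hi
    have : (Equiv.ofBijective _ h.bijective_get).symm ((w k)[i]) = ⟨k, i, hi⟩ := by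
      rw [Equiv.symm_apply_eq]; rfl
    simp only [e, Equiv.trans_apply, this]
    rfl
  have hw : ∀ k, w' k = (w k).map e := by
    intro k
    refine List.ext_getElem (by simp [hlen]) fun i hi hi' => ?_
    rw [List.getElem_map, he]
  refine ⟨e, hw, fun x => ?_, fun x => ?_⟩
  · obtain ⟨k, hk⟩ := h.cover x
    have h1 := h'.rot k
    rw [hw k, List.map_map, ← List.map_rotate, ← h.rot k, List.map_map, List.map_inj_left] at h1
    exact (h1 x hk).symm
  · obtain ⟨k, hk⟩ := h.cover x
    have h1 := hf k
    rw [hw k, List.map_map, List.map_inj_left] at h1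
    exact (h1 x hk).symm

end Representations

/-! ### Counts of maps attached to families of cyclic words. -/

section WordCount

variable {κ : Type*} [Fintype κ] [DecidableEq κ] {N : ℕ}

/-- A matrix and the exponent of the letter `u` that follows it. -/
abbrev SignedMatrix (N : ℕ) := Matrix (Fin N) (Fin N) ℂ × SignType

/-- The points of a family of cyclic words. -/
abbrev Points (V : κ → List (SignedMatrix N)) := Σ k, Fin (V k).length

/-- The rotation of all words. -/
def rotatePoints (V : κ → List (SignedMatrix N)) : Equiv.Perm (Points V) :=
  Equiv.sigmaCongrRight fun k => finRotate (V k).length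

/-- The connected maps with `r` black vertices and Euler characteristic `χ`, whose white vertices
are given by a family of cyclic words. -/
def wordCount (r : ℕ) (χ : ℤ) (V : κ → List (SignedMatrix N)) : ℂ :=
  mapCount r χ ⊤ (rotatePoints V) (fun x => (V x.1)[x.2].2) (fun x => (V x.1)[x.2].1)

theorem ofFn_finRotate {A : Type*} {n : ℕ} (f : Fin n → A) :
    List.ofFn (fun j => f (finRotate n j)) = (List.ofFn f).rotate 1 := by
  refine List.ext_getElem (by simp) fun i hi hi' => ?_
  rw [List.getElem_ofFn, List.getElem_rotate, List.getElem_ofFn]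
  congr 1
  ext
  simp only [List.length_ofFn] at hi ⊢
  obtain ⟨n, rfl⟩ : ∃ m, n = m + 1 := ⟨n - 1, by omega⟩
  by_cases h : i = n
  · subst h
    have := finRotate_last (n := i)
    rw [Fin.last] at this
    rw [this]
    simp
  · rw [finRotate_of_lt (by omega), Nat.mod_eq_of_lt (by omega)]

theorem isRep_rotatePoints (V : κ → List (SignedMatrix N)) :
    IsRep (rotatePoints V) (fun k => List.ofFn fun j => (⟨k, j⟩ : Points V)) where
  rot k := by
    rw [List.map_ofFn, ← ofFn_finRotate]
    rfl
  nodup k := List.nodup_ofFn.2 fun i j hij => by simpa using hij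
  uniq k k' x hx hx' := by
    rw [List.mem_ofFn] at hx hx'
    obtain ⟨j, rfl⟩ := hx
    obtain ⟨j', hj'⟩ := hx'
    exact (congrArg Sigma.fst hj').symm
  cover x := ⟨x.1, by rw [List.mem_ofFn]; exact ⟨x.2, rfl⟩⟩

theorem map_rotatePoints (V : κ → List (SignedMatrix N)) (k : κ) :
    (List.ofFn fun j => (⟨k, j⟩ : Points V)).map (fun x => ((V x.1)[x.2].1, (V x.1)[x.2].2)) =
      V k := by
  rw [List.map_ofFn]
  exact List.ofFn_getElem

/-- The sum can be computed on any representation. -/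
theorem wordCount_eq {I : Type*} [Fintype I] [DecidableEq I] {γ : Equiv.Perm I}
    {w : κ → List I} (h : IsRep γ w) {ε : I → SignType} {B : I → Matrix (Fin N) (Fin N) ℂ}
    {V : κ → List (SignedMatrix N)} (hV : ∀ k, (w k).map (fun x => (B x, ε x)) = V k) (r : ℕ)
    (χ : ℤ) : wordCount r χ V = mapCount r χ ⊤ γ ε B := by
  obtain ⟨e, -, he, hf⟩ := h.exists_equiv (isRep_rotatePoints V)
    (f := fun x => (B x, ε x)) (f' := fun x => ((V x.1)[x.2].1, (V x.1)[x.2].2)) fun k => by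
      rw [hV, map_rotatePoints]
  refine mapCount_equiv e he (fun x => ?_) (fun x => ?_) (fun x y => ?_) r χ
  · exact congrArg Prod.snd (hf x)
  · exact congrArg Prod.fst (hf x)
  · simp [Setoid.top_def]

theorem wordCount_reindex {κ' : Type*} [Fintype κ'] [DecidableEq κ'] (σ : κ' ≃ κ)
    (V : κ → List (SignedMatrix N)) (r : ℕ) (χ : ℤ) :
    wordCount r χ (fun k => V (σ k)) = wordCount r χ V :=
  wordCount_eq ((isRep_rotatePoints V).reindex σ) (fun k => map_rotatePoints V (σ k)) r χ

theorem exists_isRep_rotated (V V' : κ → List (SignedMatrix N))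
    (hV : ∀ k, (V k).IsRotated (V' k)) :
    ∃ w : κ → List (Points V), IsRep (rotatePoints V) w ∧
      ∀ k, (w k).map (fun x => ((V x.1)[x.2].1, (V x.1)[x.2].2)) = V' k := by
  choose m hm using hV
  refine ⟨fun k => (List.ofFn fun j => (⟨k, j⟩ : Points V)).rotate (m k),
    (isRep_rotatePoints V).rotated fun k => ⟨m k, rfl⟩, fun k => ?_⟩
  rw [List.map_rotate, map_rotatePoints, hm]

theorem wordCount_rotated {V V' : κ → List (SignedMatrix N)}
    (hV : ∀ k, (V k).IsRotated (V' k)) (r : ℕ) (χ : ℤ) :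
    wordCount r χ V' = wordCount r χ V := by
  obtain ⟨w, hw, hwV⟩ := exists_isRep_rotated V V' hV
  exact wordCount_eq hw hwV r χ

/-- A point inserted before `y` in the rotation is an extra first letter of the word that starts
with `y`. -/
theorem isRep_insertPoint {I : Type*} [DecidableEq I] {γ : Equiv.Perm I} {w : κ → List I}
    (h : IsRep γ w) {k₀ : κ} {y : I} {ys : List I} (hk₀ : w k₀ = y :: ys) :
    IsRep (insertPoint γ y)
      (fun k => if k = k₀ then none :: (w k).map some else (w k).map some) := by
  have hmap : ∀ l : List I, (∀ z ∈ l, γ z ≠ y) →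
      (l.map some).map (insertPoint γ y) = (l.map γ).map some := by
    intro l hl
    rw [List.map_map, List.map_map, List.map_inj_left]
    intro z hz
    exact insertPoint_some_of_ne (hl z hz)
  have hyk : y ∈ w k₀ := by rw [hk₀]; exact List.mem_cons_self
  refine ⟨fun k => ?_, fun k => ?_, fun k k' x hx hx' => ?_, fun x => ?_⟩
  · split_ifs with hk
    · subst hk
      have hrot := h.rot k
      have hnd := h.nodup k
      rw [hk₀] at hrot hnd ⊢
      rw [List.rotate_cons_succ, List.rotate_zero] at hrot ⊢
      obtain ⟨zs, z, hz⟩ : ∃ zs z, y :: ys = zs ++ [z] :=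
        ⟨(y :: ys).dropLast, (y :: ys).getLast (by simp),
          (List.dropLast_append_getLast (by simp)).symm⟩
      have hlen : zs.length = ys.length := by
        have := congrArg List.length hz; simp at this; exact this.symm
      rw [hz] at hrot ⊢
      rw [List.map_append] at hrot
      obtain ⟨h1, h2⟩ := List.append_inj hrot (by simp [hlen])
      simp only [List.map_cons, List.map_nil, List.cons.injEq, and_true] at h2
      rw [List.map_cons, insertPoint_none, List.map_append, List.map_append, hmap, h1,
        List.map_cons, List.map_nil, List.map_cons, List.map_nil, insertPoint_some_of_eq h2,
        ← List.cons_append, ← List.map_cons, hz, List.map_append, List.map_cons, List.map_nil]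
      · intro z' hz' hh
        have : γ z' ∈ zs.map γ := List.mem_map_of_mem hz'
        rw [h1, hh] at this
        exact (List.nodup_cons.1 hnd).1 this
    · rw [hmap, h.rot, List.map_rotate]
      intro z hz hh
      exact hk (h.uniq _ _ y (hh ▸ h.apply_mem hz) hyk)
  · split_ifs
    · rw [List.nodup_cons]
      exact ⟨by simp, (h.nodup k).map (Option.some_injective _)⟩
    · exact (h.nodup k).map (Option.some_injective _)
  · rcases x with _ | x
    · split_ifs at hx hx' with h1 h2
      · rw [h1, h2]
      · simp at hx'
      · simp at hx
      · simp at hx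
    · refine h.uniq k k' x ?_ ?_
      · split_ifs at hx <;> simpa using hx
      · split_ifs at hx' <;> simpa using hx'
  · rcases x with _ | x
    · exact ⟨k₀, by simp⟩
    · obtain ⟨k, hk⟩ := h.cover x
      refine ⟨k, ?_⟩
      split_ifs <;> simpa using hk

/-- The longer family is represented on the points of the shorter one with one point inserted;
`mapCount_insertPoint` then removes it. -/
theorem wordCount_merge {V V' : κ → List (SignedMatrix N)} (k₀ : κ)
    {M M' : Matrix (Fin N) (Fin N) ℂ} {s : SignType} {l : List (SignedMatrix N)}
    (h1 : V k₀ = (M, 0) :: (M', s) :: l) (h2 : V' k₀ = (M * M', s) :: l)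
    (h3 : ∀ k, k ≠ k₀ → V k = V' k) (r : ℕ) (χ : ℤ) : wordCount r χ V = wordCount r χ V' := by
  classical
  have hrep := isRep_rotatePoints V'
  have hmap := map_rotatePoints V'
  obtain ⟨y, ys, hy⟩ : ∃ y ys, (List.ofFn fun j => (⟨k₀, j⟩ : Points V')) = y :: ys := by
    refine List.exists_cons_of_ne_nil ?_
    intro h
    have := hmap k₀
    rw [h, h2] at this
    simp at this
  have hmap₀ := hmap k₀
  rw [hy, h2, List.map_cons, List.cons.injEq, Prod.mk.injEq] at hmap₀
  obtain ⟨⟨hyM, hys⟩, hysl⟩ := hmap₀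
  have hmem : y ∈ List.ofFn fun j => (⟨k₀, j⟩ : Points V') := by
    rw [hy]; exact List.mem_cons_self
  have hy1 : ∀ k, y ∈ (List.ofFn fun j => (⟨k, j⟩ : Points V')) → k = k₀ :=
    fun k hk => hrep.uniq _ _ y hk hmem
  let B : Option (Points V') → Matrix (Fin N) (Fin N) ℂ := fun o =>
    o.elim M fun z => if z = y then M' else (V' z.1)[z.2].1
  let ε : Option (Points V') → SignType := fun o => o.elim 0 fun z => (V' z.1)[z.2].2
  rw [wordCount_eq (isRep_insertPoint hrep hy) (B := B) (ε := ε) (V := V), wordCount]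
  · refine mapCount_insertPoint _ y rfl ?_ ?_ r χ
    · simp only [B, Option.elim_none, Option.elim_some, if_true]; exact hyM
    · intro z hz
      simp only [B, Option.elim_some, if_neg hz]
  · intro k
    have hother : ∀ l : List (Points V'), y ∉ l →
        (l.map some).map (fun x => (B x, ε x)) =
          l.map (fun x => ((V' x.1)[x.2].1, (V' x.1)[x.2].2)) := by
      intro l hl
      rw [List.map_map, List.map_inj_left]
      intro z hz
      have : z ≠ y := by rintro rfl; exact hl hz
      simp only [Function.comp_apply, B, ε, Option.elim_some, if_neg this]
    split_ifs with hk
    · subst hk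
      have hnd := hrep.nodup k
      simp only [hy] at hnd ⊢
      rw [List.map_cons, List.map_cons, List.map_cons, hother _ (List.nodup_cons.1 hnd).1, hysl, h1]
      simp only [B, ε, Option.elim_none, Option.elim_some, if_true, hys]
    · rw [hother, hmap k, h3 k hk]
      exact fun hh => hk (hy1 k hh)

/-- Cyclic words are considered up to rotation and up to the removal of points of sign zero. -/
inductive CycEquiv : List (SignedMatrix N) → List (SignedMatrix N) → Prop
  | rot (l : List (SignedMatrix N)) (m : ℕ) : CycEquiv l (l.rotate m)
  | merge (M M' : Matrix (Fin N) (Fin N) ℂ) (s : SignType) (l : List (SignedMatrix N)) :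
      CycEquiv ((M, 0) :: (M', s) :: l) ((M * M', s) :: l)
  | symm {l l' : List (SignedMatrix N)} : CycEquiv l l' → CycEquiv l' l
  | trans {l l' l'' : List (SignedMatrix N)} : CycEquiv l l' → CycEquiv l' l'' → CycEquiv l l''

theorem CycEquiv.refl (l : List (SignedMatrix N)) : CycEquiv l l := by
  simpa using CycEquiv.rot l 0

theorem CycEquiv.append_comm (l l' : List (SignedMatrix N)) : CycEquiv (l ++ l') (l' ++ l) := by
  have := CycEquiv.rot (l ++ l') l.length
  rwa [List.rotate_append_length_eq] at this

theorem CycEquiv.merge_mid (xs : List (SignedMatrix N)) (M M' : Matrix (Fin N) (Fin N) ℂ)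
    (s : SignType) (ys : List (SignedMatrix N)) :
    CycEquiv (xs ++ (M, 0) :: (M', s) :: ys) (xs ++ (M * M', s) :: ys) :=
  (CycEquiv.append_comm _ _).trans ((CycEquiv.merge M M' s (ys ++ xs)).trans
    (CycEquiv.append_comm ((M * M', s) :: ys) xs))

theorem wordCount_update {l l' : List (SignedMatrix N)} (h : CycEquiv l l')
    (V : κ → List (SignedMatrix N)) (k : κ) (r : ℕ) (χ : ℤ) :
    wordCount r χ (Function.update V k l) = wordCount r χ (Function.update V k l') := by
  induction h with
  | rot l m =>
    refine (wordCount_rotated (fun j => ?_) r χ).symm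
    by_cases hj : j = k
    · subst hj; simp only [Function.update_self]; exact ⟨m, rfl⟩
    · simp only [Function.update_of_ne hj]; exact List.IsRotated.refl _
  | merge M M' s l =>
    refine wordCount_merge k (by rw [Function.update_self]) (by rw [Function.update_self])
      (fun j hj => ?_) r χ
    rw [Function.update_of_ne hj, Function.update_of_ne hj]
  | symm _ ih => exact ih.symm
  | trans _ _ ih ih' => exact ih.trans ih'

/-- The words are replaced one at a time, by induction on the set of those already replaced. -/
theorem wordCount_congr {V V' : κ → List (SignedMatrix N)} (h : ∀ k, CycEquiv (V k) (V' k))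
    (r : ℕ) (χ : ℤ) : wordCount r χ V = wordCount r χ V' := by
  classical
  have key : ∀ S : Finset κ, wordCount r χ V = wordCount r χ (S.piecewise V' V) := by
    intro S
    induction S using Finset.induction_on with
    | empty => simp
    | insert k S hk ih =>
      rw [ih, Finset.piecewise_insert, ← wordCount_update (h k)]
      congr 1
      ext j : 1
      by_cases hj : j = k
      · subst hj; simp [hk]
      · simp [Function.update_of_ne hj]
  simpa using key Finset.univ

end WordCount

end

noncomputable section

/-! ## Cutting and joining cyclic words -/

section CutJoin

variable {n : ℕ} {I : Type*} [Fintype I] [DecidableEq I] {N : ℕ}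

/-- Only the points preceding `x` and `d` change successor: the one before `d` now returns to `x`,
and the one before `x` to `d`, which closes two cycles. -/
theorem isRep_cut {γ : Equiv.Perm I} {w : Fin n ⊕ Unit → List I} (h : IsRep γ w) {x d : I}
    {xs ys : List I} (hw : w (Sum.inr ()) = x :: ys ++ d :: xs) :
    IsRep (Equiv.swap x d * γ)
      (Sum.elim (fun k => w (Sum.inl k)) fun b : Bool => if b then d :: xs else x :: ys) := by
  have hrot := h.rot (Sum.inr ())
  have hnd := h.nodup (Sum.inr ())
  have hmem : ∀ z, z ∈ w (Sum.inr ()) ↔ z ∈ x :: ys ∨ z ∈ d :: xs := fun z => by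
    rw [hw, List.mem_append]
  rw [hw] at hrot hnd
  rw [List.cons_append, List.rotate_cons_succ, List.rotate_zero, ← List.cons_append,
    List.map_append] at hrot
  have hrot' : (x :: ys).map γ ++ (d :: xs).map γ = (ys ++ [d]) ++ (xs ++ [x]) := by
    rw [hrot]; simp
  obtain ⟨h1, h2⟩ := List.append_inj hrot' (by simp)
  have hs : ∀ l : List I, x ∉ l → d ∉ l → l.map (Equiv.swap x d) = l := by
    intro l hx hd
    conv_rhs => rw [← List.map_id l]
    rw [List.map_inj_left]
    intro z hz
    exact Equiv.swap_apply_of_ne_of_ne (fun e => hx (e ▸ hz)) (fun e => hd (e ▸ hz))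
  rw [List.nodup_append'] at hnd
  obtain ⟨hnd1, hnd2, hdisj⟩ := hnd
  have hx_ys : x ∉ ys := (List.nodup_cons.1 hnd1).1
  have hd_xs : d ∉ xs := (List.nodup_cons.1 hnd2).1
  have hd_ys : d ∉ ys := fun hh => hdisj (List.mem_cons_of_mem _ hh) List.mem_cons_self
  have hx_xs : x ∉ xs := fun hh => hdisj List.mem_cons_self (List.mem_cons_of_mem _ hh)
  have hmap : ∀ l : List I, l.map (Equiv.swap x d * γ) = (l.map γ).map (Equiv.swap x d) := by
    intro l; rw [List.map_map]; rfl
  have hout : ∀ k z, z ∈ w (Sum.inl k) → z ∉ w (Sum.inr ()) := fun k z hz hz' => by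
    have := h.uniq _ _ z hz hz'; simp at this
  have hb : ∀ (b : Bool) z, z ∈ (if b = true then d :: xs else x :: ys) → z ∈ w (Sum.inr ()) := by
    intro b z hz
    rw [hmem]
    split_ifs at hz
    · exact Or.inr hz
    · exact Or.inl hz
  refine ⟨?_, ?_, ?_, ?_⟩
  · rintro (k | b)
    · rw [Sum.elim_inl, hmap, h.rot, hs]
      · rw [List.mem_rotate]
        exact fun hh => hout k x hh ((hmem x).2 (Or.inl List.mem_cons_self))
      · rw [List.mem_rotate]
        exact fun hh => hout k d hh ((hmem d).2 (Or.inr List.mem_cons_self))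
    · rw [Sum.elim_inr, hmap]
      cases b
      · rw [if_neg (by decide), h1, List.map_append, hs _ hx_ys hd_ys, List.rotate_cons_succ,
          List.rotate_zero, List.map_singleton, Equiv.swap_apply_right]
      · rw [if_pos rfl, h2, List.map_append, hs _ hx_xs hd_xs, List.rotate_cons_succ,
          List.rotate_zero, List.map_singleton, Equiv.swap_apply_left]
  · rintro (k | b)
    · exact h.nodup _
    · rw [Sum.elim_inr]
      split_ifs
      · exact hnd2
      · exact hnd1
  · rintro (k | b) (k' | b') z hz hz'
    · have := h.uniq _ _ z hz hz'
      rw [Sum.inl_injective this]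
    · exact absurd (hb b' z hz') (hout k z hz)
    · exact absurd (hb b z hz) (hout k' z hz')
    · cases b <;> cases b'
      · rfl
      · exact absurd hz' (fun hh => hdisj hz hh)
      · exact absurd hz (fun hh => hdisj hz' hh)
      · rfl
  · intro z
    obtain ⟨k | ⟨⟩, hk⟩ := h.cover z
    · exact ⟨Sum.inl k, hk⟩
    · rcases (hmem z).1 hk with hz | hz
      · exact ⟨Sum.inr false, hz⟩
      · exact ⟨Sum.inr true, hz⟩

/-- Exchanging the successors of the points before `x` and before `d` now runs the two cycles into
each other. -/
theorem isRep_join {γ : Equiv.Perm I} {w : Fin n ⊕ Unit → List I} (h : IsRep γ w) {x d : I}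
    {xs ys : List I} {k₀ : Fin n} (hw₀ : w (Sum.inl k₀) = x :: xs)
    (hw : w (Sum.inr ()) = d :: ys) :
    IsRep (Equiv.swap x d * γ)
      (Sum.elim (fun k : {k : Fin n // k ≠ k₀} => w (Sum.inl k))
        fun _ : Unit => x :: xs ++ d :: ys) := by
  have h1 := h.rot (Sum.inl k₀)
  have h2 := h.rot (Sum.inr ())
  have hnd1 := h.nodup (Sum.inl k₀)
  have hnd2 := h.nodup (Sum.inr ())
  have hdisj : ∀ z, z ∈ x :: xs → z ∉ d :: ys := fun z hz hz' => by
    have := h.uniq _ _ z (hw₀ ▸ hz) (hw ▸ hz'); simp at this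
  rw [hw₀] at h1 hnd1
  rw [hw] at h2 hnd2
  rw [List.rotate_cons_succ, List.rotate_zero] at h1 h2
  have hs : ∀ l : List I, x ∉ l → d ∉ l → l.map (Equiv.swap x d) = l := by
    intro l hx hd
    conv_rhs => rw [← List.map_id l]
    rw [List.map_inj_left]
    intro z hz
    exact Equiv.swap_apply_of_ne_of_ne (fun e => hx (e ▸ hz)) (fun e => hd (e ▸ hz))
  have hx_xs : x ∉ xs := (List.nodup_cons.1 hnd1).1
  have hd_ys : d ∉ ys := (List.nodup_cons.1 hnd2).1
  have hd_xs : d ∉ xs := fun hh => hdisj d (List.mem_cons_of_mem _ hh) List.mem_cons_self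
  have hx_ys : x ∉ ys := fun hh => hdisj x List.mem_cons_self (List.mem_cons_of_mem _ hh)
  have hmap : ∀ l : List I, l.map (Equiv.swap x d * γ) = (l.map γ).map (Equiv.swap x d) := by
    intro l; rw [List.map_map]; rfl
  have hout : ∀ k z, k ≠ k₀ → z ∈ w (Sum.inl k) → z ∉ x :: xs ++ d :: ys := by
    intro k z hk hz hz'
    rcases List.mem_append.1 hz' with hh | hh
    · exact hk (Sum.inl_injective (h.uniq _ _ z hz (hw₀ ▸ hh)))
    · have := h.uniq _ _ z hz (hw ▸ hh); simp at this
  refine ⟨?_, ?_, ?_, ?_⟩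
  · rintro (⟨k, hk⟩ | ⟨⟩)
    · rw [Sum.elim_inl, hmap, h.rot, hs]
      · rw [List.mem_rotate]; exact fun hh => hout k x hk hh (by simp)
      · rw [List.mem_rotate]; exact fun hh => hout k d hk hh (by simp)
    · rw [Sum.elim_inr, hmap, List.map_append, h1, h2, List.map_append, List.map_append,
        List.map_append, hs _ hx_xs hd_xs, hs _ hx_ys hd_ys, List.map_singleton,
        List.map_singleton, Equiv.swap_apply_left, Equiv.swap_apply_right, List.cons_append,
        List.rotate_cons_succ, List.rotate_zero]
      simp
  · rintro (⟨k, hk⟩ | ⟨⟩)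
    · exact h.nodup _
    · rw [Sum.elim_inr, List.nodup_append']
      exact ⟨hnd1, hnd2, fun z hz hz' => hdisj z hz hz'⟩
  · rintro (⟨k, hk⟩ | ⟨⟩) (⟨k', hk'⟩ | ⟨⟩) z hz hz'
    · have := Sum.inl_injective (h.uniq _ _ z hz hz')
      subst this; rfl
    · exact absurd hz' (hout k z hk hz)
    · exact absurd hz (hout k' z hk' hz')
    · rfl
  · intro z
    obtain ⟨k | ⟨⟩, hk⟩ := h.cover z
    · by_cases hk₀ : k = k₀
      · subst hk₀
        exact ⟨Sum.inr (), List.mem_append.2 (Or.inl (hw₀ ▸ hk))⟩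
      · exact ⟨Sum.inl ⟨k, hk₀⟩, hk⟩
    · exact ⟨Sum.inr (), List.mem_append.2 (Or.inr (hw ▸ hk))⟩

theorem isRep_sum {κ₁ κ₂ X Y : Type*} {γ₁ : Equiv.Perm X} {γ₂ : Equiv.Perm Y} {w₁ : κ₁ → List X}
    {w₂ : κ₂ → List Y} (h₁ : IsRep γ₁ w₁) (h₂ : IsRep γ₂ w₂) :
    IsRep (Equiv.sumCongr γ₁ γ₂ : Equiv.Perm (X ⊕ Y))
      (Sum.elim (fun k => (w₁ k).map Sum.inl) fun k => (w₂ k).map Sum.inr) := by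
  refine ⟨?_, ?_, ?_, ?_⟩
  · rintro (k | k)
    · rw [Sum.elim_inl, List.map_map, ← List.map_rotate, ← h₁.rot, List.map_map]; rfl
    · rw [Sum.elim_inr, List.map_map, ← List.map_rotate, ← h₂.rot, List.map_map]; rfl
  · rintro (k | k)
    · exact (h₁.nodup k).map Sum.inl_injective
    · exact (h₂.nodup k).map Sum.inr_injective
  · rintro (k | k) (k' | k') z hz hz'
    · simp only [Sum.elim_inl, List.mem_map] at hz hz'
      obtain ⟨a, ha, rfl⟩ := hz
      obtain ⟨b, hb, hab⟩ := hz'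
      rw [h₁.uniq k k' a ha (Sum.inl_injective hab ▸ hb)]
    · simp only [Sum.elim_inl, Sum.elim_inr, List.mem_map] at hz hz'
      obtain ⟨a, ha, rfl⟩ := hz
      obtain ⟨b, hb, hab⟩ := hz'
      simp at hab
    · simp only [Sum.elim_inl, Sum.elim_inr, List.mem_map] at hz hz'
      obtain ⟨a, ha, rfl⟩ := hz
      obtain ⟨b, hb, hab⟩ := hz'
      simp at hab
    · simp only [Sum.elim_inr, List.mem_map] at hz hz'
      obtain ⟨a, ha, rfl⟩ := hz
      obtain ⟨b, hb, hab⟩ := hz'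
      rw [h₂.uniq k k' a ha (Sum.inr_injective hab ▸ hb)]
  · rintro (z | z)
    · obtain ⟨k, hk⟩ := h₁.cover z
      exact ⟨Sum.inl k, List.mem_map_of_mem hk⟩
    · obtain ⟨k, hk⟩ := h₂.cover z
      exact ⟨Sum.inr k, List.mem_map_of_mem hk⟩

/-- The distribution of the vertices between the two components. -/
def splitVertices (K : Finset (Fin n)) :
    Fin n ⊕ Bool ≃ ({j // j ∈ K} ⊕ Unit) ⊕ ({j // j ∉ K} ⊕ Unit) where
  toFun := Sum.elim
    (fun j => if hj : j ∈ K then Sum.inl (Sum.inl ⟨j, hj⟩) else Sum.inr (Sum.inl ⟨j, hj⟩))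
    (fun b => if b then Sum.inl (Sum.inr ()) else Sum.inr (Sum.inr ()))
  invFun := Sum.elim (Sum.elim (fun j => Sum.inl j) fun _ => Sum.inr true)
    (Sum.elim (fun j => Sum.inl j) fun _ => Sum.inr false)
  left_inv := by
    rintro (j | b)
    · by_cases hj : j ∈ K <;> simp [hj]
    · cases b <;> simp
  right_inv := by
    rintro ((⟨j, hj⟩ | ⟨⟩) | (⟨j, hj⟩ | ⟨⟩))
    · simp [hj]
    · simp
    · simp [hj]
    · simp

/-- After relabelling by the two sets of words selected by `K`, the colouring becomes the left/right
partition and `mapCount_sum` applies. -/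
theorem mapCount_side {γ : Equiv.Perm I} {w : Fin n ⊕ Bool → List I} (h : IsRep γ w)
    (hne : ∀ k, w k ≠ []) (ε : I → SignType) (B : I → Matrix (Fin N) (Fin N) ℂ)
    {V : Fin n ⊕ Bool → List (SignedMatrix N)}
    (hV : ∀ k, (w k).map (fun x => (B x, ε x)) = V k) (K : Finset (Fin n)) (r g : ℕ) :
    mapCount r (4 - 2 * g) (Setoid.ker (sideOf h.vertex K)) γ ε B =
      ∑ q ∈ Finset.HasAntidiagonal.antidiagonal g, ∑ s ∈ Finset.HasAntidiagonal.antidiagonal r,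
        wordCount s.1 (2 - 2 * q.1) (Sum.elim (fun j : {j // j ∈ K} => V (Sum.inl j))
          fun _ : Unit => V (Sum.inr true)) *
        wordCount s.2 (2 - 2 * q.2) (Sum.elim (fun j : {j // j ∉ K} => V (Sum.inl j))
          fun _ : Unit => V (Sum.inr false)) := by
  set V₁ : {j // j ∈ K} ⊕ Unit → List (SignedMatrix N) :=
    Sum.elim (fun j => V (Sum.inl j)) fun _ => V (Sum.inr true) with hV₁
  set V₂ : {j // j ∉ K} ⊕ Unit → List (SignedMatrix N) :=
    Sum.elim (fun j => V (Sum.inl j)) fun _ => V (Sum.inr false) with hV₂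
  have hVne : ∀ k, V k ≠ [] := fun k hk => by
    rw [← hV, List.map_eq_nil_iff] at hk; exact hne k hk
  have : Nonempty (Points V₁) :=
    ⟨⟨Sum.inr (), 0, List.length_pos_iff.2 (hVne (Sum.inr true))⟩⟩
  have : Nonempty (Points V₂) :=
    ⟨⟨Sum.inr (), 0, List.length_pos_iff.2 (hVne (Sum.inr false))⟩⟩
  have hrep := (isRep_sum (isRep_rotatePoints V₁) (isRep_rotatePoints V₂)).reindex
    (splitVertices K)
  let f' : Points V₁ ⊕ Points V₂ → SignedMatrix N :=
    Sum.elim (fun x => ((V₁ x.1)[x.2].1, (V₁ x.1)[x.2].2))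
      fun x => ((V₂ x.1)[x.2].1, (V₂ x.1)[x.2].2)
  obtain ⟨e, he1, he2, he3⟩ := h.exists_equiv hrep (f := fun x => (B x, ε x)) (f' := f') (by
    have e1 : ∀ k, ((List.ofFn fun j => (⟨k, j⟩ : Points V₁)).map Sum.inl).map f' = V₁ k := by
      intro k; rw [List.map_map]; exact map_rotatePoints V₁ k
    have e2 : ∀ k, ((List.ofFn fun j => (⟨k, j⟩ : Points V₂)).map Sum.inr).map f' = V₂ k := by
      intro k; rw [List.map_map]; exact map_rotatePoints V₂ k
    rintro (k | b)
    · rw [hV]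
      by_cases hk : k ∈ K
      · simp only [splitVertices, Equiv.coe_fn_mk, Sum.elim_inl, dif_pos hk, e1]; rfl
      · simp only [splitVertices, Equiv.coe_fn_mk, Sum.elim_inl, dif_neg hk, Sum.elim_inr, e2]; rfl
    · rw [hV]
      cases b
      · simp only [splitVertices, Equiv.coe_fn_mk, Sum.elim_inr, Bool.false_eq_true, if_false, e2]
        rfl
      · simp only [splitVertices, Equiv.coe_fn_mk, Sum.elim_inr, if_true, Sum.elim_inl, e1]
        rfl)
  have hside : ∀ x, Sum.isLeft (e x) = sideOf h.vertex K x := by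
    intro x
    have hx := h.mem_vertex x
    have hex : e x ∈ (w (h.vertex x)).map e := List.mem_map_of_mem hx
    rw [← he1] at hex
    rcases hk : h.vertex x with k | b
    · rw [hk] at hex
      by_cases hkK : k ∈ K
      · simp only [splitVertices, Equiv.coe_fn_mk, Sum.elim_inl, dif_pos hkK, List.mem_map] at hex
        obtain ⟨a, -, ha⟩ := hex
        simp [sideOf, hk, hkK, ← ha]
      · simp only [splitVertices, Equiv.coe_fn_mk, Sum.elim_inl, Sum.elim_inr, dif_neg hkK,
          List.mem_map] at hex
        obtain ⟨a, -, ha⟩ := hex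
        simp [sideOf, hk, hkK, ← ha]
    · rw [hk] at hex
      cases b
      · simp only [splitVertices, Equiv.coe_fn_mk, Sum.elim_inr, Bool.false_eq_true, if_false,
          List.mem_map] at hex
        obtain ⟨a, -, ha⟩ := hex
        simp [sideOf, hk, ← ha]
      · simp only [splitVertices, Equiv.coe_fn_mk, Sum.elim_inr, if_true, Sum.elim_inl,
          List.mem_map] at hex
        obtain ⟨a, -, ha⟩ := hex
        simp [sideOf, hk, ← ha]
  rw [← mapCount_equiv e he2 (ε' := fun x => (f' x).2) (B' := fun x => (f' x).1)
    (η' := Setoid.ker Sum.isLeft), mapCount_sum]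
  · rfl
  · exact fun x => congrArg Prod.snd (he3 x)
  · exact fun x => congrArg Prod.fst (he3 x)
  · intro x y
    rw [Setoid.ker_def, Setoid.ker_def, hside, hside]

variable {γ : Equiv.Perm I} {w : Fin n ⊕ Unit → List I} {ε : I → SignType}
  {B : I → Matrix (Fin N) (Fin N) ℂ} {x d : I}

theorem map_swap_data {l : List I} (hx : x ∉ l) (hd : d ∉ l) :
    l.map (fun z => (B (Equiv.swap x d z), ε z)) = l.map (fun z => (B z, ε z)) := by
  rw [List.map_inj_left]
  intro z hz
  have h1 : z ≠ x := fun e => hx (e ▸ hz)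
  have h2 : z ≠ d := fun e => hd (e ▸ hz)
  rw [Equiv.swap_apply_of_ne_of_ne h1 h2]

/-- The words of `x` and `d` become one. One vertex is lost, which compensates the shift by 1 in the
Euler characteristic: the genus is unchanged. -/
theorem cutCount_join (h : IsRep γ w) {xs ys : List I} {k₀ : Fin n}
    (hw₀ : w (Sum.inl k₀) = x :: xs) (hw : w (Sum.inr ()) = d :: ys) (r : ℕ) (χ : ℤ) :
    cutCount r (χ + 1 + numCycles (Equiv.swap x d * γ) - numCycles γ) (Equiv.swap x d * γ) ε
        (fun z => B (Equiv.swap x d z)) x d =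
      wordCount r χ (Sum.elim
        (fun k : {k : Fin n // k ≠ k₀} => (w (Sum.inl k)).map fun z => (B z, ε z))
        fun _ : Unit => (B d, ε x) :: xs.map (fun z => (B z, ε z)) ++
          (B x, ε d) :: ys.map fun z => (B z, ε z)) := by
  have hrep := isRep_join h hw₀ hw
  have hxk : x ∈ w (Sum.inl k₀) := by rw [hw₀]; exact List.mem_cons_self
  have hdk : d ∈ w (Sum.inr ()) := by rw [hw]; exact List.mem_cons_self
  have hn : ¬ orb γ x d := by
    rw [h.orb_eq, Setoid.ker_def, h.vertex_eq hxk, h.vertex_eq hdk]; simp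
  have hrel : orb (Equiv.swap x d * γ) x d := sameCycle_swap_mul hn
  have hc := numCycles_swap_mul_of_not hn
  have hχ : χ + 1 + numCycles (Equiv.swap x d * γ) - numCycles γ = χ := by
    rw [← hc]; push_cast; ring
  rw [hχ, cutCount_of_rel hrel]
  refine (wordCount_eq hrep ?_ r χ).symm
  have hnd1 := h.nodup (Sum.inl k₀)
  have hnd2 := h.nodup (Sum.inr ())
  have hxs : ∀ k, x ∈ w k → k = Sum.inl k₀ := fun k hk => h.uniq _ _ x hk hxk
  have hds : ∀ k, d ∈ w k → k = Sum.inr () := fun k hk => h.uniq _ _ d hk hdk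
  have hd_xs : d ∉ xs := fun hh => by
    have := hds (Sum.inl k₀) (by rw [hw₀]; exact List.mem_cons_of_mem _ hh)
    simp at this
  have hx_ys : x ∉ ys := fun hh => by
    have := hxs (Sum.inr ()) (by rw [hw]; exact List.mem_cons_of_mem _ hh)
    simp at this
  rw [hw₀] at hnd1
  rw [hw] at hnd2
  rintro (⟨k, hk⟩ | ⟨⟩)
  · refine map_swap_data (fun hh => hk ?_) (fun hh => ?_)
    · exact Sum.inl_injective (hxs _ hh)
    · have := hds _ hh; simp at this
  · rw [Sum.elim_inr, Sum.elim_inr, List.map_append, List.map_cons, List.map_cons,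
      map_swap_data (List.nodup_cons.1 hnd1).1 hd_xs,
      map_swap_data hx_ys (List.nodup_cons.1 hnd2).1, Equiv.swap_apply_left,
      Equiv.swap_apply_right]

theorem cutCount_comm (r : ℕ) (χ : ℤ) : cutCount r χ γ ε B x d = cutCount r χ γ ε B d x := by
  rw [cutCount, cutCount, joinPair_comm x d]

/-- One vertex is gained and the Euler characteristic becomes 4 − 2g. This is genus g − 1 for a
connected map, and genera of sum g for two components. -/
theorem cutCount_cut (h : IsRep γ w) (hne : ∀ k, w k ≠ []) {xs ys : List I}
    (hw : w (Sum.inr ()) = x :: ys ++ d :: xs) (r g : ℕ)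
    {v : Fin n → List (SignedMatrix N)} {Q R : List (SignedMatrix N)}
    (hv : ∀ k, (w (Sum.inl k)).map (fun z => (B z, ε z)) = v k)
    (hQ : (B x, ε d) :: xs.map (fun z => (B z, ε z)) = Q)
    (hR : (B d, ε x) :: ys.map (fun z => (B z, ε z)) = R) :
    cutCount r (2 - 2 * g + 1 + numCycles (Equiv.swap x d * γ) - numCycles γ)
        (Equiv.swap x d * γ) ε (fun z => B (Equiv.swap x d z)) x d =
      wordCount r (2 - 2 * (g - 1)) (Sum.elim v fun b : Bool => if b then Q else R) +
      ∑ K : Finset (Fin n), ∑ q ∈ Finset.HasAntidiagonal.antidiagonal g,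
        ∑ s ∈ Finset.HasAntidiagonal.antidiagonal r,
          wordCount s.1 (2 - 2 * q.1)
            (Sum.elim (fun j : {j // j ∈ K} => v j) fun _ : Unit => Q) *
          wordCount s.2 (2 - 2 * q.2)
            (Sum.elim (fun j : {j // j ∉ K} => v j) fun _ : Unit => R) := by
  have hrep := isRep_cut h hw
  have hxk : x ∈ w (Sum.inr ()) := by rw [hw]; simp
  have hdk : d ∈ w (Sum.inr ()) := by rw [hw]; simp
  have hnd := h.nodup (Sum.inr ())
  rw [hw, List.nodup_append'] at hnd
  obtain ⟨hnd1, hnd2, hdisj⟩ := hnd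
  have hxd : x ≠ d := fun e => hdisj List.mem_cons_self (e ▸ List.mem_cons_self)
  have hvx := hrep.vertex_eq (x := x) (k := Sum.inr false) (by simp)
  have hvd := hrep.vertex_eq (x := d) (k := Sum.inr true) (by simp)
  have hn : ¬ orb (Equiv.swap x d * γ) x d := by
    rw [hrep.orb_eq, Setoid.ker_def, hvx, hvd]; simp
  have hc : numCycles (Equiv.swap x d * γ) = numCycles γ + 1 := by
    rcases orb_swap_mul_cases (f := γ) hxd with ⟨-, -, hc⟩ | ⟨-, hh, -⟩
    · exact hc
    · exact absurd hh hn
  have hχ : (2 - 2 * g + 1 + numCycles (Equiv.swap x d * γ) - numCycles γ : ℤ) = 4 - 2 * g := by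
    rw [hc]; push_cast; ring
  have hne' : ∀ k, (Sum.elim (fun k => w (Sum.inl k))
      fun b : Bool => if b then d :: xs else x :: ys) k ≠ [] := by
    rintro (k | b)
    · exact hne _
    · cases b <;> simp
  have hV : ∀ k, ((Sum.elim (fun k => w (Sum.inl k))
      fun b : Bool => if b then d :: xs else x :: ys) k).map
        (fun z => (B (Equiv.swap x d z), ε z)) =
      (Sum.elim v fun b : Bool => if b then Q else R) k := by
    rintro (k | b)
    · rw [Sum.elim_inl, Sum.elim_inl, ← hv]
      refine map_swap_data (fun hh => ?_) (fun hh => ?_)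
      · have := h.uniq _ _ x hh hxk; simp at this
      · have := h.uniq _ _ d hh hdk; simp at this
    · cases b
      · rw [Sum.elim_inr, Sum.elim_inr, if_neg (by decide), if_neg (by decide), ← hR,
          List.map_cons, map_swap_data (List.nodup_cons.1 hnd1).1
            (fun hh => hdisj (List.mem_cons_of_mem _ hh) List.mem_cons_self),
          Equiv.swap_apply_left]
      · rw [Sum.elim_inr, Sum.elim_inr, if_pos rfl, if_pos rfl, ← hQ,
          List.map_cons, map_swap_data
            (fun hh => hdisj List.mem_cons_self (List.mem_cons_of_mem _ hh))
            (List.nodup_cons.1 hnd2).1, Equiv.swap_apply_right]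
  -- The roles of `x` and `d` are exchanged because the piece `Q`, labelled `true`, is the one
  -- containing the point `d`.
  rw [hχ, cutCount_comm, cutCount_of_not_rel (hrep.vertex_surjective hne') hvd hvx hrep.orb_eq]
  congr 1
  · rw [wordCount_eq hrep hV]
    congr 1
    ring
  · refine Finset.sum_congr rfl fun K _ => ?_
    rw [mapCount_side hrep hne' ε _ hV K r g]
    rfl

end CutJoin

end

noncomputable section

/-! ## The recursion for families of cyclic words -/

section Recursion

variable {n N : ℕ}

theorem CycEquiv.cons_append (a : SignedMatrix N) (l : List (SignedMatrix N)) :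
    CycEquiv (a :: l) (l ++ [a]) := CycEquiv.append_comm [a] l

section Abstract

variable {I : Type*} [Fintype I] [DecidableEq I] {γ : Equiv.Perm I} {w : Fin n ⊕ Unit → List I}
  {ε ε' : I → SignType} {B : I → Matrix (Fin N) (Fin N) ℂ} {x d : I} {s : SignType}
  {v : Fin n → List (SignedMatrix N)} {u : List (SignedMatrix N)}

theorem map_data_congr (hε : ∀ z, z ≠ x → z ≠ d → ε' z = ε z) {l : List I} (hx : x ∉ l)
    (hd : d ∉ l) : l.map (fun z => (B z, ε' z)) = l.map (fun z => (B z, ε z)) := by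
  rw [List.map_inj_left]
  intro z hz
  have h1 : z ≠ x := fun e => hx (e ▸ hz)
  have h2 : z ≠ d := fun e => hd (e ▸ hz)
  rw [hε z h1 h2]

/-- The lists are first rotated to start at `x` and at `d`. Once the merged word is rotated back,
the exchange of the two matrices puts each of them again after the letters which preceded it, so the
words are simply concatenated, opened after `x` and after `d`. -/
theorem cutCount_join_word (h : IsRep γ w) (hv : ∀ k, (w (Sum.inl k)).map (fun z => (B z, ε z)) = v k)
    {o p q : List I} (hd : w (Sum.inr ()) = o ++ [d]) (hu : o.map (fun z => (B z, ε z)) = u)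
    {k₀ : Fin n} (hx : w (Sum.inl k₀) = p ++ x :: q)
    (hε : ∀ z, z ≠ x → z ≠ d → ε' z = ε z) (hεx : ε' x = s) (hεd : ε' d = s) (r : ℕ) (χ : ℤ) :
    cutCount r (χ + 1 + numCycles (Equiv.swap x d * γ) - numCycles γ) (Equiv.swap x d * γ) ε'
        (fun z => B (Equiv.swap x d z)) x d =
      wordCount r χ (Sum.elim (fun k : {k : Fin n // k ≠ k₀} => v k)
        fun _ : Unit => q.map (fun z => (B z, ε z)) ++ p.map (fun z => (B z, ε z)) ++
          (B x, s) :: u ++ [(B d, s)]) := by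
  classical
  have hxk : x ∈ w (Sum.inl k₀) := by rw [hx]; simp
  have hdk : d ∈ w (Sum.inr ()) := by rw [hd]; simp
  have hxs : ∀ k, x ∈ w k → k = Sum.inl k₀ := fun k hk => h.uniq _ _ x hk hxk
  have hds : ∀ k, d ∈ w k → k = Sum.inr () := fun k hk => h.uniq _ _ d hk hdk
  let w' : Fin n ⊕ Unit → List I := fun k =>
    if k = Sum.inl k₀ then x :: (q ++ p) else if k = Sum.inr () then d :: o else w k
  have hrep : IsRep γ w' := by
    refine h.rotated fun k => ?_
    simp only [w']
    split_ifs with h1 h2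
    · rw [h1, hx, ← List.cons_append]; exact List.isRotated_append
    · rw [h2, hd]; exact List.isRotated_append
    · exact List.IsRotated.refl _
  rw [cutCount_join hrep (k₀ := k₀) (x := x) (d := d) (xs := q ++ p) (ys := o) (by simp [w'])
    (by simp [w']), hεx, hεd]
  refine wordCount_congr ?_ r χ
  have hnd1 := h.nodup (Sum.inl k₀)
  have hnd2 := h.nodup (Sum.inr ())
  rintro (⟨k, hk⟩ | ⟨⟩)
  · have e1 : w' (Sum.inl k) = w (Sum.inl k) := by simp [w', hk]
    rw [Sum.elim_inl, Sum.elim_inl, e1, map_data_congr hε, hv]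
    · exact CycEquiv.refl _
    · exact fun hh => hk (Sum.inl_injective (hxs _ hh))
    · intro hh; have := hds _ hh; simp at this
  · rw [Sum.elim_inr, Sum.elim_inr, map_data_congr hε, map_data_congr hε, hu, List.map_append,
      List.cons_append]
    · have := CycEquiv.cons_append (B d, s)
        (q.map (fun z => (B z, ε z)) ++ p.map (fun z => (B z, ε z)) ++ (B x, s) :: u)
      simpa [List.append_assoc] using this
    · intro hh; have := hxs (Sum.inr ()) (by rw [hd]; simp [hh]); simp at this
    · rw [hd, List.nodup_append'] at hnd2
      exact fun hh => hnd2.2.2 hh (by simp)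
    · rw [hx, List.nodup_append', List.nodup_cons] at hnd1
      intro hh
      rcases List.mem_append.1 hh with hh | hh
      · exact hnd1.2.1.1 hh
      · exact hnd1.2.2 hh (by simp)
    · intro hh
      have := hds (Sum.inl k₀) (by
        rw [hx]
        rcases List.mem_append.1 hh with hh | hh <;> simp [hh])
      simp at this

/-- The two components obtained by cutting a word. -/
def splitCount (r g : ℕ) (v : Fin n → List (SignedMatrix N)) (Q R : List (SignedMatrix N)) : ℂ :=
  ∑ q ∈ Finset.HasAntidiagonal.antidiagonal g, ∑ K : Finset (Fin n),
    ∑ s ∈ Finset.HasAntidiagonal.antidiagonal r,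
      wordCount s.1 (2 - 2 * q.1) (Sum.elim (fun j : {j // j ∈ K} => v j) fun _ : Unit => Q) *
      wordCount s.2 (2 - 2 * q.2) (Sum.elim (fun j : {j // j ∉ K} => v j) fun _ : Unit => R)

/-- The last word is cut right after `x`. The common new sign `s` of `x` and `d` is 0 when an edge
was deleted and 1 when a black vertex was. -/
theorem cutCount_cut_word (h : IsRep γ w) (hne : ∀ k, w k ≠ [])
    (hv : ∀ k, (w (Sum.inl k)).map (fun z => (B z, ε z)) = v k)
    {p q : List I} (hd : w (Sum.inr ()) = p ++ x :: q ++ [d])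
    (hε : ∀ z, z ≠ x → z ≠ d → ε' z = ε z) (hεx : ε' x = s) (hεd : ε' d = s) (r g : ℕ) :
    cutCount r (2 - 2 * g + 1 + numCycles (Equiv.swap x d * γ) - numCycles γ)
        (Equiv.swap x d * γ) ε' (fun z => B (Equiv.swap x d z)) x d =
      wordCount r (2 - 2 * (g - 1)) (Sum.elim v fun b : Bool =>
        if b then p.map (fun z => (B z, ε z)) ++ [(B x, s)]
        else q.map (fun z => (B z, ε z)) ++ [(B d, s)]) +
      splitCount r g v (p.map (fun z => (B z, ε z)) ++ [(B x, s)])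
        (q.map (fun z => (B z, ε z)) ++ [(B d, s)]) := by
  classical
  have hxk : x ∈ w (Sum.inr ()) := by rw [hd]; simp
  have hdk : d ∈ w (Sum.inr ()) := by rw [hd]; simp
  let w' : Fin n ⊕ Unit → List I := fun k =>
    if k = Sum.inr () then x :: q ++ d :: p else w k
  have hrep : IsRep γ w' := by
    refine h.rotated fun k => ?_
    simp only [w']
    split_ifs with h1
    · rw [h1, hd]
      have : x :: q ++ d :: p = (x :: q ++ [d]) ++ p := by simp
      rw [this, List.append_assoc]
      exact List.isRotated_append
    · exact List.IsRotated.refl _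
  have hnd := h.nodup (Sum.inr ())
  rw [hd, List.nodup_append', List.nodup_append', List.nodup_cons] at hnd
  obtain ⟨⟨hndp, ⟨hxq, hndq⟩, hpq⟩, -, hdd⟩ := hnd
  have hxp : x ∉ p := fun hh => hpq hh List.mem_cons_self
  have hdp : d ∉ p := fun hh => hdd (List.mem_append.2 (Or.inl hh)) (by simp)
  have hdq : d ∉ q := fun hh => hdd (List.mem_append.2 (Or.inr (List.mem_cons_of_mem _ hh))) (by simp)
  rw [cutCount_cut hrep (x := x) (d := d) (xs := p) (ys := q)
    (Q := (B x, s) :: p.map fun z => (B z, ε z)) (R := (B d, s) :: q.map fun z => (B z, ε z))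
    (v := v)]
  · rw [Finset.sum_comm, splitCount]
    refine congrArg₂ (· + ·) ?_ ?_
    · refine wordCount_congr ?_ _ _
      rintro (k | b)
      · exact CycEquiv.refl _
      · cases b
        · exact CycEquiv.cons_append _ _
        · exact CycEquiv.cons_append _ _
    · refine Finset.sum_congr rfl fun q' _ => Finset.sum_congr rfl fun K _ =>
        Finset.sum_congr rfl fun s' _ => ?_
      refine congrArg₂ (· * ·) ?_ ?_
      · refine wordCount_congr ?_ _ _
        rintro (k | b)
        · exact CycEquiv.refl _
        · exact CycEquiv.cons_append _ _
      · refine wordCount_congr ?_ _ _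
        rintro (k | b)
        · exact CycEquiv.refl _
        · exact CycEquiv.cons_append _ _
  · intro k
    simp only [w']
    split_ifs
    · simp
    · exact hne k
  · simp [w']
  · intro k
    have e1 : w' (Sum.inl k) = w (Sum.inl k) := by simp [w']
    rw [e1, map_data_congr hε, hv]
    · intro hh; have := h.uniq _ _ x hh hxk; simp at this
    · intro hh; have := h.uniq _ _ d hh hdk; simp at this
  · rw [map_data_congr hε hxp hdp, hεd]
  · rw [map_data_congr hε hxq hdq, hεx]

end Abstract

/-- The sum over the positions of the letters with exponent `s`. -/
def posSum (l : List (SignedMatrix N)) (s : SignType)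
    (F : List (SignedMatrix N) → Matrix (Fin N) (Fin N) ℂ → List (SignedMatrix N) → ℂ) : ℂ :=
  ∑ j : Fin l.length, if l[j].2 = s then F (l.take j) l[j].1 (l.drop (j + 1)) else 0

/-- The maps in which the last letter interacts with another word. -/
def joinCount (r : ℕ) (χ : ℤ) (v : Fin n → List (SignedMatrix N)) (u : List (SignedMatrix N))
    (M : Matrix (Fin N) (Fin N) ℂ) (s s' : SignType) : ℂ :=
  ∑ k, posSum (v k) s fun xs M' ys =>
    wordCount r χ (Sum.elim (fun k' : {k' : Fin n // k' ≠ k} => v k')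
      fun _ : Unit => ys ++ xs ++ (M', s') :: u ++ [(M, s')])

/-- The maps in which the last letter interacts with its own word. -/
def selfCount (r g : ℕ) (v : Fin n → List (SignedMatrix N)) (u : List (SignedMatrix N))
    (M : Matrix (Fin N) (Fin N) ℂ) (s s' : SignType) : ℂ :=
  posSum u s fun xs M' ys =>
    wordCount r (2 - 2 * (g - 1))
      (Sum.elim v fun b : Bool => if b then xs ++ [(M', s')] else ys ++ [(M, s')]) +
    splitCount r g v (xs ++ [(M', s')]) (ys ++ [(M, s')])

theorem sum_fin_append_singleton {A : Type*} (u : List A) (a : A)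
    (f : Fin (u ++ [a]).length → ℂ) :
    ∑ j, f j = ∑ j : Fin u.length, f ⟨j, by simp⟩ + f ⟨u.length, by simp⟩ := by
  rw [← Equiv.sum_comp (finCongr (by simp : u.length + 1 = (u ++ [a]).length)),
    Fin.sum_univ_castSucc]
  rfl

variable (v : Fin n → List (SignedMatrix N)) (u : List (SignedMatrix N))
  (M : Matrix (Fin N) (Fin N) ℂ)

/-- The family of all words. -/
abbrev fullFamily : Fin n ⊕ Unit → List (SignedMatrix N) := Sum.elim v fun _ => u ++ [(M, 1)]

/-- The point of the last letter. -/
def lastPoint : Points (fullFamily v u M) :=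
  ⟨Sum.inr (), ⟨u.length, by simp [fullFamily]⟩⟩

theorem sum_points (f : Points (fullFamily v u M) → ℂ) :
    ∑ x, f x = (∑ k, ∑ j : Fin (v k).length, f ⟨Sum.inl k, j⟩) +
      (∑ j : Fin u.length, f ⟨Sum.inr (), ⟨j, by simp [fullFamily]⟩⟩) +
      f (lastPoint v u M) := by
  rw [Fintype.sum_sigma, Fintype.sum_sum_type, Fintype.sum_unique (fun k : Unit => ∑ j, f ⟨Sum.inr k, j⟩),
    add_assoc]
  congr 1
  exact sum_fin_append_singleton u (M, 1) (fun j => f ⟨Sum.inr (), j⟩)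

/-- The sum over the points of given sign, except the last one, of the cut maps. -/
theorem sum_cutCount (hne : ∀ k, v k ≠ []) (r g : ℕ) (s s' : SignType)
    (ε' : Points (fullFamily v u M) → Points (fullFamily v u M) → SignType)
    (hε : ∀ x z, z ≠ x → z ≠ lastPoint v u M → ε' x z = (fullFamily v u M z.1)[z.2].2)
    (hεx : ∀ x, (fullFamily v u M x.1)[x.2].2 = s → ε' x x = s')
    (hεd : ∀ x, (fullFamily v u M x.1)[x.2].2 = s → ε' x (lastPoint v u M) = s') :
    (∑ x, if (fullFamily v u M x.1)[x.2].2 = s ∧ x ≠ lastPoint v u M then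
      cutCount r (2 - 2 * g + 1 + numCycles (Equiv.swap x (lastPoint v u M) *
          rotatePoints (fullFamily v u M)) - numCycles (rotatePoints (fullFamily v u M)))
        (Equiv.swap x (lastPoint v u M) * rotatePoints (fullFamily v u M)) (ε' x)
        (fun z => (fullFamily v u M (Equiv.swap x (lastPoint v u M) z).1)[
          (Equiv.swap x (lastPoint v u M) z).2].1) x (lastPoint v u M) else 0) =
    joinCount r (2 - 2 * g) v u M s s' + selfCount r g v u M s s' := by
  have hrep := isRep_rotatePoints (fullFamily v u M)
  have hmap := map_rotatePoints (fullFamily v u M)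
  set o : Fin n ⊕ Unit → List (Points (fullFamily v u M)) :=
    fun k => List.ofFn fun j => (⟨k, j⟩ : Points (fullFamily v u M)) with ho
  have hlen : ∀ k, (o k).length = (fullFamily v u M k).length := fun k => by simp [ho]
  have hget : ∀ k (j : Fin (fullFamily v u M k).length),
      (o k)[j.1]'(by rw [hlen]; exact j.2) = ⟨k, j⟩ := fun k j => by simp [ho]
  have hsplit : ∀ k (j : Fin (fullFamily v u M k).length),
      o k = (o k).take j ++ ⟨k, j⟩ :: (o k).drop (j + 1) := fun k j => by
    rw [← hget, List.getElem_cons_drop, List.take_append_drop]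
  have hlast : o (Sum.inr ()) = (o (Sum.inr ())).take u.length ++ [lastPoint v u M] := by
    have h1 := hsplit (Sum.inr ()) (lastPoint v u M).2
    have h2 : (o (Sum.inr ())).drop (u.length + 1) = [] := by
      rw [List.drop_eq_nil_iff, hlen]; simp [fullFamily]
    change o (Sum.inr ()) = _ ++ _ :: (o (Sum.inr ())).drop (u.length + 1) at h1
    rw [h2] at h1
    exact h1
  have hu : ((o (Sum.inr ())).take u.length).map
      (fun x => ((fullFamily v u M x.1)[x.2].1, (fullFamily v u M x.1)[x.2].2)) = u := by
    rw [List.map_take, hmap]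
    simp [fullFamily]
  have hne' : ∀ k, o k ≠ [] := by
    intro k hk
    have := hlen k
    rw [hk] at this
    rcases k with k | k
    · exact hne k (List.length_eq_zero_iff.1 this.symm)
    · simp [fullFamily] at this
  -- A point of another word produces a join, a point of the last word a cut, and the last point
  -- itself is excluded.
  rw [sum_points, if_neg (by simp), add_zero]
  congr 1
  · refine Finset.sum_congr rfl fun k _ => Finset.sum_congr rfl fun j _ => ?_
    have hx : (⟨Sum.inl k, j⟩ : Points (fullFamily v u M)) ≠ lastPoint v u M := by
      intro h; have := congrArg Sigma.fst h; simp [lastPoint] at this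
    simp only [ne_eq, hx, not_false_eq_true, and_true]
    change (if (v k)[j].2 = s then _ else _) = (if (v k)[j].2 = s then _ else _)
    by_cases hs : (v k)[j].2 = s
    · rw [if_pos hs, if_pos hs]
      rw [cutCount_join_word hrep (fun k => hmap (Sum.inl k)) hlast hu (hsplit (Sum.inl k) j)
        (hε _) (hεx _ hs) (hεd _ hs)]
      rw [List.map_take, List.map_drop, hmap]
      congr 1
      ext1 (k' | k')
      · rfl
      · simp only [fullFamily, lastPoint, Sum.elim_inr, Sum.elim_inl]
        congr 1
        simp
    · rw [if_neg hs, if_neg hs]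
  · refine Finset.sum_congr rfl fun j _ => ?_
    have hj : j.1 < (fullFamily v u M (Sum.inr ())).length := by simp [fullFamily]
    have hx : (⟨Sum.inr (), ⟨j, hj⟩⟩ : Points (fullFamily v u M)) ≠ lastPoint v u M := by
      intro h
      have : j.1 = u.length := congrArg (fun x : Points (fullFamily v u M) => x.2.1) h
      omega
    have hdata : (fullFamily v u M (Sum.inr ()))[j.1] = u[j] := by
      simp [fullFamily]
    simp only [ne_eq, hx, not_false_eq_true, and_true]
    change (if (fullFamily v u M (Sum.inr ()))[j.1].2 = s then _ else _) =
      (if u[j].2 = s then _ else _)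
    rw [hdata]
    by_cases hs : u[j].2 = s
    · rw [if_pos hs, if_pos hs]
      have hs' : (fullFamily v u M (Sum.inr ()))[j.1].2 = s := by rw [hdata]; exact hs
      have hsp : o (Sum.inr ()) = ((o (Sum.inr ())).take u.length).take j ++
          ⟨Sum.inr (), ⟨j, hj⟩⟩ :: ((o (Sum.inr ())).take u.length).drop (j + 1) ++
            [lastPoint v u M] := by
        have hjlt : j.1 < ((o (Sum.inr ())).take u.length).length := by
          rw [List.length_take, hlen]; simp [fullFamily]
        have h3 : ((o (Sum.inr ())).take u.length)[j.1] =
            (⟨Sum.inr (), ⟨j, hj⟩⟩ : Points (fullFamily v u M)) := by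
          rw [List.getElem_take]; exact hget (Sum.inr ()) ⟨j, hj⟩
        rw [← h3, List.getElem_cons_drop, List.take_append_drop]
        exact hlast
      rw [cutCount_cut_word hrep hne' (fun k => hmap (Sum.inl k)) hsp (hε _) (hεx _ hs')
        (hεd _ hs'), List.map_take, List.map_drop, hu]
      have hM : (fullFamily v u M (lastPoint v u M).1)[(lastPoint v u M).2].1 = M := by
        simp [fullFamily, lastPoint]
      have hM' : (fullFamily v u M (Sum.inr ()))[(⟨j.1, hj⟩ : Fin _)].1 = u[j].1 := by
        rw [← hdata]; rfl
      simp only [hM, hM']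
      rfl
    · rw [if_neg hs, if_neg hs]

/-- Without black vertices the last letter is matched with a letter of sign −1, and both become
inert. -/
theorem wordCount_zero_eq (hne : ∀ k, v k ≠ []) (g : ℕ) :
    wordCount 0 (2 - 2 * g) (fullFamily v u M) =
      joinCount 0 (2 - 2 * g) v u M (-1) 0 + selfCount 0 g v u M (-1) 0 := by
  have hd : (fullFamily v u M (lastPoint v u M).1)[(lastPoint v u M).2].2 = 1 := by
    simp [fullFamily, lastPoint]
  rw [← sum_cutCount v u M hne 0 g (-1) 0 (fun x => killPair
    (fun z => (fullFamily v u M z.1)[z.2].2) x (lastPoint v u M)), wordCount, mapCount_zero_eq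
      (ε := fun z : Points (fullFamily v u M) => (fullFamily v u M z.1)[z.2].2)
      (d := lastPoint v u M) hd,
    minusSet, Finset.sum_filter]
  · refine Finset.sum_congr rfl fun x _ => ?_
    refine if_congr ?_ rfl rfl
    rw [iff_self_and]
    rintro hx rfl
    rw [hd] at hx
    exact absurd hx (by decide)
  · intro x z h1 h2; simp [killPair, h1, h2]
  · intro x _; simp [killPair]
  · intro x _; simp [killPair]

/-- The additional terms come from the removal of the last black vertex. It leaves two letters of
sign 1 and `r` black vertices; this shift of the index is the origin of the minus sign in the
recursion. -/
theorem wordCount_succ_eq (hne : ∀ k, v k ≠ []) (r g : ℕ) :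
    wordCount (r + 1) (2 - 2 * g) (fullFamily v u M) =
      joinCount (r + 1) (2 - 2 * g) v u M (-1) 0 + selfCount (r + 1) g v u M (-1) 0 +
      (joinCount r (2 - 2 * g) v u M 1 1 + selfCount r g v u M 1 1) := by
  have hd : (fullFamily v u M (lastPoint v u M).1)[(lastPoint v u M).2].2 = 1 := by
    simp [fullFamily, lastPoint]
  rw [← sum_cutCount v u M hne (r + 1) g (-1) 0 (fun x => killPair
    (fun z => (fullFamily v u M z.1)[z.2].2) x (lastPoint v u M)),
    ← sum_cutCount v u M hne r g 1 1 (fun _ z => (fullFamily v u M z.1)[z.2].2), wordCount,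
    mapCount_succ_eq
      (ε := fun z : Points (fullFamily v u M) => (fullFamily v u M z.1)[z.2].2)
      (d := lastPoint v u M) hd, minusSet, Finset.sum_filter]
  · congr 1
    · refine Finset.sum_congr rfl fun x _ => ?_
      refine if_congr ?_ rfl rfl
      rw [iff_self_and]
      rintro hx rfl
      rw [hd] at hx
      exact absurd hx (by decide)
    · rw [← Finset.sum_filter]
      refine Finset.sum_congr ?_ fun x _ => rfl
      ext x
      rw [Finset.mem_erase, mem_plusSet, Finset.mem_filter, and_comm]
      simp
  · intro x z _ _; rfl
  · intro x hx; exact hx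
  · intro x _; exact hd
  · intro x z h1 h2; simp [killPair, h1, h2]
  · intro x _; simp [killPair]
  · intro x _; simp [killPair]

end Recursion

end

noncomputable section

/-! ## The signed sum over the number of black vertices -/

section SignedSum

variable {κ : Type*} [Fintype κ] [DecidableEq κ] {n N : ℕ}

/-- The sum over all connected maps of genus `g`, each weighted by the sign `(-1)^r` given by its
number `r` of black vertices. -/
def wordSum (g : ℤ) (V : κ → List (SignedMatrix N)) : ℂ :=
  ∑' r : ℕ, (-1) ^ r * wordCount r (2 - 2 * g) V

/-- The Euler characteristic bounds the number of black vertices, so all series over `r` are finite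
sums. -/
theorem hasFiniteSupport_wordCount (χ : ℤ) (V : κ → List (SignedMatrix N)) :
    (Function.support fun r : ℕ => (-1 : ℂ) ^ r * wordCount r χ V).Finite := by
  refine (Set.finite_Iic (2 * (Fintype.card (Points V) : ℤ) - χ).toNat).subset fun r hr => ?_
  rw [Function.mem_support] at hr
  by_contra h
  rw [Set.mem_Iic, not_le, Int.toNat_lt'] at h
  · apply hr
    rw [wordCount, mapCount_eq_zero_of_lt, mul_zero]
    omega
  · omega

theorem summable_wordCount (χ : ℤ) (V : κ → List (SignedMatrix N)) :
    Summable fun r : ℕ => (-1 : ℂ) ^ r * wordCount r χ V :=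
  summable_of_hasFiniteSupport (hasFiniteSupport_wordCount χ V)

theorem hasSum_wordCount (g : ℤ) (V : κ → List (SignedMatrix N)) :
    HasSum (fun r : ℕ => (-1 : ℂ) ^ r * wordCount r (2 - 2 * g) V) (wordSum g V) :=
  (summable_wordCount _ V).hasSum

theorem wordSum_congr {V V' : κ → List (SignedMatrix N)} (h : ∀ k, CycEquiv (V k) (V' k)) (g : ℤ) :
    wordSum g V = wordSum g V' := by
  simp only [wordSum, wordCount_congr h]

theorem wordSum_reindex {κ' : Type*} [Fintype κ'] [DecidableEq κ'] (σ : κ' ≃ κ)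
    (V : κ → List (SignedMatrix N)) (g : ℤ) : wordSum g (fun k => V (σ k)) = wordSum g V := by
  simp only [wordSum, wordCount_reindex]

theorem wordSum_of_neg {g : ℤ} (hg : g < 0) {V : κ → List (SignedMatrix N)} {k : κ}
    (hk : V k ≠ []) : wordSum g V = 0 := by
  have : Nonempty (Points V) := ⟨⟨k, ⟨0, List.length_pos_of_ne_nil hk⟩⟩⟩
  simp only [wordSum, wordCount]
  simp [mapCount_top_eq_zero _ (show 2 < 2 - 2 * g by omega)]

/-- A Cauchy product: the sign (−1)^r is multiplicative when black vertices are shared between two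
components. -/
theorem hasSum_mul_antidiagonal (χ χ' : ℤ) {κ' : Type*} [Fintype κ'] [DecidableEq κ']
    (V : κ → List (SignedMatrix N)) (V' : κ' → List (SignedMatrix N)) {a b : ℂ}
    (ha : HasSum (fun r : ℕ => (-1 : ℂ) ^ r * wordCount r χ V) a)
    (hb : HasSum (fun r : ℕ => (-1 : ℂ) ^ r * wordCount r χ' V') b) :
    HasSum (fun r : ℕ => (-1 : ℂ) ^ r * ∑ s ∈ Finset.HasAntidiagonal.antidiagonal r,
      wordCount s.1 χ V * wordCount s.2 χ' V') (a * b) := by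
  have h := tsum_mul_tsum_eq_tsum_sum_antidiagonal_of_summable_norm ha.summable.norm
    hb.summable.norm
  have hs := (summable_norm_sum_mul_antidiagonal_of_summable_norm ha.summable.norm
    hb.summable.norm).of_norm
  rw [ha.tsum_eq, hb.tsum_eq] at h
  rw [h]
  refine hs.hasSum.congr_fun ?_
  intro r
  rw [Finset.mul_sum]
  refine Finset.sum_congr rfl fun s hs => ?_
  rw [← Finset.HasAntidiagonal.mem_antidiagonal.1 hs, pow_add]
  ring

theorem hasSum_posSum (l : List (SignedMatrix N)) (s : SignType)
    {F : ℕ → List (SignedMatrix N) → Matrix (Fin N) (Fin N) ℂ → List (SignedMatrix N) → ℂ}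
    {G : List (SignedMatrix N) → Matrix (Fin N) (Fin N) ℂ → List (SignedMatrix N) → ℂ}
    (h : ∀ xs M ys, HasSum (fun r : ℕ => (-1 : ℂ) ^ r * F r xs M ys) (G xs M ys)) :
    HasSum (fun r : ℕ => (-1 : ℂ) ^ r * posSum l s (F r)) (posSum l s G) := by
  simp only [posSum, Finset.mul_sum]
  refine hasSum_sum fun j _ => ?_
  split_ifs
  · exact h _ _ _
  · simp [hasSum_zero]

/-- The terms in which the last letter interacts with another word. -/
def joinSum (g : ℤ) (v : Fin n → List (SignedMatrix N)) (u : List (SignedMatrix N))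
    (M : Matrix (Fin N) (Fin N) ℂ) (s s' : SignType) : ℂ :=
  ∑ k, posSum (v k) s fun xs M' ys =>
    wordSum g (Sum.elim (fun k' : {k' : Fin n // k' ≠ k} => v k')
      fun _ : Unit => ys ++ xs ++ (M', s') :: u ++ [(M, s')])

/-- The terms in which the last letter interacts with its own word. -/
def selfSum (g : ℕ) (v : Fin n → List (SignedMatrix N)) (u : List (SignedMatrix N))
    (M : Matrix (Fin N) (Fin N) ℂ) (s s' : SignType) : ℂ :=
  posSum u s fun xs M' ys =>
    wordSum (g - 1)
      (Sum.elim v fun b : Bool => if b then xs ++ [(M', s')] else ys ++ [(M, s')]) +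
    ∑ q ∈ Finset.HasAntidiagonal.antidiagonal g, ∑ K : Finset (Fin n),
      wordSum q.1 (Sum.elim (fun j : {j // j ∈ K} => v j) fun _ : Unit => xs ++ [(M', s')]) *
      wordSum q.2 (Sum.elim (fun j : {j // j ∉ K} => v j) fun _ : Unit => ys ++ [(M, s')])

variable (v : Fin n → List (SignedMatrix N)) (u : List (SignedMatrix N))
  (M : Matrix (Fin N) (Fin N) ℂ)

theorem hasSum_joinCount (g : ℤ) (s s' : SignType) :
    HasSum (fun r : ℕ => (-1 : ℂ) ^ r * joinCount r (2 - 2 * g) v u M s s')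
      (joinSum g v u M s s') := by
  simp only [joinCount, Finset.mul_sum]
  exact hasSum_sum fun k _ => hasSum_posSum _ _ fun _ _ _ => hasSum_wordCount _ _

theorem hasSum_selfCount (g : ℕ) (s s' : SignType) :
    HasSum (fun r : ℕ => (-1 : ℂ) ^ r * selfCount r g v u M s s') (selfSum g v u M s s') := by
  refine hasSum_posSum _ _ fun xs M' ys => ?_
  simp only [mul_add]
  refine (hasSum_wordCount _ _).add ?_
  simp only [splitCount]
  have h : ∀ r : ℕ, ∀ f : ℕ × ℕ → Finset (Fin n) → ℂ, (-1 : ℂ) ^ r *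
      ∑ q ∈ Finset.HasAntidiagonal.antidiagonal g, ∑ K, f q K =
      ∑ q ∈ Finset.HasAntidiagonal.antidiagonal g, ∑ K, (-1 : ℂ) ^ r * f q K := by
    intro r f
    simp only [Finset.mul_sum]
  simp only [h]
  exact hasSum_sum fun q _ => hasSum_sum fun K _ =>
    hasSum_mul_antidiagonal _ _ _ _ (hasSum_wordCount _ _) (hasSum_wordCount _ _)

/-- The series `K` enters with its index shifted by one, hence with the opposite sign. -/
theorem hasSum_shift {F J K : ℕ → ℂ} {j k : ℂ} (hJ : HasSum (fun r : ℕ => (-1 : ℂ) ^ r * J r) j)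
    (hK : HasSum (fun r : ℕ => (-1 : ℂ) ^ r * K r) k) (h0 : F 0 = J 0)
    (hs : ∀ r, F (r + 1) = J (r + 1) + K r) :
    HasSum (fun r : ℕ => (-1 : ℂ) ^ r * F r) (j - k) := by
  rw [← hasSum_nat_add_iff' 1]
  have hJ' := (hasSum_nat_add_iff' 1).2 hJ
  have h := hJ'.sub hK
  simp only [Finset.range_one, Finset.sum_singleton, pow_zero, one_mul] at h ⊢
  rw [h0, sub_right_comm]
  refine h.congr_fun fun r => ?_
  rw [hs]
  ring

/-- The recursion for families of cyclic words. -/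
theorem wordSum_fullFamily (hne : ∀ k, v k ≠ []) (g : ℕ) :
    wordSum g (fullFamily v u M) =
      (joinSum g v u M (-1) 0 + selfSum g v u M (-1) 0) -
        (joinSum g v u M 1 1 + selfSum g v u M 1 1) := by
  refine (hasSum_wordCount _ _).unique (hasSum_shift
    (J := fun r => joinCount r (2 - 2 * g) v u M (-1) 0 + selfCount r g v u M (-1) 0)
    (K := fun r => joinCount r (2 - 2 * g) v u M 1 1 + selfCount r g v u M 1 1) ?_ ?_
    (wordCount_zero_eq v u M hne g) (fun r => wordCount_succ_eq v u M hne r g))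
  · simp only [mul_add]
    exact (hasSum_joinCount v u M g _ _).add (hasSum_selfCount v u M g _ _)
  · simp only [mul_add]
    exact (hasSum_joinCount v u M g _ _).add (hasSum_selfCount v u M g _ _)

/-! ### Words without letters `u` -/

theorem ntrPerm_unit (f : Equiv.Perm Unit) (B : Unit → Matrix (Fin N) (Fin N) ℂ) :
    ntrPerm f B = ntr (B ()) := by
  rw [ntrPerm]
  have : Subsingleton (Quotient (Equiv.Perm.SameCycle.setoid f)) :=
    ⟨fun a b => by
      induction a using Quotient.inductionOn
      induction b using Quotient.inductionOn
      rfl⟩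
  rw [finprod_eq_single _ (Quotient.mk _ ()) fun x hx => absurd (Subsingleton.elim _ _) hx]
  have : Function.minimalPeriod f (Quotient.out (Quotient.mk (Equiv.Perm.SameCycle.setoid f) ())) = 1 :=
    Function.minimalPeriod_eq_one_iff_isFixedPt.2 rfl
  rw [this]
  simp

/-- One vertex, no edge and one face: a sphere. This agrees with the convention for a single
monomial of degree 0. -/
theorem wordCount_isolated (r : ℕ) (χ : ℤ) :
    wordCount r χ (fun _ : Unit => [(M, 0)]) = if r = 0 ∧ χ = 2 then ntr M else 0 := by
  classical
  have hrep : IsRep (1 : Equiv.Perm Unit) (fun _ : Unit => [()]) :=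
    ⟨fun _ => rfl, fun _ => by simp, fun _ _ _ _ _ => rfl, fun _ => ⟨(), by simp⟩⟩
  rw [wordCount_eq hrep (B := fun _ => M) (ε := fun _ => 0)
    (V := fun _ : Unit => [(M, 0)]) fun _ => rfl, mapCount]
  have h1 : matchings (fun _ : Unit => (0 : SignType)) = {1} := by
    ext T
    rw [mem_matchings, Finset.mem_singleton]
    have : T = 1 := Subsingleton.elim _ _
    simp [this]
  have h2 : plusSet (fun _ : Unit => (0 : SignType)) = ∅ := by
    ext x; simp
  rw [h1, Finset.sum_singleton, h2, Finset.toList_empty]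
  cases r with
  | succ r => rw [monoSum_nil]; simp
  | zero =>
    rw [monoSum_zero, faceTrace, ntrPerm_unit]
    have h3 : orb (1 : Equiv.Perm Unit) ⊔ orb (1 : Equiv.Perm Unit) ⊔ (1 : PartPerm Unit).part = ⊤ := by
      refine le_antisymm le_top fun x y _ => ?_
      cases x; cases y; exact Setoid.refl' _ _
    have h4 : ∀ f : Equiv.Perm Unit, numCycles f = 1 := by
      intro f
      obtain rfl : f = 1 := Subsingleton.elim _ _
      simpa using hrep.numCycles_eq (by simp)
    rw [h3, eulerChar, h4, h4, h2]
    simp [eq_comm]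

theorem wordSum_isolated (g : ℤ) :
    wordSum g (fun _ : Unit => [(M, 0)]) = if g = 0 then ntr M else 0 := by
  rw [wordSum, tsum_eq_single 0]
  · rw [wordCount_isolated]
    simp
  · intro r hr
    rw [wordCount_isolated]
    simp [hr]

/-- A vertex without letters `u` is a connected component. -/
theorem wordSum_of_isolated {V : κ → List (SignedMatrix N)} {k₀ k₁ : κ} (hk : k₁ ≠ k₀)
    (hV : V k₀ = [(M, 0)]) (hV' : V k₁ ≠ []) (g : ℤ) : wordSum g V = 0 := by
  classical
  suffices h : ∀ r χ, wordCount r χ V = 0 by simp [wordSum, h]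
  intro r χ
  have hrep := isRep_rotatePoints V
  let x₀ : Points V := ⟨k₀, ⟨0, by simp [hV]⟩⟩
  let x₁ : Points V := ⟨k₁, ⟨0, List.length_pos_of_ne_nil hV'⟩⟩
  have hε : (V x₀.1)[x₀.2].2 = 0 := by simp [x₀, hV]
  have hγ : ∀ x, rotatePoints V x = x₀ → x = x₀ := by
    rintro ⟨k, j⟩ h
    obtain rfl : k = k₀ := congrArg Sigma.fst h
    have : (V k).length = 1 := by simp [hV]
    have hj : j = ⟨0, by omega⟩ := Fin.ext (by have := j.2; simp; omega)
    rw [hj]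
  -- The rotation, the matching and the transpositions all fix `x₀`, so the partition they generate
  -- keeps it alone in its class.
  have hle : ∀ f : Equiv.Perm (Points V), f x₀ = x₀ → orb f ≤ onlyClass {x₀}ᶜ := by
    intro f hf
    refine orb_le_iff.2 fun x => ?_
    by_cases hx : x = x₀
    · left; rw [hx, hf]
    · right
      exact ⟨hx, fun h => hx (f.injective (by rw [hf]; exact h))⟩
  have hγ0 : rotatePoints V x₀ = x₀ := by
    obtain ⟨y, hy⟩ := (rotatePoints V).surjective x₀
    have := hγ y hy
    rwa [this] at hy
  rw [wordCount, mapCount]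
  refine Finset.sum_eq_zero fun T hT => ?_
  rw [monoSum_congr (Finset.nodup_toList _) (G := fun _ => 0), monoSum_zero_fun]
  intro a ha
  rw [if_neg]
  rintro ⟨h, -⟩
  have h1 : orb (rotatePoints V) ⊔ orb T ⊔ a.part ≤ onlyClass {x₀}ᶜ := by
    refine sup_le (sup_le (hle _ hγ0) (hle _ ((mem_matchings.1 hT).2.2 _ hε))) ?_
    refine ha.2.trans fun x y hxy => ?_
    rcases hxy with h | ⟨h, h'⟩
    · exact Or.inl h
    · refine Or.inr ⟨?_, ?_⟩
      · rintro rfl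
        simp only [Set.mem_ofPred_eq, Finset.mem_toList, mem_plusSet] at h
        rw [hε] at h
        exact absurd h (by decide)
      · rintro rfl
        simp only [Set.mem_ofPred_eq, Finset.mem_toList, mem_plusSet] at h'
        rw [hε] at h'
        exact absurd h' (by decide)
  rw [h] at h1
  rcases h1 (show (⊤ : Setoid (Points V)) x₀ x₁ from trivial) with h2 | h2
  · exact hk (congrArg Sigma.fst h2).symm
  · exact h2.1 rfl

end SignedSum

end

noncomputable section

/-! ## Monomials as cyclic words -/

/-- An inert identity matrix can be absorbed by the next letter in cyclic order, provided that there
is another letter. -/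
theorem CycEquiv.insert_one {N : ℕ} {xs ys : List (SignedMatrix N)} (h : xs ++ ys ≠ []) :
    CycEquiv (xs ++ (1, 0) :: ys) (xs ++ ys) := by
  refine (CycEquiv.append_comm _ _).trans (CycEquiv.trans ?_ (CycEquiv.append_comm ys xs))
  obtain ⟨⟨M, s⟩, l, hl⟩ := List.exists_cons_of_ne_nil (l := ys ++ xs) fun h' => h (by
    rw [List.append_eq_nil_iff] at h' ⊢; exact h'.symm)
  rw [List.cons_append, hl]
  simpa using CycEquiv.merge 1 M s l

namespace Word

variable {p N : ℕ} (A : Fin p → Matrix (Fin N) (Fin N) ℂ)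

/-- The exponent of a letter. -/
def letterSign : Letter p → SignType
  | Letter.u => 1
  | Letter.us => -1
  | Letter.a _ => 0
  | Letter.as _ => 0

/-- The letters of a word, with their exponents. -/
def letters (w : Word p) : List (SignedMatrix N) := w.map fun x => (evalLetter A x, letterSign x)

theorem letters_append (w w' : Word p) : letters A (w ++ w') = letters A w ++ letters A w' :=
  List.map_append

/-- The cyclic word of a monomial. -/
def cyclic (w : Word p) : List (SignedMatrix N) := letters A w ++ [(1, 0)]

/-- The inert last letter ensures that every monomial, even the empty one, has a point and counts as
a vertex. -/
theorem cyclic_ne_nil (w : Word p) : cyclic A w ≠ [] := by simp [cyclic]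

theorem letters_cycEquiv {w : Word p} (h : w ≠ []) : CycEquiv (letters A w) (cyclic A w) := by
  have := CycEquiv.insert_one (N := N) (xs := letters A w) (ys := []) (by simp [letters, h])
  rw [List.append_nil] at this
  exact this.symm

/-- The exponent `±1` as a sign. -/
def unitSign (e : ℤˣ) : SignType := SignType.sign (e : ℤ)

@[simp] theorem unitSign_one : unitSign 1 = 1 := by decide
@[simp] theorem unitSign_neg_one : unitSign (-1) = -1 := by decide

/-- The value of a factor `M u^ε`. -/
def evalBlock (b : Word p × ℤˣ) : SignedMatrix N := (b.1.eval A, unitSign b.2)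

theorem eval_append (w w' : Word p) : (w ++ w').eval A = w.eval A * w'.eval A := by
  simp [eval]

/-- The accumulator `M` of `parse` corresponds to an inert letter: reading a letter of sign 0
enlarges it, reading u or u* merges it into a factor and restarts from an identity matrix. -/
theorem parse_cycEquiv (xs suf : List (SignedMatrix N)) (M w : Word p) :
    CycEquiv (xs ++ (M.eval A, 0) :: (letters A w ++ suf))
      (xs ++ ((parse M w).1.map (evalBlock A) ++ ((parse M w).2.eval A, 0) :: suf)) := by
  have key : ∀ (M w : Word p) (xs : List (SignedMatrix N)) (e : ℤˣ),
      (∀ xs : List (SignedMatrix N), CycEquiv (xs ++ (eval A [], 0) :: (letters A w ++ suf))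
        (xs ++ ((parse [] w).1.map (evalBlock A) ++ ((parse [] w).2.eval A, 0) :: suf))) →
      CycEquiv (xs ++ (M.eval A, 0) :: (1, unitSign e) :: (letters A w ++ suf))
      (xs ++ (((M, e) :: (parse [] w).1).map (evalBlock A) ++
        ((parse [] w).2.eval A, 0) :: suf)) := by
    intro M w xs e ih
    refine (CycEquiv.merge_mid _ _ _ _ _).trans ?_
    have h1 := (CycEquiv.insert_one (xs := xs ++ [(M.eval A, unitSign e)])
      (ys := letters A w ++ suf) (by simp)).symm
    have h2 := ih (xs ++ [(M.eval A, unitSign e)])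
    have h3 : eval A ([] : Word p) = 1 := by simp [eval]
    rw [h3] at h2
    simpa [evalBlock] using h1.trans h2
  induction w generalizing M xs with
  | nil => exact CycEquiv.refl _
  | cons x w ih =>
    cases x with
    | u => simpa [letters, parse, letterSign, evalLetter] using key M w xs 1 fun xs => ih xs []
    | us => simpa [letters, parse, letterSign, evalLetter] using key M w xs (-1) fun xs => ih xs []
    | a i =>
      refine CycEquiv.trans ?_ (ih xs (M ++ [Letter.a i]))
      rw [eval_append]
      simpa [letters, eval, letterSign] using
        CycEquiv.merge_mid xs (M.eval A) (evalLetter A (Letter.a i)) 0 (letters A w ++ suf)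
    | as i =>
      refine CycEquiv.trans ?_ (ih xs (M ++ [Letter.as i]))
      rw [eval_append]
      simpa [letters, eval, letterSign] using
        CycEquiv.merge_mid xs (M.eval A) (evalLetter A (Letter.as i)) 0 (letters A w ++ suf)

theorem parse_append (T M w : Word p) {M₁ : Word p} {e : ℤˣ} {l : List (Word p × ℤˣ)}
    (h : (parse M w).1 = (M₁, e) :: l) : (parse (T ++ M) w).1 = (T ++ M₁, e) :: l := by
  induction w generalizing M with
  | nil => simp [parse] at h
  | cons x w ih =>
    cases x with
    | u => simp only [parse, List.cons.injEq, Prod.mk.injEq] at h ⊢; simp [h]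
    | us => simp only [parse, List.cons.injEq, Prod.mk.injEq] at h ⊢; simp [h]
    | a i => simp only [parse] at h ⊢; rw [List.append_assoc]; exact ih _ h
    | as i => simp only [parse] at h ⊢; rw [List.append_assoc]; exact ih _ h

theorem parse_of_degree_zero (M w : Word p) (h : w.degree = 0) : parse M w = ([], M ++ w) := by
  induction w generalizing M with
  | nil => simp [parse]
  | cons x w ih =>
    cases x with
    | u => simp [degree] at h
    | us => simp [degree] at h
    | a i => rw [parse, ih _ (by simpa [degree] using h)]; simp
    | as i => rw [parse, ih _ (by simpa [degree] using h)]; simp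

theorem cyclic_cycEquiv_parse (w : Word p) : CycEquiv (cyclic A w)
    ((parse [] w).1.map (evalBlock A) ++ [((parse [] w).2.eval A, 0)]) := by
  have := parse_cycEquiv A [] [] [] w
  refine CycEquiv.trans (CycEquiv.append_comm _ _) ?_
  simpa [eval] using this

/-- The letters after the last u or u* form an inert point. In cyclic order it precedes the first
factor and merges with it, in agreement with the definition of `blocks`. -/
theorem cyclic_cycEquiv_blocks {w : Word p} (h : 0 < w.degree) :
    CycEquiv (cyclic A w) (w.blocks.map (evalBlock A)) := by
  obtain ⟨⟨M₁, e⟩, l, hl⟩ := List.exists_cons_of_ne_nil (l := (parse [] w).1) (by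
    rw [← List.length_pos_iff, length_parse]; exact h)
  have hb : w.blocks = ((parse [] w).2 ++ M₁, e) :: l := by
    have := parse_append (parse [] w).2 [] w hl
    rwa [List.append_nil] at this
  refine (cyclic_cycEquiv_parse A w).trans ((CycEquiv.append_comm _ _).trans ?_)
  rw [hl, hb]
  simpa [evalBlock, eval_append] using CycEquiv.merge ((parse [] w).2.eval A) (M₁.eval A)
    (unitSign e) (l.map (evalBlock A))

theorem cyclic_cycEquiv_of_degree_zero {w : Word p} (h : w.degree = 0) :
    CycEquiv (cyclic A w) [(w.eval A, 0)] := by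
  simpa [parse_of_degree_zero [] w h] using cyclic_cycEquiv_parse A w

theorem sum_splits (x : Letter p) (w : Word p) (G : Word p × Word p → ℂ) :
    ∑ q ∈ splits x w, G q =
      ∑ j : Fin w.length, if w[j] = x then G (w.take j, w.drop (j + 1)) else 0 := by
  classical
  have h : splits x w = (Finset.univ.filter fun j : Fin w.length => w[j] = x).image
      fun j : Fin w.length => (w.take j.1, w.drop (j.1 + 1)) := by
    ext q
    rw [mem_splits]
    simp only [Finset.mem_image, Finset.mem_filter, Finset.mem_univ, true_and]
    constructor
    · intro h
      refine ⟨⟨q.1.length, ?_⟩, ?_, ?_⟩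
      · rw [h]; simp
      · simp [h]
      · simp only [h, List.take_left, List.drop_append, List.drop_eq_nil_of_le (Nat.le_succ _)]
        simp
    · rintro ⟨j, hj, rfl⟩
      rw [← hj]
      simp
  rw [h, Finset.sum_image, Finset.sum_filter]
  intro i _ j _ hij
  have := congrArg (fun q : Word p × Word p => q.1.length) hij
  simp only [List.length_take] at this
  exact Fin.ext (by omega)

/-- Positions of given sign are occurrences of one letter, and each occurrence yields a different
splitting since the prefix lengths differ. -/
theorem posSum_letters (w : Word p) (x : Letter p) (s : SignType)
    (hx : ∀ y : Letter p, letterSign y = s ↔ y = x)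
    (F : List (SignedMatrix N) → Matrix (Fin N) (Fin N) ℂ → List (SignedMatrix N) → ℂ) :
    posSum (letters A w) s F =
      ∑ q ∈ splits x w, F (letters A q.1) (evalLetter A x) (letters A q.2) := by
  rw [sum_splits, posSum,
    ← Equiv.sum_comp (finCongr (by simp [letters] : w.length = (letters A w).length))]
  refine Finset.sum_congr rfl fun j _ => ?_
  have h : (letters A w)[(finCongr (by simp [letters] : w.length = (letters A w).length)) j] =
      (evalLetter A w[j], letterSign w[j]) := List.getElem_map _
  rw [h]
  refine if_ctx_congr (hx _) (fun hj => ?_) fun _ => rfl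
  rw [← hj]
  simp only [letters, List.map_take, List.map_drop]
  rfl

theorem letterSign_eq_one (y : Letter p) : letterSign y = 1 ↔ y = Letter.u := by
  cases y <;> simp [letterSign]

theorem letterSign_eq_neg_one (y : Letter p) : letterSign y = -1 ↔ y = Letter.us := by
  cases y <;> simp [letterSign]

end Word

theorem posSum_append_singleton {N : ℕ} (l : List (SignedMatrix N)) (a : SignedMatrix N)
    {s : SignType} (hs : a.2 ≠ s)
    (F : List (SignedMatrix N) → Matrix (Fin N) (Fin N) ℂ → List (SignedMatrix N) → ℂ) :
    posSum (l ++ [a]) s F = posSum l s fun xs M ys => F xs M (ys ++ [a]) := by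
  rw [posSum, sum_fin_append_singleton, if_neg (by simpa using hs), add_zero]
  refine Finset.sum_congr rfl fun j _ => ?_
  have h : (l ++ [a])[(⟨j, by simp⟩ : Fin (l ++ [a]).length)] = l[j] := by simp
  rw [h]
  congr 1
  rw [List.take_append_of_le_length j.2.le, List.drop_append_of_le_length j.2]

/-! ## The recursion for families of monomials -/

section Monomials

variable {p N n : ℕ} (A : Fin p → Matrix (Fin N) (Fin N) ℂ)

/-- The signed sum over the maps whose white vertices are given by a family of monomials. -/
def monomialSum {κ : Type*} [Fintype κ] [DecidableEq κ] (g : ℤ) (W : κ → Word p) : ℂ :=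
  wordSum g fun k => (W k).cyclic A

theorem monomialSum_reindex {κ κ' : Type*} [Fintype κ] [DecidableEq κ] [Fintype κ']
    [DecidableEq κ'] (σ : κ' ≃ κ) (W : κ → Word p) (g : ℤ) :
    monomialSum A g (fun k => W (σ k)) = monomialSum A g W :=
  wordSum_reindex σ (fun k => (W k).cyclic A) g

/-- Here `m` writes the joined cyclic word as a monomial; its choice depends on whether the two
letters involved survive. -/
theorem joinSum_letters (g : ℤ) (P : Fin n → Word p) (Pl : Word p) {s s' : SignType} (hs : s ≠ 0)
    {x : Letter p} (hx : ∀ y : Letter p, Word.letterSign y = s ↔ y = x)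
    (hx1 : Word.evalLetter A x = 1) (m : Word p × Word p → Word p)
    (hm : ∀ q : Word p × Word p, CycEquiv
      (q.2.letters A ++ [(1, 0)] ++ q.1.letters A ++ (1, s') :: Pl.letters A ++ [(1, s')])
      ((m q).cyclic A)) :
    joinSum g (fun k => (P k).cyclic A) (Pl.letters A) 1 s s' =
      ∑ j, ∑ q ∈ (P j).splits x,
        monomialSum A g (Sum.elim (fun k : {k : Fin n // k ≠ j} => P k) fun _ : Unit => m q) := by
  refine Finset.sum_congr rfl fun j _ => ?_
  change posSum ((P j).letters A ++ [(1, 0)]) s _ = _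
  rw [posSum_append_singleton _ _ (by simpa using hs.symm), Word.posSum_letters A _ x s hx]
  refine Finset.sum_congr rfl fun q _ => ?_
  rw [hx1]
  refine wordSum_congr ?_ g
  rintro (k | k)
  · exact CycEquiv.refl _
  · exact hm q

theorem selfSum_letters (g : ℕ) (P : Fin n → Word p) (Pl : Word p) {s s' : SignType}
    {x : Letter p} (hx : ∀ y : Letter p, Word.letterSign y = s ↔ y = x)
    (hx1 : Word.evalLetter A x = 1) (m : Word p → Word p)
    (hm : ∀ w : Word p, CycEquiv (w.letters A ++ [(1, s')]) ((m w).cyclic A)) :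
    selfSum g (fun k => (P k).cyclic A) (Pl.letters A) 1 s s' =
      ∑ q ∈ Pl.splits x,
        (monomialSum A (g - 1) (Sum.elim P fun b : Bool => if b then m q.1 else m q.2) +
          ∑ h ∈ Finset.HasAntidiagonal.antidiagonal g, ∑ K : Finset (Fin n),
            monomialSum A h.1 (Sum.elim (fun j : {j // j ∈ K} => P j) fun _ : Unit => m q.1) *
            monomialSum A h.2 (Sum.elim (fun j : {j // j ∉ K} => P j) fun _ : Unit => m q.2)) := by
  rw [selfSum, Word.posSum_letters A _ x s hx]
  refine Finset.sum_congr rfl fun q _ => ?_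
  rw [hx1]
  refine congrArg₂ (· + ·) ?_ (Finset.sum_congr rfl fun h _ => Finset.sum_congr rfl fun K _ =>
    congrArg₂ (· * ·) ?_ ?_)
  · refine wordSum_congr ?_ _
    rintro (k | b)
    · exact CycEquiv.refl _
    · cases b
      · exact hm _
      · exact hm _
  · refine wordSum_congr ?_ _
    rintro (k | b)
    · exact CycEquiv.refl _
    · exact hm _
  · refine wordSum_congr ?_ _
    rintro (k | b)
    · exact CycEquiv.refl _
    · exact hm _

/-- In the u* terms the letters left by the surgery are inert identity matrices and disappear, while
in the u terms they are letters u ending the new words. The remaining inert letters of the joined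
words are absorbed by `CycEquiv.insert_one`. -/
theorem monomialSum_recursion (P : Fin n → Word p) (Pl : Word p) (g : ℕ) :
    monomialSum A g (Sum.elim P fun _ : Unit => Pl ++ [Letter.u]) =
      - (∑ q ∈ Pl.splits Letter.u,
        (monomialSum A (g - 1) (Sum.elim P fun b : Bool =>
            if b then q.1 ++ [Letter.u] else q.2 ++ [Letter.u]) +
          ∑ h ∈ Finset.HasAntidiagonal.antidiagonal g, ∑ K : Finset (Fin n),
            monomialSum A h.1 (Sum.elim (fun j : {j // j ∈ K} => P j)
              fun _ : Unit => q.1 ++ [Letter.u]) *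
            monomialSum A h.2 (Sum.elim (fun j : {j // j ∉ K} => P j)
              fun _ : Unit => q.2 ++ [Letter.u])))
      - (∑ j, ∑ q ∈ (P j).splits Letter.u,
          monomialSum A g (Sum.elim (fun k : {k : Fin n // k ≠ j} => P k)
            fun _ : Unit => q.2 ++ q.1 ++ [Letter.u] ++ Pl ++ [Letter.u]))
      + (∑ q ∈ Pl.splits Letter.us,
        (monomialSum A (g - 1) (Sum.elim P fun b : Bool => if b then q.1 else q.2) +
          ∑ h ∈ Finset.HasAntidiagonal.antidiagonal g, ∑ K : Finset (Fin n),
            monomialSum A h.1 (Sum.elim (fun j : {j // j ∈ K} => P j) fun _ : Unit => q.1) *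
            monomialSum A h.2 (Sum.elim (fun j : {j // j ∉ K} => P j) fun _ : Unit => q.2)))
      + (∑ j, ∑ q ∈ (P j).splits Letter.us,
          monomialSum A g (Sum.elim (fun k : {k : Fin n // k ≠ j} => P k)
            fun _ : Unit => q.2 ++ q.1 ++ Pl)) := by
  have hL : monomialSum A g (Sum.elim P fun _ : Unit => Pl ++ [Letter.u]) =
      wordSum g (fullFamily (fun k => (P k).cyclic A) (Pl.letters A) 1) := by
    refine wordSum_congr ?_ _
    rintro (k | k)
    · exact CycEquiv.refl _
    · have := Word.letters_cycEquiv A (w := Pl ++ [Letter.u]) (by simp)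
      rw [Word.letters_append] at this
      exact this.symm
  rw [hL, wordSum_fullFamily _ _ _ fun k => Word.cyclic_ne_nil A (P k),
    joinSum_letters A g P Pl (by decide) Word.letterSign_eq_one rfl
      (fun q => q.2 ++ q.1 ++ [Letter.u] ++ Pl ++ [Letter.u]),
    joinSum_letters A g P Pl (by decide) Word.letterSign_eq_neg_one rfl
      (fun q => q.2 ++ q.1 ++ Pl),
    selfSum_letters A g P Pl Word.letterSign_eq_one rfl (fun w => w ++ [Letter.u]),
    selfSum_letters A g P Pl Word.letterSign_eq_neg_one rfl (fun w => w)]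
  · ring
  · intro w
    exact CycEquiv.refl _
  · intro w
    have := Word.letters_cycEquiv A (w := w ++ [Letter.u]) (by simp)
    rw [Word.letters_append] at this
    exact this
  · intro q
    have h1 := CycEquiv.insert_one (xs := q.2.letters A)
      (ys := q.1.letters A ++ (1, 0) :: Pl.letters A ++ [(1, 0)]) (by simp)
    have h2 := CycEquiv.insert_one (xs := q.2.letters A ++ q.1.letters A)
      (ys := Pl.letters A ++ [(1, 0)]) (by simp)
    have h3 : q.2.letters A ++ q.1.letters A ++ (Pl.letters A ++ [(1, 0)]) =
        Word.cyclic A (q.2 ++ q.1 ++ Pl) := by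
      simp [Word.cyclic, Word.letters_append]
    rw [h3] at h2
    refine CycEquiv.trans ?_ h2
    simpa using h1
  · intro q
    have h1 := CycEquiv.insert_one (xs := q.2.letters A)
      (ys := q.1.letters A ++ (1, 1) :: Pl.letters A ++ [(1, 1)]) (by simp)
    have h2 := Word.letters_cycEquiv A (w := q.2 ++ q.1 ++ [Letter.u] ++ Pl ++ [Letter.u])
      (by simp)
    refine CycEquiv.trans ?_ h2
    simpa [Word.letters, Word.letterSign, Word.evalLetter] using h1

end Monomials

end

noncomputable section

/-! ## Lists and families of monomials -/

section Lists

variable {p N n : ℕ} (A : Fin p → Matrix (Fin N) (Fin N) ℂ)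

/-- The signed sum for a list of monomials. -/
def listSum (g : ℤ) (L : List (Word p)) : ℂ := monomialSum A g fun i : Fin L.length => L.get i

/-- The signed sum depends on the family only, so any enumeration of the index set gives the same
value. -/
theorem listSum_map {κ : Type*} [Fintype κ] [DecidableEq κ] (g : ℤ) {t : List κ} (ht : t.Nodup)
    (hmem : ∀ k, k ∈ t) (W : κ → Word p) : listSum A g (t.map W) = monomialSum A g W := by
  rw [← monomialSum_reindex A
    ((finCongr (List.length_map W)).trans (ht.getEquivOfForallMemList t hmem)) W g, listSum]
  congr 1
  ext1 i
  simp

theorem listSum_ofFn_append (g : ℤ) (P : Fin n → Word p) (w : Word p) :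
    listSum A g (List.ofFn P ++ [w]) = monomialSum A g (Sum.elim P fun _ : Unit => w) := by
  rw [← listSum_map A g (t := (List.finRange n).map Sum.inl ++ [Sum.inr ()])]
  · congr 1
    simp [List.ofFn_eq_map]
  · rw [List.nodup_append']
    refine ⟨(List.nodup_finRange n).map Sum.inl_injective, List.nodup_singleton _, ?_⟩
    intro x hx hx'
    simp only [List.mem_singleton] at hx'
    subst hx'
    simp at hx
  · rintro (k | k) <;> simp

theorem listSum_ofFn_append_pair (g : ℤ) (P : Fin n → Word p) (w w' : Word p) :
    listSum A g (List.ofFn P ++ [w, w']) =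
      monomialSum A g (Sum.elim P fun b : Bool => if b then w else w') := by
  rw [← listSum_map A g (t := (List.finRange n).map Sum.inl ++ [Sum.inr true, Sum.inr false])]
  · congr 1
    simp [List.ofFn_eq_map]
  · rw [List.nodup_append']
    refine ⟨(List.nodup_finRange n).map Sum.inl_injective, by simp, ?_⟩
    intro x hx hx'
    simp only [List.mem_cons, List.not_mem_nil, or_false] at hx'
    rcases hx' with rfl | rfl <;> simp at hx
  · rintro (k | k)
    · simp
    · cases k <;> simp

theorem listSum_restrict_append (g : ℤ) (P : Fin n → Word p) (w : Word p) (K : Finset (Fin n))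
    (q : Fin n → Prop) [Fintype {j // q j}] (hq : ∀ j, j ∈ K ↔ q j) :
    listSum A g (restrict P K ++ [w]) =
      monomialSum A g (Sum.elim (fun j : {j // q j} => P j) fun _ : Unit => w) := by
  have h : ∀ j ∈ (List.finRange n).filter fun i => i ∈ K, q j := fun j hj => by
    rw [List.mem_filter, decide_eq_true_iff, hq] at hj; exact hj.2
  rw [← listSum_map A g
    (t := (((List.finRange n).filter fun i => i ∈ K).attachWith q h).map Sum.inl ++ [Sum.inr ()])]
  · congr 1
    simp only [restrict, List.map_append, List.map_map, List.map_cons, List.map_nil, Sum.elim_inr]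
    congr 1
    exact (List.attachWith_map_val (f := P) h).symm
  · rw [List.nodup_append']
    refine ⟨List.Nodup.map Sum.inl_injective ?_, List.nodup_singleton _, ?_⟩
    · apply List.Nodup.of_map Subtype.val
      have e := List.attachWith_map_val (f := fun i => i) h
      rw [List.map_id'] at e
      rw [e]
      exact (List.nodup_finRange n).filter _
    · intro x hx hx'
      simp only [List.mem_singleton] at hx'
      subst hx'
      simp at hx
  · rintro (k | k)
    · simp [hq]
    · simp

theorem listSum_recursion (P : Fin n → Word p) (Pl : Word p) (g : ℕ) :
    listSum A g (List.ofFn P ++ [Pl ++ [Letter.u]]) =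
      - (∑ q ∈ Pl.splits Letter.u,
          (listSum A (g - 1) (List.ofFn P ++ [q.1 ++ [Letter.u], q.2 ++ [Letter.u]]) +
            ∑ h ∈ Finset.HasAntidiagonal.antidiagonal g, ∑ I : Finset (Fin n),
              listSum A h.1 (restrict P I ++ [q.1 ++ [Letter.u]]) *
                listSum A h.2 (restrict P Iᶜ ++ [q.2 ++ [Letter.u]])))
      - (∑ j : Fin n, ∑ q ∈ (P j).splits Letter.u,
          listSum A g (restrict P {j}ᶜ ++ [q.2 ++ q.1 ++ [Letter.u] ++ Pl ++ [Letter.u]]))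
      + (∑ q ∈ Pl.splits Letter.us,
          (listSum A (g - 1) (List.ofFn P ++ [q.1, q.2]) +
            ∑ h ∈ Finset.HasAntidiagonal.antidiagonal g, ∑ I : Finset (Fin n),
              listSum A h.1 (restrict P I ++ [q.1]) * listSum A h.2 (restrict P Iᶜ ++ [q.2])))
      + (∑ j : Fin n, ∑ q ∈ (P j).splits Letter.us,
          listSum A g (restrict P {j}ᶜ ++ [q.2 ++ q.1 ++ Pl])) := by
  have h1 : ∀ (g : ℤ) (w : Word p) (K : Finset (Fin n)), listSum A g (restrict P K ++ [w]) =
      monomialSum A g (Sum.elim (fun j : {j // j ∈ K} => P j) fun _ : Unit => w) :=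
    fun g w K => listSum_restrict_append A g P w K _ fun _ => Iff.rfl
  have h2 : ∀ (g : ℤ) (w : Word p) (K : Finset (Fin n)), listSum A g (restrict P Kᶜ ++ [w]) =
      monomialSum A g (Sum.elim (fun j : {j // j ∉ K} => P j) fun _ : Unit => w) :=
    fun g w K => listSum_restrict_append A g P w Kᶜ _ fun _ => by simp
  have h3 : ∀ (g : ℤ) (w : Word p) (k : Fin n), listSum A g (restrict P {k}ᶜ ++ [w]) =
      monomialSum A g (Sum.elim (fun j : {j // j ≠ k} => P j) fun _ : Unit => w) :=
    fun g w k => listSum_restrict_append A g P w {k}ᶜ _ fun _ => by simp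
  simp only [h3]
  simp only [h2]
  simp only [h1, listSum_ofFn_append_pair]
  rw [listSum_ofFn_append]
  exact monomialSum_recursion A P Pl g

end Lists

end

noncomputable section

/-! ## Labels of the half-edges of a map of unitary type -/

namespace UnitaryMap

variable {I : Type*} {r : ℕ} (C : UnitaryMap I r)

theorem label_spec (h : I ⊕ Fin r × ZMod 4) : ∃ n : ℕ, (C.φ⁻¹ ^ n) h = Sum.inl (C.label h) ∧
    ∀ m < n, ¬ ((C.φ⁻¹ ^ m) h).isLeft :=
  ⟨Nat.find (C.exists_white h), (Sum.inl_getLeft _ (Nat.find_spec (C.exists_white h))).symm,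
    fun _ hm => Nat.find_min (C.exists_white h) hm⟩

theorem label_eq_of_pow {h : I ⊕ Fin r × ZMod 4} {n : ℕ} {j : I}
    (hn : (C.φ⁻¹ ^ n) h = Sum.inl j) (hm : ∀ m < n, ¬ ((C.φ⁻¹ ^ m) h).isLeft) :
    C.label h = j := by
  obtain ⟨n', hn', hm'⟩ := C.label_spec h
  rcases lt_trichotomy n n' with hlt | rfl | hlt
  · exact absurd (by rw [hn]; rfl) (hm' n hlt)
  · rw [hn] at hn'; exact (Sum.inl_injective hn').symm
  · exact absurd (by rw [hn']; rfl) (hm n' hlt)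

theorem label_inl (i : I) : C.label (Sum.inl i) = i :=
  C.label_eq_of_pow (n := 0) rfl fun _ h => absurd h (Nat.not_lt_zero _)

theorem label_inr (x : Fin r × ZMod 4) :
    C.label (Sum.inr x) = C.label (C.α (C.σ (Sum.inr x))) := by
  rw [← C.φ_inv_apply]
  obtain ⟨n, hn, hm⟩ := C.label_spec (C.φ⁻¹ (Sum.inr x))
  refine C.label_eq_of_pow (n := n + 1) (by rw [pow_succ, Equiv.Perm.mul_apply, hn])
    fun m hlt => ?_
  cases m with
  | zero => simp
  | succ m => rw [pow_succ, Equiv.Perm.mul_apply]; exact hm m (by omega)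

/-- A face passes from the half-edge `c` of a black vertex to the edge at `c + 1`. For outgoing
half-edges this says that the label arriving at `c + 1` leaves through `c`. -/
theorem label_black (k : Fin r) (c : ZMod 4) :
    C.label (Sum.inr (k, c)) = C.label (C.α (Sum.inr (k, c + 1))) := by
  rw [label_inr, C.σ_black]

theorem ε_σ_black (k : Fin r) (c : ZMod 4) : C.ε (Sum.inr (k, c + 2)) = C.ε (Sum.inr (k, c)) := by
  have : c + 2 = c + 1 + 1 := by ring
  rw [this, C.alternated, C.alternated, neg_neg]

theorem zmod_four_ne (c : ZMod 4) : c ≠ c + 2 := by revert c; decide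

theorem zmod_four_add (c : ZMod 4) : c + 2 + 2 = c := by revert c; decide

theorem zmod_four_cases (c c' : ZMod 4) :
    c' = c ∨ c' = c + 2 ∨ c' = c + 1 ∨ c' = c + 1 + 2 := by revert c c'; decide

theorem units_neg_one_ne_one : (-1 : ℤˣ) ≠ 1 := by decide

/-- A half-edge has the orientation of the white half-edge that gives its label. -/
theorem ε_label (h : I ⊕ Fin r × ZMod 4) : C.ε (Sum.inl (C.label h)) = C.ε h := by
  obtain ⟨n, hn, hm⟩ := C.label_spec h
  have key : ∀ m ≤ n, C.ε ((C.φ⁻¹ ^ m) h) = C.ε h := by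
    intro m
    induction m with
    | zero => intro _; rfl
    | succ m ih =>
      intro hlt
      rw [← ih (by omega), pow_succ', Equiv.Perm.mul_apply]
      have := hm m (by omega)
      rcases hx : (C.φ⁻¹ ^ m) h with i | ⟨k, c⟩
      · rw [hx] at this; simp at this
      · rw [φ_inv_apply, C.σ_black, C.ε_α, C.alternated, neg_neg]
  rw [← hn, key n le_rfl]

theorem σ_inl (i : I) : ∃ j, C.σ (Sum.inl i) = Sum.inl j := by
  rcases h : C.σ (Sum.inl i) with j | ⟨k, c⟩
  · exact ⟨j, rfl⟩
  · have h1 := C.σ_black k (c - 1)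
    rw [sub_add_cancel, ← h] at h1
    exact absurd (C.σ.injective h1) (by simp)

theorem firstReturn_eq_of_apply {A : Type*} [Finite A] (f : Equiv.Perm A) (e : I ↪ A) {i j : I}
    (h : f (e i) = e j) : firstReturn f e i = j := by
  apply e.injective
  have h0 : returnTime f e i = 0 := by
    classical
    rw [returnTime, Nat.find_eq_zero]
    exact ⟨j, by simp [h]⟩
  rw [firstReturn_spec, h0]
  simpa using h

section Finite

variable [Finite I]

theorem σ_inl_eq (i : I) : C.σ (Sum.inl i) = Sum.inl (C.whiteρ i) := by
  obtain ⟨j, hj⟩ := C.σ_inl i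
  rw [hj]
  congr 1
  exact (firstReturn_eq_of_apply C.σ Function.Embedding.inl hj).symm

theorem label_φ_inv (i : I) : C.label (C.φ⁻¹ (Sum.inl i)) = C.whiteφ⁻¹ i := by
  have h1 := firstReturn_spec C.φ⁻¹ (Function.Embedding.inl : I ↪ I ⊕ Fin r × ZMod 4) i
  refine C.label_eq_of_pow (n := returnTime C.φ⁻¹ Function.Embedding.inl i) ?_ fun m hm => ?_
  · rw [pow_succ, Equiv.Perm.mul_apply] at h1
    exact h1.symm
  · classical
    have := Nat.find_min (exists_return C.φ⁻¹ Function.Embedding.inl i) hm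
    rw [pow_succ, Equiv.Perm.mul_apply] at this
    intro hl
    obtain ⟨j, hj⟩ := Sum.isLeft_iff.1 hl
    exact this ⟨j, hj.symm⟩

end Finite

/-- The label of the half-edge facing a white half-edge. -/
def facing (i : I) : I := C.label (C.α (Sum.inl i))

theorem whiteφ_inv_eq [Finite I] (i : I) : C.whiteφ⁻¹ i = C.facing (C.whiteρ i) := by
  rw [← label_φ_inv, φ_inv_apply, σ_inl_eq, facing]

/-! ### Strands -/

/-- The time at which a strand starts. -/
def startTime : I ⊕ Fin r × ZMod 4 → ℕ
  | Sum.inl _ => 0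
  | Sum.inr x => x.1 + 1

/-- The time at which a strand ends. -/
def endTime : I ⊕ Fin r × ZMod 4 → ℕ
  | Sum.inl _ => r
  | Sum.inr x => x.1

/-- The outgoing half-edge `h` starts before the black vertex `s` and its edge does not
end before it. -/
def Alive (s : ℕ) (h : I ⊕ Fin r × ZMod 4) : Prop :=
  C.ε h = 1 ∧ startTime h ≤ s ∧ s ≤ endTime (C.α h)

/-- Time `s` is the moment just before the black vertex `s`: edges ending there have end time `s`,
edges starting there have start time `s + 1`. An edge to a later black vertex is therefore alive
when it starts. -/
theorem alive_start {h : I ⊕ Fin r × ZMod 4} (hε : C.ε h = 1) : C.Alive (startTime h) h := by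
  refine ⟨hε, le_rfl, ?_⟩
  rcases h with i | ⟨k, c⟩
  · exact Nat.zero_le _
  · rcases hx : C.α (Sum.inr (k, c)) with j | ⟨k', c'⟩
    · exact k.2
    · exact Fin.lt_def.1 (C.increasing k c k' c' hε hx)

/-- The strand that arrives at an ingoing half-edge of a black vertex. -/
theorem alive_α {k : Fin r} {c : ZMod 4} (hε : C.ε (Sum.inr (k, c)) = -1) :
    C.Alive k (C.α (Sum.inr (k, c))) := by
  have h1 : C.ε (C.α (Sum.inr (k, c))) = 1 := by rw [C.ε_α, hε, neg_neg]
  refine ⟨h1, ?_, ?_⟩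
  · rcases hx : C.α (Sum.inr (k, c)) with j | ⟨k', c'⟩
    · exact Nat.zero_le _
    · rw [hx] at h1
      exact Fin.lt_def.1 (C.increasing k' c' k c h1 (by rw [← hx, C.α_α]))
  · rw [C.α_α]; exact le_rfl

theorem alive_inl_α {i : I} (hε : C.ε (Sum.inl i) = -1) : C.Alive r (C.α (Sum.inl i)) := by
  refine ⟨by rw [C.ε_α, hε, neg_neg], ?_, by rw [C.α_α]; exact le_rfl⟩
  rcases C.α (Sum.inl i) with j | ⟨k', c'⟩
  · exact Nat.zero_le _
  · exact k'.2

theorem ε_out_pred {k : Fin r} {c : ZMod 4} (hε : C.ε (Sum.inr (k, c)) = 1) :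
    C.ε (Sum.inr (k, c + 1)) = -1 := by rw [C.alternated, hε]

theorem startTime_eq {h : I ⊕ Fin r × ZMod 4} {s : ℕ} (hs : startTime h = s + 1) :
    ∃ (hlt : s < r) (c : ZMod 4), h = Sum.inr (⟨s, hlt⟩, c) := by
  rcases h with i | ⟨k, c⟩
  · exact absurd hs (by simp [startTime])
  · simp only [startTime, Nat.add_right_cancel_iff] at hs
    exact ⟨hs ▸ k.2, c, by simp [← hs]⟩

/-- At each time there is at most one strand with a given label. -/
theorem eq_of_alive {s : ℕ} {x y : I ⊕ Fin r × ZMod 4} (hx : C.Alive s x) (hy : C.Alive s y)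
    (hxy : C.label x = C.label y) : x = y := by
  induction s generalizing x y with
  | zero =>
    rcases x with i | x
    · rcases y with j | y
      · rw [label_inl, label_inl] at hxy; rw [hxy]
      · exact absurd hy.2.1 (by simp [startTime])
    · exact absurd hx.2.1 (by simp [startTime])
  | succ s ih =>
    have hold : ∀ {z}, C.Alive (s + 1) z → startTime z ≠ s + 1 → C.Alive s z := fun hz h =>
      ⟨hz.1, by have := hz.2.1; omega, by have := hz.2.2; omega⟩
    -- A new strand inherits its label from a strand ending at the vertex `s`. By induction that was
    -- the only strand with this label, so no older strand surviving the vertex can carry it.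
    have mixed : ∀ {x y : I ⊕ Fin r × ZMod 4}, C.Alive (s + 1) x → C.Alive (s + 1) y →
        C.label x = C.label y → startTime x = s + 1 → startTime y = s + 1 := by
      intro x y hx hy hxy h1
      by_contra h2
      obtain ⟨hlt, c, rfl⟩ := startTime_eq h1
      have h3 := C.alive_α (C.ε_out_pred hx.1)
      have h4 := ih h3 (hold hy h2) (by rw [← label_black]; exact hxy)
      have h5 := hy.2.2
      rw [← h4, C.α_α] at h5
      exact absurd h5 (by simp [endTime])
    by_cases h1 : startTime x = s + 1
    · obtain ⟨hlt, c, rfl⟩ := startTime_eq h1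
      obtain ⟨hlt, c', rfl⟩ := startTime_eq (mixed hx hy hxy h1)
      have := ih (C.alive_α (C.ε_out_pred hx.1)) (C.alive_α (C.ε_out_pred hy.1))
        (by rw [← label_black, ← label_black]; exact hxy)
      simpa using C.α.injective this
    · have h2 : startTime y ≠ s + 1 := fun h => h1 (mixed hy hx hxy.symm h)
      exact ih (hold hx h1) (hold hy h2) hxy

theorem label_ne {k : Fin r} {c : ZMod 4} (hε : C.ε (Sum.inr (k, c)) = 1) :
    C.label (Sum.inr (k, c)) ≠ C.label (Sum.inr (k, c + 2)) := by
  intro h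
  have := C.eq_of_alive (s := k + 1) (C.alive_start hε)
    (C.alive_start (h := Sum.inr (k, c + 2)) (by rw [ε_σ_black, hε])) h
  simp only [Sum.inr.injEq, Prod.mk.injEq, true_and] at this
  exact absurd this (zmod_four_ne c)

/-! ### Transpositions -/

theorem exists_out (k : Fin r) : ∃ c, C.ε (Sum.inr (k, c)) = 1 := by
  rcases Int.units_eq_one_or (C.ε (Sum.inr (k, 0))) with h | h
  · exact ⟨0, h⟩
  · exact ⟨0 + 1, by rw [C.alternated, h, neg_neg]⟩

theorem out_eq {k : Fin r} {c c' : ZMod 4} (h : C.ε (Sum.inr (k, c)) = 1)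
    (h' : C.ε (Sum.inr (k, c')) = 1) : c' = c ∨ c' = c + 2 := by
  have h1 : C.ε (Sum.inr (k, c + 1)) = -1 := by rw [C.alternated, h]
  have h3 : C.ε (Sum.inr (k, c + 1 + 2)) = -1 := by rw [ε_σ_black, h1]
  rcases zmod_four_cases c c' with rfl | rfl | rfl | rfl
  · exact Or.inl rfl
  · exact Or.inr rfl
  · rw [h'] at h1; exact absurd h1.symm units_neg_one_ne_one
  · rw [h'] at h3; exact absurd h3.symm units_neg_one_ne_one

section LinearOrder

variable [LinearOrder I]

/-- The labels of the outgoing half-edges of a black vertex, in increasing order. -/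
def outPair (k : Fin r) : I × I :=
  (min (C.label (Sum.inr (k, (C.exists_out k).choose)))
      (C.label (Sum.inr (k, (C.exists_out k).choose + 2))),
    max (C.label (Sum.inr (k, (C.exists_out k).choose)))
      (C.label (Sum.inr (k, (C.exists_out k).choose + 2))))

theorem outPair_eq {k : Fin r} {c : ZMod 4} (h : C.ε (Sum.inr (k, c)) = 1) :
    C.outPair k = (min (C.label (Sum.inr (k, c))) (C.label (Sum.inr (k, c + 2))),
      max (C.label (Sum.inr (k, c))) (C.label (Sum.inr (k, c + 2)))) := by
  rw [outPair]
  rcases C.out_eq h (C.exists_out k).choose_spec with h' | h'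
  · rw [h']
  · rw [h', zmod_four_add, min_comm, max_comm]

theorem outPair_lt (k : Fin r) : (C.outPair k).1 < (C.outPair k).2 := by
  obtain ⟨c, hc⟩ := C.exists_out k
  rw [C.outPair_eq hc]
  exact min_lt_max.2 (C.label_ne hc)

theorem swap_outPair {k : Fin r} {c : ZMod 4} (h : C.ε (Sum.inr (k, c)) = 1) :
    PartPerm.swap (C.outPair k).1 (C.outPair k).2 =
      PartPerm.swap (C.label (Sum.inr (k, c))) (C.label (Sum.inr (k, c + 2))) := by
  rw [C.outPair_eq h]
  rcases le_total (C.label (Sum.inr (k, c))) (C.label (Sum.inr (k, c + 2))) with h1 | h1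
  · rw [min_eq_left h1, max_eq_right h1]
  · rw [min_eq_right h1, max_eq_left h1, PartPerm.swap_comm]

theorem mem_outPair {k : Fin r} {i : I} (h : i = (C.outPair k).1 ∨ i = (C.outPair k).2) :
    ∃ c, C.ε (Sum.inr (k, c)) = 1 ∧ C.label (Sum.inr (k, c)) = i := by
  obtain ⟨c, hc⟩ := C.exists_out k
  rw [C.outPair_eq hc] at h
  have h2 : C.ε (Sum.inr (k, c + 2)) = 1 := by rw [ε_σ_black, hc]
  rcases le_total (C.label (Sum.inr (k, c))) (C.label (Sum.inr (k, c + 2))) with h1 | h1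
  · simp only [min_eq_left h1, max_eq_right h1] at h
    rcases h with rfl | rfl
    exacts [⟨_, hc, rfl⟩, ⟨_, h2, rfl⟩]
  · simp only [min_eq_right h1, max_eq_left h1] at h
    rcases h with rfl | rfl
    exacts [⟨_, h2, rfl⟩, ⟨_, hc, rfl⟩]

theorem label_out_mem {k : Fin r} {c : ZMod 4} (h : C.ε (Sum.inr (k, c)) = 1) :
    C.label (Sum.inr (k, c)) = (C.outPair k).1 ∨ C.label (Sum.inr (k, c)) = (C.outPair k).2 := by
  rw [C.outPair_eq h]
  rcases le_total (C.label (Sum.inr (k, c))) (C.label (Sum.inr (k, c + 2))) with h1 | h1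
  · left; exact (min_eq_left h1).symm
  · right; exact (max_eq_left h1).symm

theorem value_eq (k : Fin r) : C.value k = (C.outPair k).2 := by
  obtain ⟨c, hc⟩ := C.exists_out k
  have hS : (Finset.univ.filter fun c : ZMod 4 => C.ε (Sum.inr (k, c)) = 1) = {c, c + 2} := by
    ext c'
    simp only [Finset.mem_filter, Finset.mem_univ, true_and, Finset.mem_insert,
      Finset.mem_singleton]
    refine ⟨C.out_eq hc, ?_⟩
    rintro (rfl | rfl)
    · exact hc
    · rw [ε_σ_black, hc]
  rw [value, hS, C.outPair_eq hc, Finset.image_insert, Finset.image_singleton, Finset.max_insert,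
    Finset.max_singleton, WithBot.coe_max]

theorem nondecreasing_iff : C.Nondecreasing ↔ Monotone fun k => (C.outPair k).2 := by
  have : C.value = fun k => ((C.outPair k).2 : WithBot I) := funext C.value_eq
  rw [Nondecreasing, this]
  exact ⟨fun h a b hab => WithBot.coe_le_coe.1 (h hab), fun h a b hab => WithBot.coe_le_coe.2 (h hab)⟩

end LinearOrder

end UnitaryMap

end

noncomputable section

/-! ## Products of transpositions -/

theorem perm_apply_inv_self {A : Type*} (f : Equiv.Perm A) (x : A) : f (f⁻¹ x) = x :=
  f.apply_symm_apply x

theorem perm_inv_apply_self {A : Type*} (f : Equiv.Perm A) (x : A) : f⁻¹ (f x) = x :=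
  f.symm_apply_apply x

section WordProd

variable {I : Type*} [DecidableEq I] {r : ℕ}

/-- The transposition number `s`, if there is one. -/
def stepSwap (w : Fin r → I × I) (s : ℕ) : PartPerm I :=
  if h : s < r then PartPerm.swap (w ⟨s, h⟩).1 (w ⟨s, h⟩).2 else 1

/-- The product of the first `s` transpositions, the first one on the right. -/
def partialProd (w : Fin r → I × I) : ℕ → PartPerm I
  | 0 => 1
  | s + 1 => stepSwap w s * partialProd w s

/-- The product of a sequence of transpositions, the first one on the right. -/
def wordProd (w : Fin r → I × I) : PartPerm I := partialProd w r

theorem partialProd_succ (w : Fin r → I × I) (k : Fin r) :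
    partialProd w (k + 1) = PartPerm.swap (w k).1 (w k).2 * partialProd w k := by
  rw [partialProd, stepSwap, dif_pos k.2]

theorem suppIn_partialProd {S : Set I} {w : Fin r → I × I} (hw : ∀ k, (w k).1 ∈ S ∧ (w k).2 ∈ S)
    (s : ℕ) : (partialProd w s).SuppIn S := by
  induction s with
  | zero => exact PartPerm.suppIn_one S
  | succ s ih =>
    by_cases h : s < r
    · have := partialProd_succ w ⟨s, h⟩
      simp only at this
      rw [this]
      exact ih.swap_mul (hw _).1 (hw _).2
    · rw [partialProd, stepSwap, dif_neg h, one_mul]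
      exact ih

theorem PartPerm.SuppIn.perm_mem {S : Set I} {a : PartPerm I} (ha : a.SuppIn S) {x : I}
    (hx : x ∈ S) : a.perm x ∈ S := by
  by_contra h
  exact h ((a.perm.injective (ha.perm_apply h)).symm ▸ hx)

theorem part_partialProd_mono (w : Fin r → I × I) {s s' : ℕ} (h : s ≤ s') :
    (partialProd w s).part ≤ (partialProd w s').part := by
  induction h with
  | refl => exact le_rfl
  | step _ ih => exact ih.trans le_sup_right

theorem joinPair_le_wordProd (w : Fin r → I × I) (k : Fin r) :
    joinPair (w k).1 (w k).2 ≤ (wordProd w).part := by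
  refine le_trans ?_ (part_partialProd_mono w (Nat.succ_le_of_lt k.2))
  have := partialProd_succ w k
  rw [Nat.succ_eq_add_one, this]
  exact le_sup_left

theorem wordProd_part_le_iff {w : Fin r → I × I} {θ : Setoid I} :
    (wordProd w).part ≤ θ ↔ ∀ k, θ (w k).1 (w k).2 := by
  refine ⟨fun h k => joinPair_le_iff.1 ((joinPair_le_wordProd w k).trans h), fun h => ?_⟩
  rw [wordProd]
  have : ∀ s, (partialProd w s).part ≤ θ := by
    intro s
    induction s with
    | zero => exact bot_le
    | succ s ih =>
      rw [partialProd, PartPerm.mul_part]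
      refine sup_le ?_ ih
      rw [stepSwap]
      split_ifs with hs
      · exact joinPair_le_iff.2 (h _)
      · exact bot_le
  exact this r

end WordProd

theorem numCycles_eq_card {A K : Type*} (f : Equiv.Perm A) (v : A → K)
    (hs : Function.Surjective v) (h1 : ∀ x, v (f x) = v x)
    (h2 : ∀ x y, v x = v y → f.SameCycle x y) : numCycles f = Nat.card K := by
  have : orb f = Setoid.ker v :=
    le_antisymm (orb_le_iff.2 fun x => (h1 x).symm) fun {x y} h => h2 x y h
  rw [_root_.numCycles_eq, numClasses, this]
  exact Nat.card_congr (Setoid.quotientKerEquivOfSurjective _ hs)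

namespace UnitaryMap

variable {I : Type*} {r : ℕ} (C : UnitaryMap I r)

theorem endTime_le (h : I ⊕ Fin r × ZMod 4) : endTime h ≤ r := by
  rcases h with i | ⟨k, c⟩
  · exact le_rfl
  · exact k.2.le

section LinearOrder

variable [LinearOrder I]

theorem ε_outPair (k : Fin r) :
    (C.outPair k).1 ∈ {i | C.whiteε i = 1} ∧ (C.outPair k).2 ∈ {i | C.whiteε i = 1} := by
  constructor
  · obtain ⟨c, hc, h⟩ := C.mem_outPair (k := k) (Or.inl rfl)
    rw [← h]; exact (C.ε_label _).trans hc
  · obtain ⟨c, hc, h⟩ := C.mem_outPair (k := k) (Or.inr rfl)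
    rw [← h]; exact (C.ε_label _).trans hc

theorem label_notMem_outPair {k : Fin r} {x : I ⊕ Fin r × ZMod 4} (hx : C.Alive (k + 1) x)
    (hs : startTime x ≠ k + 1) : C.label x ≠ (C.outPair k).1 ∧ C.label x ≠ (C.outPair k).2 := by
  rw [← not_or]
  intro h
  obtain ⟨c, hc, h'⟩ := C.mem_outPair h
  have := C.eq_of_alive hx (C.alive_start hc) h'.symm
  rw [this] at hs
  exact hs rfl

/-- Following the strands. -/
theorem label_α_of_alive {s : ℕ} {x : I ⊕ Fin r × ZMod 4} (hx : C.Alive s x) {i : I}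
    (hi : C.label x = (partialProd C.outPair s).perm i) : C.label (C.α x) = C.facing i := by
  induction s generalizing x with
  | zero =>
    rcases x with j | x
    · rw [label_inl] at hi
      rw [hi]; rfl
    · exact absurd hx.2.1 (by simp [startTime])
  | succ s ih =>
    have hlt : s < r := by have := hx.2.2; have := endTime_le (C.α x); omega
    have hp := partialProd_succ C.outPair ⟨s, hlt⟩
    simp only at hp
    rw [hp, PartPerm.mul_perm, Equiv.Perm.mul_apply] at hi
    by_cases h1 : startTime x = s + 1
    · obtain ⟨hlt, c, rfl⟩ := startTime_eq h1
      have hc := hx.1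
      rw [C.swap_outPair hc, PartPerm.swap_perm, eq_comm, Equiv.swap_apply_eq_iff,
        Equiv.swap_apply_left] at hi
      -- The far end of the strand leaving through `c` has the same label as the ingoing half-edge
      -- `c - 1`, where the strand labelled like the other outgoing half-edge `c + 2` arrives.
      -- Passing the vertex thus applies its transposition.
      have h2 : C.ε (Sum.inr (⟨s, hlt⟩, c - 1)) = -1 := by
        have := C.alternated ⟨s, hlt⟩ (c - 1)
        rw [sub_add_cancel, hc] at this
        rw [this, neg_neg]
      have h3 := ih (C.alive_α h2) (by
        rw [hi]
        have := C.label_black ⟨s, hlt⟩ (c + 2)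
        have e : c + 2 + 1 = c - 1 := by
          have : (4 : ZMod 4) = 0 := rfl
          linear_combination this
        rw [this, e])
      rw [C.α_α, label_black, sub_add_cancel] at h3
      exact h3
    · have h2 := C.label_notMem_outPair (k := ⟨s, hlt⟩) hx h1
      rw [PartPerm.swap_perm, eq_comm, Equiv.swap_apply_eq_iff,
        Equiv.swap_apply_of_ne_of_ne h2.1 h2.2] at hi
      exact ih ⟨hx.1, by have := hx.2.1; omega, by have := hx.2.2; omega⟩ hi.symm

/-- A label entering a black vertex leaves it on the neighbouring half-edge, so every outgoing label
persists to the end. -/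
theorem exists_alive {s : ℕ} (hs : s ≤ r) {i : I} (hi : C.whiteε i = 1) :
    ∃ x, C.Alive s x ∧ C.label x = i := by
  induction s with
  | zero => exact ⟨Sum.inl i, C.alive_start hi, C.label_inl i⟩
  | succ s ih =>
    obtain ⟨x, hx, hl⟩ := ih (by omega)
    by_cases h : s + 1 ≤ endTime (C.α x)
    · exact ⟨x, ⟨hx.1, by have := hx.2.1; omega, h⟩, hl⟩
    · have h1 : endTime (C.α x) = s := by have := hx.2.2; omega
      rcases hy : C.α x with j | ⟨k, c⟩
      · rw [hy] at h1; simp only [endTime] at h1; omega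
      · rw [hy] at h1
        have hk : k.1 = s := h1
        have h2 : C.ε (Sum.inr (k, c - 1)) = 1 := by
          have := C.alternated k (c - 1)
          rw [sub_add_cancel, ← hy, C.ε_α, hx.1] at this
          exact (neg_injective this).symm
        refine ⟨Sum.inr (k, c - 1), hk ▸ C.alive_start h2, ?_⟩
        rw [label_black, sub_add_cancel, ← hy, C.α_α, hl]

theorem suppIn_wordProd : (wordProd C.outPair).SuppIn {i | C.whiteε i = 1} :=
  suppIn_partialProd C.ε_outPair r

theorem whiteε_facing (i : I) : C.whiteε (C.facing i) = -C.whiteε i := by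
  rw [facing, whiteε, ε_label, C.ε_α]; rfl

/-- After all crossings, the strand labelled by the image of `i` under the product ends at a white
half-edge, which is `C.facing i`; seen from there, one faces that strand. -/
theorem facing_facing {i : I} (hi : C.whiteε i = 1) :
    C.facing (C.facing i) = (wordProd C.outPair).perm i := by
  obtain ⟨x, hx, hl⟩ := C.exists_alive le_rfl (C.suppIn_wordProd.perm_mem hi)
  have h1 := C.label_α_of_alive hx hl
  rcases hy : C.α x with j | ⟨k, c⟩
  · rw [hy, label_inl] at h1
    rw [← h1, facing, ← hy, C.α_α, hl]
  · have := hx.2.2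
    rw [hy] at this
    exact absurd this (not_le.2 k.2)

variable [Fintype I]

/-- The matching of the white half-edges which remains when the black vertices are removed. -/
def matching : Equiv.Perm I := (wordProd C.outPair).perm⁻¹ * C.whiteφ⁻¹ * C.whiteρ⁻¹

theorem wordProd_matching (i : I) :
    (wordProd C.outPair).perm (C.matching i) = C.facing i := by
  rw [matching, Equiv.Perm.mul_apply, Equiv.Perm.mul_apply, perm_apply_inv_self,
    whiteφ_inv_eq, perm_apply_inv_self]

/-- The label faced by `i` is ingoing, hence fixed by the product of the transpositions. -/
theorem matching_of_pos {i : I} (hi : C.whiteε i = 1) : C.matching i = C.facing i := by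
  apply (wordProd C.outPair).perm.injective
  rw [wordProd_matching, C.suppIn_wordProd.perm_apply]
  change ¬ C.whiteε _ = 1
  rw [whiteε_facing, hi]
  exact units_neg_one_ne_one

theorem whiteε_wordProd (i : I) : C.whiteε ((wordProd C.outPair).perm i) = C.whiteε i := by
  by_cases hi : C.whiteε i = 1
  · rw [hi]; exact C.suppIn_wordProd.perm_mem hi
  · rw [C.suppIn_wordProd.perm_apply hi]

theorem whiteε_matching (i : I) : C.whiteε (C.matching i) = -C.whiteε i := by
  rw [← whiteε_wordProd, wordProd_matching, whiteε_facing]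

theorem matching_matching (i : I) : C.matching (C.matching i) = i := by
  have key : ∀ i, C.whiteε i = 1 → C.matching (C.matching i) = i := by
    intro i hi
    apply (wordProd C.outPair).perm.injective
    rw [wordProd_matching, C.matching_of_pos hi, C.facing_facing hi]
  rcases Int.units_eq_one_or (C.whiteε i) with h | h
  · exact key i h
  · apply C.matching.injective
    exact key _ (by rw [whiteε_matching, h, neg_neg])

theorem unitSign_neg (e : ℤˣ) : Word.unitSign (-e) = -Word.unitSign e := by
  revert e; decide

theorem unitSign_eq_one {e : ℤˣ} : Word.unitSign e = 1 ↔ e = 1 := by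
  revert e; decide

theorem unitSign_ne_zero (e : ℤˣ) : Word.unitSign e ≠ 0 := by
  revert e; decide

theorem mem_matchings_unitSign {ε : I → ℤˣ} {T : Equiv.Perm I} :
    T ∈ matchings (fun i => Word.unitSign (ε i)) ↔
      (∀ i, T (T i) = i) ∧ ∀ i, ε (T i) = -ε i := by
  rw [mem_matchings]
  refine and_congr ⟨fun h i => Equiv.ext_iff.1 h i, fun h => Equiv.ext h⟩ ?_
  constructor
  · intro h i
    have := h.1 i
    rw [← unitSign_neg] at this
    generalize ε (T i) = a at this
    generalize ε i = b at this
    revert a b; decide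
  · exact fun h => ⟨fun i => by rw [h, unitSign_neg], fun i hi => absurd hi (unitSign_ne_zero _)⟩

theorem matching_mem : C.matching ∈ matchings (fun i => Word.unitSign (C.whiteε i)) :=
  mem_matchings_unitSign.2 ⟨C.matching_matching, C.whiteε_matching⟩

theorem whiteφ_inv : C.whiteφ⁻¹ = (wordProd C.outPair).perm * C.matching * C.whiteρ := by
  rw [matching]; group

/-! ### Vertices, edges and faces -/

theorem numVertices_eq : C.numVertices = numCycles C.whiteρ + r := by
  have h0 : orb C.whiteρ ≤ Setoid.comap Sum.inl (orb C.σ) := orb_le_iff.2 fun i => by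
    rw [Setoid.comap_rel, ← σ_inl_eq]; exact orb_rel _ _
  rw [OrientedMap.numVertices, numCycles_eq_card C.σ
    (Sum.map (Quotient.mk (orb C.whiteρ)) fun x : Fin r × ZMod 4 => x.1)]
  · rw [Nat.card_sum, Nat.card_fin]; rfl
  · rintro (x | k)
    · induction x using Quotient.inductionOn with
      | h i => exact ⟨Sum.inl i, rfl⟩
    · exact ⟨Sum.inr (k, 0), rfl⟩
  · rintro (i | ⟨k, c⟩)
    · rw [σ_inl_eq]
      simp only [Sum.map_inl, Sum.inl.injEq]
      exact Quotient.sound (Setoid.symm' _ (orb_rel C.whiteρ i))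
    · rw [C.σ_black]; rfl
  · rintro (i | ⟨k, c⟩) (j | ⟨k', c'⟩) h
    · simp only [Sum.map_inl, Sum.inl.injEq] at h
      exact h0 (Quotient.exact h)
    · simp at h
    · simp at h
    · simp only [Sum.map_inr, Sum.inr.injEq] at h
      subst h
      have h1 : ∀ n : ℕ, (C.σ ^ n) (Sum.inr (k, c)) = Sum.inr (k, c + n) := by
        intro n
        induction n with
        | zero => simp
        | succ n ih => rw [pow_succ', Equiv.Perm.mul_apply, ih, C.σ_black]; push_cast; rw [add_assoc]
      refine ⟨((c' - c).val : ℤ), ?_⟩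
      rw [zpow_natCast, h1, ZMod.natCast_zmod_val, add_sub_cancel]

theorem card_out : Nat.card {h // C.ε h = 1} =
    (plusSet fun i => Word.unitSign (C.whiteε i)).card + 2 * r := by
  classical
  rw [Nat.card_eq_fintype_card, Fintype.card_subtype, Finset.card_filter, Fintype.sum_sum_type,
    Fintype.sum_prod_type]
  have h2 : ∀ k : Fin r, (∑ c, if C.ε (Sum.inr (k, c)) = 1 then 1 else 0) = 2 := by
    intro k
    obtain ⟨c, hc⟩ := C.exists_out k
    rw [← Finset.card_filter]
    have hS : (Finset.univ.filter fun c : ZMod 4 => C.ε (Sum.inr (k, c)) = 1) = {c, c + 2} := by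
      ext c'
      simp only [Finset.mem_filter, Finset.mem_univ, true_and, Finset.mem_insert,
        Finset.mem_singleton]
      refine ⟨C.out_eq hc, ?_⟩
      rintro (rfl | rfl)
      · exact hc
      · rw [ε_σ_black, hc]
    rw [hS, Finset.card_pair (zmod_four_ne c)]
  simp only [h2, Finset.sum_const, Finset.card_univ, Fintype.card_fin, smul_eq_mul]
  rw [← Finset.card_filter, mul_comm]
  congr 2
  ext i
  simp only [Finset.mem_filter, Finset.mem_univ, true_and, mem_plusSet, unitSign_eq_one]
  rfl

/-- An edge has exactly one outgoing half, and each black vertex has two outgoing half-edges. -/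
theorem numEdges_eq :
    C.numEdges = (plusSet fun i => Word.unitSign (C.whiteε i)).card + 2 * r := by
  classical
  rw [← card_out, OrientedMap.numEdges]
  have hα : ∀ h, ¬ C.ε h = 1 → C.ε (C.α h) = 1 := fun h hh => by
    rw [C.ε_α, (Int.units_eq_one_or _).resolve_left hh, neg_neg]
  refine numCycles_eq_card C.α
    (fun h => if hh : C.ε h = 1 then ⟨h, hh⟩ else ⟨C.α h, hα h hh⟩) ?_ ?_ ?_
  · rintro ⟨h, hh⟩
    exact ⟨h, by simp [hh]⟩
  · intro h
    by_cases hh : C.ε h = 1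
    · have : ¬ C.ε (C.α h) = 1 := by rw [C.ε_α, hh]; exact units_neg_one_ne_one
      simp [hh, this, C.α_α]
    · simp [hh, hα h hh]
  · have hsame : ∀ h, C.α.SameCycle h (C.α h) := fun h => orb_rel C.α h
    intro x y hxy
    by_cases hx : C.ε x = 1 <;> by_cases hy : C.ε y = 1 <;>
      simp only [hx, hy, dite_true, dite_false, Subtype.mk.injEq] at hxy
    · rw [hxy]
    · rw [hxy]; exact (hsame y).symm
    · rw [← hxy]; exact hsame x
    · rw [C.α.injective hxy]

theorem sameCycle_label (h : I ⊕ Fin r × ZMod 4) :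
    C.φ.SameCycle h (Sum.inl (C.label h)) := by
  obtain ⟨n, hn, -⟩ := C.label_spec h
  exact ⟨-n, by rw [zpow_neg, zpow_natCast, ← inv_pow]; exact hn⟩

/-- Every face meets a white half-edge, so labels identify the faces with the cycles of the induced
permutation. -/
theorem numFaces_eq : C.numFaces = numCycles C.whiteφ := by
  have hφ : ∀ h, (orb C.whiteφ) (C.label (C.φ⁻¹ h)) (C.label h) := by
    rintro (i | x)
    · rw [label_φ_inv, label_inl, ← orb_inv]
      exact Setoid.symm' _ (orb_rel _ i)
    · rw [C.label_inr x, φ_inv_apply]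
  have h0 : orb C.whiteφ ≤ Setoid.comap Sum.inl (orb C.φ) := by
    rw [← orb_inv C.whiteφ]
    refine orb_le_iff.2 fun i => ?_
    rw [Setoid.comap_rel, ← label_φ_inv]
    refine Setoid.trans' _ ?_ (C.sameCycle_label _)
    have := orb_rel C.φ⁻¹ (Sum.inl i : I ⊕ Fin r × ZMod 4)
    rwa [orb_inv] at this
  rw [OrientedMap.numFaces, numCycles_eq_card C.φ fun h => Quotient.mk (orb C.whiteφ) (C.label h)]
  · rfl
  · intro x
    induction x using Quotient.inductionOn with
    | h i => exact ⟨Sum.inl i, congrArg _ (C.label_inl i)⟩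
  · intro h
    have := hφ (C.φ h)
    rw [perm_inv_apply_self] at this
    exact Quotient.sound (Setoid.symm' _ this)
  · intro x y h
    exact (C.sameCycle_label x).trans ((h0 (Quotient.exact h)).trans (C.sameCycle_label y).symm)

/-! ### Connectedness -/

theorem orbitRel_le_iff {θ : Setoid (I ⊕ Fin r × ZMod 4)} :
    MulAction.orbitRel (Subgroup.closure {C.σ, C.α}) (I ⊕ Fin r × ZMod 4) ≤ θ ↔
      (∀ h, θ (C.σ h) h) ∧ ∀ h, θ (C.α h) h := by
  constructor
  · intro hle
    exact ⟨fun h => hle ⟨⟨C.σ, Subgroup.subset_closure (by simp)⟩, rfl⟩,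
      fun h => hle ⟨⟨C.α, Subgroup.subset_closure (by simp)⟩, rfl⟩⟩
  · rintro ⟨h1, h2⟩ x y ⟨⟨g, hg⟩, rfl⟩
    have : ∀ h, θ (g h) h := by
      induction hg using Subgroup.closure_induction with
      | mem g hg =>
        rcases hg with rfl | rfl
        · exact h1
        · exact h2
      | one => exact fun h => Setoid.refl' _ _
      | mul g g' _ _ hg hg' =>
        exact fun h => Setoid.trans' _ (hg (g' h)) (hg' h)
      | inv g _ hg =>
        intro h
        have := hg (g⁻¹ h)
        rw [perm_apply_inv_self] at this
        exact Setoid.symm' _ this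
    exact this y

/-- A half-edge lies on the same face as the white half-edge of its label, so connectedness can be
tested on labels. Rotation and edges respect the joined partition on labels; conversely the
transposed labels meet at a black vertex, and matched labels are connected through the strands. -/
theorem connected_iff [Nonempty I] :
    C.Connected ↔ orb C.whiteρ ⊔ orb C.matching ⊔ (wordProd C.outPair).part = ⊤ := by
  set O := MulAction.orbitRel (Subgroup.closure {C.σ, C.α}) (I ⊕ Fin r × ZMod 4) with hO
  set η := orb C.whiteρ ⊔ orb C.matching ⊔ (wordProd C.outPair).part with hη
  have hconn : C.Connected ↔ O = ⊤ := by
    rw [OrientedMap.Connected, OrientedMap.numComponents, Nat.card_eq_one_iff_unique]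
    constructor
    · rintro ⟨hs, -⟩
      refine le_antisymm le_top fun {x y} _ => ?_
      exact Quotient.exact (s := O) (@Subsingleton.elim _ hs _ _)
    · intro h
      refine ⟨⟨fun a b => ?_⟩, ⟨Quotient.mk O (Sum.inl (Classical.arbitrary I))⟩⟩
      induction a using Quotient.inductionOn
      induction b using Quotient.inductionOn
      refine Quotient.sound (s := O) ?_
      change O _ _
      rw [h]; trivial
  rw [hconn]
  have hsupp : orb (wordProd C.outPair).perm ≤ η := C.suppIn_wordProd.1.trans le_sup_right
  have hfac : ∀ i, η (C.facing i) i := fun i => by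
    rw [← wordProd_matching]
    refine Setoid.symm' _ (Setoid.trans' _ ?_ (hsupp (orb_rel _ _)))
    exact (le_sup_right.trans le_sup_left : orb C.matching ≤ η) (orb_rel _ i)
  have hout : ∀ x, C.ε x = 1 → η (C.label (C.α x)) (C.label x) := by
    intro x hx
    have h1 := C.label_α_of_alive (C.alive_start hx) (i := (partialProd C.outPair
      (startTime x)).perm⁻¹ (C.label x)) (by rw [perm_apply_inv_self])
    rw [h1]
    refine Setoid.trans' _ (hfac _) ?_
    have h2 : orb (partialProd C.outPair (startTime x)).perm ≤ η := by
      refine ((suppIn_partialProd C.ε_outPair _).1.trans (part_partialProd_mono _ ?_)).trans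
        le_sup_right
      rcases x with i | ⟨k, c⟩
      · exact Nat.zero_le _
      · exact k.2
    have h3 := h2 (orb_rel (partialProd C.outPair (startTime x)).perm
      ((partialProd C.outPair (startTime x)).perm⁻¹ (C.label x)))
    rwa [perm_apply_inv_self] at h3
  have hα : ∀ x, η (C.label (C.α x)) (C.label x) := by
    intro x
    rcases Int.units_eq_one_or (C.ε x) with h | h
    · exact hout x h
    · have := hout (C.α x) (by rw [C.ε_α, h, neg_neg])
      rw [C.α_α] at this
      exact Setoid.symm' _ this
  have hσ : ∀ x, η (C.label (C.σ x)) (C.label x) := by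
    rintro (i | x)
    · rw [σ_inl_eq, label_inl, label_inl]
      exact Setoid.symm' _ ((le_sup_left.trans le_sup_left : orb C.whiteρ ≤ η) (orb_rel _ i))
    · rw [label_inr]
      exact Setoid.symm' _ (hα _)
  constructor
  · intro h
    have hle : O ≤ Setoid.comap C.label η := C.orbitRel_le_iff.2 ⟨hσ, hα⟩
    rw [h] at hle
    refine le_antisymm le_top fun {i j} _ => ?_
    have := hle (show (⊤ : Setoid _) (Sum.inl i) (Sum.inl j) from trivial)
    rwa [Setoid.comap_rel, label_inl, label_inl] at this
  · intro h
    obtain ⟨Oσ, Oα⟩ := C.orbitRel_le_iff.1 (le_refl O)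
    have Oφ : orb C.φ ≤ O := by
      rw [← orb_inv C.φ]
      refine orb_le_iff.2 fun x => ?_
      rw [φ_inv_apply]
      exact Setoid.symm' _ (Setoid.trans' _ (Oα _) (Oσ _))
    have Olab : ∀ x, O x (Sum.inl (C.label x)) := fun x => Oφ (C.sameCycle_label x)
    have Osame : ∀ k c c', O (Sum.inr (k, c)) (Sum.inr (k, c + c')) := by
      intro k c c'
      have : ∀ n : ℕ, O (Sum.inr (k, c)) (Sum.inr (k, c + n)) := by
        intro n
        induction n with
        | zero => simp
        | succ n ih =>
          refine Setoid.trans' _ ih (Setoid.symm' _ ?_)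
          have := Oσ (Sum.inr (k, c + n))
          rw [C.σ_black] at this
          push_cast
          rwa [← add_assoc]
      have h := this c'.val
      rwa [ZMod.natCast_zmod_val] at h
    have hpart : (wordProd C.outPair).part ≤ Setoid.comap Sum.inl O := by
      rw [wordProd_part_le_iff]
      intro k
      obtain ⟨c, -, h1⟩ := C.mem_outPair (k := k) (Or.inl rfl)
      obtain ⟨c', -, h2⟩ := C.mem_outPair (k := k) (Or.inr rfl)
      rw [Setoid.comap_rel, ← h1, ← h2]
      refine Setoid.trans' _ (Setoid.symm' _ (Olab _)) (Setoid.trans' _ ?_ (Olab _))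
      have := Osame k c (c' - c)
      rwa [add_sub_cancel] at this
    have hle : η ≤ Setoid.comap Sum.inl O := by
      refine sup_le (sup_le (orb_le_iff.2 fun i => ?_) (orb_le_iff.2 fun i => ?_)) hpart
      · rw [Setoid.comap_rel, ← σ_inl_eq]
        exact Setoid.symm' _ (Oσ _)
      · have h1 := (C.suppIn_wordProd.1.trans hpart) (orb_rel _ (C.matching i))
        rw [Setoid.comap_rel, wordProd_matching, facing] at h1
        rw [Setoid.comap_rel]
        exact Setoid.trans' _ (Setoid.trans' _ (Setoid.symm' _ (Oα _)) (Olab _))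
          (Setoid.symm' _ h1)
    rw [h] at hle
    refine le_antisymm le_top fun {x y} _ => ?_
    refine Setoid.trans' _ (Olab x) (Setoid.trans' _ ?_ (Setoid.symm' _ (Olab y)))
    exact hle (show (⊤ : Setoid _) (C.label x) (C.label y) from trivial)

theorem hasGenus_iff [Nonempty I] (hC : C.Connected) {γ : Equiv.Perm I} (hγ : C.whiteρ = γ⁻¹)
    (g : ℤ) : C.HasGenus g ↔ eulerChar r γ (fun i => Word.unitSign (C.whiteε i)) C.matching
      (wordProd C.outPair) = 2 - 2 * g := by
  rw [OrientedMap.HasGenus, hC, numVertices_eq, numEdges_eq, numFaces_eq, eulerChar, ← hγ,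
    ← whiteφ_inv, numCycles_inv, hγ, numCycles_inv]
  push_cast
  constructor <;> intro h <;> linarith

end LinearOrder

end UnitaryMap

end

noncomputable section

/-! ## Isomorphisms of maps of unitary type -/

namespace UnitaryMap

section Iso

variable {I : Type*} {r : ℕ} {C C' : UnitaryMap I r}

theorem Iso.label_eq {θ : Equiv.Perm (I ⊕ Fin r × ZMod 4)} (h1 : ∀ i, θ (Sum.inl i) = Sum.inl i)
    (h2 : ∀ k c, ∃ c', θ (Sum.inr (k, c)) = Sum.inr (k, c'))
    (h3 : ∀ h, θ (C.σ h) = C'.σ (θ h)) (h4 : ∀ h, θ (C.α h) = C'.α (θ h))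
    (h : I ⊕ Fin r × ZMod 4) : C'.label (θ h) = C.label h := by
  have hpow : ∀ n : ℕ, (C'.φ⁻¹ ^ n) (θ h) = θ ((C.φ⁻¹ ^ n) h) := by
    intro n
    induction n with
    | zero => rfl
    | succ n ih =>
      rw [pow_succ', pow_succ', Equiv.Perm.mul_apply, Equiv.Perm.mul_apply, ih, φ_inv_apply,
        φ_inv_apply, h4, h3]
  obtain ⟨n, hn, hm⟩ := C.label_spec h
  refine C'.label_eq_of_pow (n := n) (by rw [hpow, hn, h1]) fun m hlt => ?_
  rw [hpow]
  have := hm m hlt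
  rcases hx : (C.φ⁻¹ ^ m) h with i | ⟨k, c⟩
  · rw [hx] at this; simp at this
  · obtain ⟨c', hc'⟩ := h2 k c
    rw [hc']; simp

variable [LinearOrder I] [Fintype I]

/-- This makes the encoding independent of the representative of an isomorphism class. -/
theorem Iso.data_eq (h : Iso C C') : C'.whiteε = C.whiteε ∧ C'.whiteρ = C.whiteρ ∧
    C'.outPair = C.outPair ∧ C'.matching = C.matching ∧ C'.whiteφ = C.whiteφ := by
  obtain ⟨θ, h1, h2, h3, h4, h5⟩ := h
  have hlab := Iso.label_eq h1 h2 h3 h4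
  have hε : C'.whiteε = C.whiteε := funext fun i => by rw [whiteε, whiteε, h5, h1]
  have hρ : C'.whiteρ = C.whiteρ := Equiv.ext fun i => by
    apply Sum.inl_injective (β := Fin r × ZMod 4)
    rw [← σ_inl_eq, ← h1 (C.whiteρ i), ← σ_inl_eq, h3, h1]
  have hw : C'.outPair = C.outPair := funext fun k => by
    obtain ⟨c, hc⟩ := C.exists_out k
    obtain ⟨c', hc'⟩ := h2 k c
    have hσ : θ (Sum.inr (k, c + 2)) = Sum.inr (k, c' + 2) := by
      have e : ∀ c : ZMod 4, c + 2 = c + 1 + 1 := fun c => by ring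
      rw [e, e, ← C.σ_black, h3, ← C.σ_black, h3, hc', C'.σ_black, C'.σ_black]
    rw [C.outPair_eq hc, C'.outPair_eq (c := c') (by rw [← hc', ← h5, hc]), ← hc', ← hσ, hlab,
      hlab]
  have hφ : C'.whiteφ = C.whiteφ := by
    rw [← inv_inj]
    refine Equiv.ext fun i => ?_
    rw [whiteφ_inv_eq, whiteφ_inv_eq, hρ, facing, facing, ← hlab, h4, h1]
  exact ⟨hε, hρ, hw, by rw [matching, matching, hw, hφ, hρ], hφ⟩

theorem label_add_two (C : UnitaryMap I r) {k : Fin r} {c : ZMod 4}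
    (hc : C.ε (Sum.inr (k, c)) = 1) (h : C.label (Sum.inr (k, c)) = (C.outPair k).1) :
    C.label (Sum.inr (k, c + 2)) = (C.outPair k).2 := by
  rw [C.outPair_eq hc] at h ⊢
  exact (max_eq_right (min_eq_left_iff.1 h.symm)).symm

/-- A map of unitary type is determined by its rotation, its transpositions and its matching. -/
theorem iso_of_data_eq (hε : C.whiteε = C'.whiteε) (hρ : C.whiteρ = C'.whiteρ)
    (hw : C.outPair = C'.outPair) (hT : C.matching = C'.matching) : Iso C C' := by
  choose a ha hal using fun k => C.mem_outPair (k := k) (Or.inl rfl)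
  choose b hb hbl using fun k => C'.mem_outPair (k := k) (Or.inl rfl)
  have hal2 := fun k => C.label_add_two (ha k) (hal k)
  have hbl2 := fun k => C'.label_add_two (hb k) (hbl k)
  have ha2 : ∀ k, C.ε (Sum.inr (k, a k + 2)) = 1 := fun k => by rw [ε_σ_black, ha]
  have hb2 : ∀ k, C'.ε (Sum.inr (k, b k + 2)) = 1 := fun k => by rw [ε_σ_black, hb]
  -- Each black vertex is turned so that the outgoing half-edges with the smaller label correspond.
  let rot : Equiv.Perm (Fin r × ZMod 4) :=
    ⟨fun x => (x.1, x.2 + (b x.1 - a x.1)), fun x => (x.1, x.2 - (b x.1 - a x.1)),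
      fun x => by simp, fun x => by simp⟩
  let θ : Equiv.Perm (I ⊕ Fin r × ZMod 4) := Equiv.sumCongr (Equiv.refl I) rot
  have θl : ∀ i, θ (Sum.inl i) = Sum.inl i := fun i => rfl
  have θr : ∀ k c, θ (Sum.inr (k, c)) = Sum.inr (k, c + (b k - a k)) := fun k c => rfl
  have θa : ∀ k, θ (Sum.inr (k, a k)) = Sum.inr (k, b k) := fun k => by
    rw [θr, add_sub_cancel]
  have θa' : ∀ k d, θ (Sum.inr (k, a k + d)) = Sum.inr (k, b k + d) := fun k d => by
    rw [θr]; congr 2; ring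
  have θε : ∀ h, C.ε h = C'.ε (θ h) := by
    rintro (i | ⟨k, c⟩)
    · exact congrFun hε i
    · rcases zmod_four_cases (a k) c with rfl | rfl | rfl | rfl
      · rw [θa, ha, hb]
      · rw [θa', ha2, hb2]
      · rw [θa', C.alternated, C'.alternated, ha, hb]
      · rw [add_assoc, θa', ← add_assoc, ← add_assoc, ε_σ_black, ε_σ_black, C.alternated,
          C'.alternated, ha, hb]
  have θlab : ∀ k c, C.ε (Sum.inr (k, c)) = 1 →
      C'.label (θ (Sum.inr (k, c))) = C.label (Sum.inr (k, c)) := by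
    intro k c hc
    rcases C.out_eq (ha k) hc with rfl | rfl
    · rw [θa, hal, hbl, hw]
    · rw [θa', hal2, hbl2, hw]
  -- At each time strands are determined by their labels, and both maps have the same crossings, so
  -- strands with equal labels correspond. Edges are then compared at their ingoing ends.
  have key : ∀ s x x', C.Alive s x → C'.Alive s x' → C.label x = C'.label x' → θ x = x' := by
    intro s
    induction s with
    | zero =>
      rintro (i | x) (i' | x') hx hx' hl
      · rw [label_inl, label_inl] at hl
        rw [θl, hl]
      · exact absurd hx'.2.1 (by simp [startTime])
      · exact absurd hx.2.1 (by simp [startTime])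
      · exact absurd hx.2.1 (by simp [startTime])
    | succ s ih =>
      intro x x' hx hx' hl
      have hlt : s < r := by have := hx.2.2; have := endTime_le (C.α x); omega
      have old : ∀ {D : UnitaryMap I r} {z}, D.Alive (s + 1) z →
          D.label z ≠ (D.outPair ⟨s, hlt⟩).1 → D.label z ≠ (D.outPair ⟨s, hlt⟩).2 →
          D.Alive s z := by
        intro D z hz hz1 hz2
        refine ⟨hz.1, ?_, by have := hz.2.2; omega⟩
        by_contra hcon
        have h1 : startTime z = s + 1 := by have := hz.2.1; omega
        obtain ⟨hlt, c, rfl⟩ := startTime_eq h1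
        rcases D.label_out_mem hz.1 with h | h
        · exact hz1 h
        · exact hz2 h
      by_cases h1 : C.label x = (C.outPair ⟨s, hlt⟩).1
      · have e1 := C.eq_of_alive hx (C.alive_start (ha ⟨s, hlt⟩)) (h1.trans (hal _).symm)
        have e2 := C'.eq_of_alive hx' (C'.alive_start (hb ⟨s, hlt⟩))
          (by rw [← hl, h1, hw, hbl])
        rw [e1, e2, θa]
      · by_cases h2 : C.label x = (C.outPair ⟨s, hlt⟩).2
        · have e1 := C.eq_of_alive hx (C.alive_start (ha2 ⟨s, hlt⟩)) (h2.trans (hal2 _).symm)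
          have e2 := C'.eq_of_alive hx' (C'.alive_start (hb2 ⟨s, hlt⟩))
            (by rw [← hl, h2, hw, hbl2])
          rw [e1, e2, θa']
        · exact ih x x' (old hx h1 h2) (old hx' (by rw [← hl, ← hw]; exact h1)
            (by rw [← hl, ← hw]; exact h2)) hl
  have hin : ∀ h, C.ε h = -1 → θ (C.α h) = C'.α (θ h) := by
    rintro (i | ⟨k, c⟩) hh
    · refine key r _ _ (C.alive_inl_α hh) (C'.alive_inl_α ((θε (Sum.inl i)).symm.trans hh)) ?_
      change C.facing i = C'.facing i
      rw [← wordProd_matching, ← wordProd_matching, hw, hT]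
    · have hh' := hh
      rw [θε] at hh'
      refine key k _ _ (C.alive_α hh) (C'.alive_α hh') ?_
      have h1 : C.ε (Sum.inr (k, c - 1)) = 1 := by
        have := C.alternated k (c - 1)
        rw [sub_add_cancel, hh] at this
        exact (neg_injective this).symm
      have h2 := C.label_black k (c - 1)
      have h3 := C'.label_black k (c - 1 + (b k - a k))
      have e : c - 1 + (b k - a k) + 1 = c + (b k - a k) := by ring
      rw [sub_add_cancel] at h2
      rw [e] at h3
      rw [θr, ← h2, ← h3, ← θr, θlab k _ h1]
  refine ⟨θ, θl, fun k c => ⟨_, θr k c⟩, ?_, fun h => ?_, θε⟩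
  · rintro (i | ⟨k, c⟩)
    · rw [σ_inl_eq, θl, θl, σ_inl_eq, hρ]
    · rw [C.σ_black, θr, θr, C'.σ_black]
      congr 2; ring
  · rcases Int.units_eq_one_or (C.ε h) with hh | hh
    · have := hin (C.α h) (by rw [C.ε_α, hh])
      rw [C.α_α] at this
      rw [this, C'.α_α]
    · exact hin h hh

end Iso

/-! ## Construction of maps of unitary type -/

section Construction

variable {I : Type*} {r : ℕ} [DecidableEq I]

/-- The outgoing half-edge with label `i` before the black vertex `s`. -/
def hold (w : Fin r → I × I) : ℕ → I → I ⊕ Fin r × ZMod 4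
  | 0, i => Sum.inl i
  | s + 1, i =>
    if h : s < r then
      if i = (w ⟨s, h⟩).1 then Sum.inr (⟨s, h⟩, 0)
      else if i = (w ⟨s, h⟩).2 then Sum.inr (⟨s, h⟩, 2) else hold w s i
    else hold w s i

/-- The labels of outgoing half-edges. -/
def outLabel (w : Fin r → I × I) : I ⊕ Fin r × ZMod 4 → I
  | Sum.inl i => i
  | Sum.inr x => if x.2 = 0 then (w x.1).1 else (w x.1).2

/-- The orientation of the half-edges of a black vertex. -/
def blackOrientation (c : ZMod 4) : ℤˣ := if c = 0 ∨ c = 2 then 1 else -1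

/-- The orientation of the half-edges. -/
def orientation (ε : I → ℤˣ) : I ⊕ Fin r × ZMod 4 → ℤˣ
  | Sum.inl i => ε i
  | Sum.inr x => blackOrientation x.2

variable (w : Fin r → I × I)

theorem hold_succ (k : Fin r) (i : I) : hold w (k + 1) i =
    if i = (w k).1 then Sum.inr (k, 0) else if i = (w k).2 then Sum.inr (k, 2)
    else hold w k i := by
  rw [hold, dif_pos k.2]

theorem outLabel_hold (s : ℕ) (i : I) : outLabel w (hold w s i) = i := by
  induction s with
  | zero => rfl
  | succ s ih =>
    rw [hold]
    split_ifs with h1 h2 h3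
    · simp [outLabel, h2]
    · have : (2 : ZMod 4) ≠ 0 := by decide
      simp [outLabel, h3, this]
    · exact ih
    · exact ih

theorem orientation_hold {ε : I → ℤˣ} (s : ℕ) {i : I} (hi : ε i = 1) :
    orientation ε (hold w s i) = 1 := by
  induction s with
  | zero => exact hi
  | succ s ih =>
    rw [hold]
    split_ifs with h1 h2 h3
    · exact (by decide : blackOrientation 0 = 1)
    · exact (by decide : blackOrientation 2 = 1)
    · exact ih
    · exact ih

theorem startTime_hold_le (s : ℕ) (i : I) : startTime (hold w s i) ≤ s := by
  induction s with
  | zero => exact le_rfl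
  | succ s ih =>
    rw [hold]
    split_ifs with h1 h2 h3
    · exact le_rfl
    · exact le_rfl
    · omega
    · omega

theorem startTime_hold_mono (i : I) {s s' : ℕ} (h : s ≤ s') :
    startTime (hold w s i) ≤ startTime (hold w s' i) := by
  induction h with
  | refl => exact le_rfl
  | @step m hm ih =>
    refine ih.trans ?_
    have := startTime_hold_le w m i
    rw [hold]
    split_ifs with h1 h2 h3
    · exact this.trans (Nat.le_succ _)
    · exact this.trans (Nat.le_succ _)
    · exact le_rfl
    · exact le_rfl

/-- A strand that enters the black vertex `k` is not present afterwards. -/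
theorem le_of_hold_eq {k : Fin r} {i i' : I} {s : ℕ} (hi : i = (w k).1 ∨ i = (w k).2)
    (h : hold w s i' = hold w k i) : s ≤ k ∧ i' = i := by
  have hii : i' = i := by rw [← outLabel_hold w s i', h, outLabel_hold]
  refine ⟨?_, hii⟩
  by_contra hlt
  rw [not_le] at hlt
  have h1 := startTime_hold_mono w i (Nat.succ_le_of_lt hlt)
  rw [← hii, h, hii, Nat.succ_eq_add_one, hold_succ] at h1
  have h2 := startTime_hold_le w k i
  have h3 : (k : ℕ) + 1 ≤ startTime (hold w k i) := by
    rcases hi with hi | hi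
    · rw [if_pos hi] at h1; exact h1
    · by_cases hi' : i = (w k).1
      · rw [if_pos hi'] at h1; exact h1
      · rw [if_neg hi', if_pos hi] at h1; exact h1
  omega

/-- The strand that arrives at an ingoing half-edge. -/
def arriving (π : Equiv.Perm I) : I ⊕ Fin r × ZMod 4 → I ⊕ Fin r × ZMod 4
  | Sum.inl j => hold w r (π j)
  | Sum.inr x => hold w x.1 (if x.2 = 1 then (w x.1).1 else (w x.1).2)

/-- A strand that enters a black vertex is replaced there and cannot arrive elsewhere later.
Half-edges 0 and 2 are outgoing; 1 and 3 receive the labels which leave through 0 and 2. -/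
theorem arriving_injOn {ε : I → ℤˣ} (hw : ∀ k, (w k).1 ≠ (w k).2) (π : Equiv.Perm I) :
    Set.InjOn (arriving w π) {h | orientation ε h = -1} := by
  have hmem : ∀ x : Fin r × ZMod 4, (if x.2 = 1 then (w x.1).1 else (w x.1).2) = (w x.1).1 ∨
      (if x.2 = 1 then (w x.1).1 else (w x.1).2) = (w x.1).2 := by
    intro x; split_ifs <;> simp
  have hor : ∀ k c, orientation ε (Sum.inr (k, c) : I ⊕ Fin r × ZMod 4) = -1 →
      c = 1 ∨ c = 3 := by
    intro k c h
    have h0 : ∀ c : ZMod 4, blackOrientation c = -1 → c = 1 ∨ c = 3 := by decide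
    exact h0 c h
  rintro (j | ⟨k, c⟩) hx (j' | ⟨k', c'⟩) hy h
  · have h1 := congrArg (outLabel w) h
    simp only [arriving, outLabel_hold] at h1
    rw [π.injective h1]
  · exact absurd (le_of_hold_eq w (hmem (k', c')) h).1 (not_le.2 k'.2)
  · exact absurd (le_of_hold_eq w (hmem (k, c)) h.symm).1 (not_le.2 k.2)
  · have h1 := le_of_hold_eq w (hmem (k', c')) h
    have h2 := le_of_hold_eq w (hmem (k, c)) h.symm
    obtain rfl : k = k' := le_antisymm h1.1 h2.1
    have h3 := h1.2
    rcases hor k c hx with rfl | rfl <;> rcases hor k c' hy with rfl | rfl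
    · rfl
    · exact absurd h3 (by simpa [show (3 : ZMod 4) ≠ 1 by decide] using hw k)
    · exact absurd h3 (by simpa [show (3 : ZMod 4) ≠ 1 by decide] using (hw k).symm)
    · rfl

theorem orientation_succ (ε : I → ℤˣ) (k : Fin r) (c : ZMod 4) :
    orientation ε (Sum.inr (k, c + 1) : I ⊕ Fin r × ZMod 4) =
      -orientation ε (Sum.inr (k, c) : I ⊕ Fin r × ZMod 4) := by
  have h0 : ∀ c : ZMod 4, blackOrientation (c + 1) = -blackOrientation c := by decide
  exact h0 c

variable {w} [Fintype I] {ε : I → ℤˣ} {T : Equiv.Perm I}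

theorem bijective_arriving (hw : ∀ k, (w k).1 ≠ (w k).2)
    (hε : ∀ k, ε (w k).1 = 1 ∧ ε (w k).2 = 1) (hT : ∀ i, ε (T i) = -ε i) {π : Equiv.Perm I}
    (hπ : ∀ i, ε i = -1 → ε (π i) = 1) :
    ∃ e : {h : I ⊕ Fin r × ZMod 4 // orientation ε h = -1} ≃
      {h : I ⊕ Fin r × ZMod 4 // orientation ε h = 1}, ∀ h, (e h).1 = arriving w π h.1 := by
  have hmaps : ∀ h : {h : I ⊕ Fin r × ZMod 4 // orientation ε h = -1},
      orientation ε (arriving w π h.1) = 1 := by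
    rintro ⟨j | ⟨k, c⟩, hh⟩
    · exact orientation_hold w r (hπ j hh)
    · refine orientation_hold w k ?_
      split_ifs
      · exact (hε k).1
      · exact (hε k).2
  let f : {h : I ⊕ Fin r × ZMod 4 // orientation ε h = -1} →
      {h : I ⊕ Fin r × ZMod 4 // orientation ε h = 1} := fun h => ⟨arriving w π h.1, hmaps h⟩
  have hinj : Function.Injective f := fun x y hxy =>
    Subtype.ext (arriving_injOn w hw π x.2 y.2 (congrArg Subtype.val hxy))
  -- The matching on white half-edges and a quarter turn at black vertices reverse orientations, so
  -- there are as many ingoing as outgoing half-edges and injectivity suffices.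
  let g₀ : I ⊕ Fin r × ZMod 4 → I ⊕ Fin r × ZMod 4 := Sum.map T fun x => (x.1, x.2 + 1)
  have hg₀ : Function.Injective g₀ := by
    refine Function.Injective.sumMap T.injective ?_
    rintro ⟨k, c⟩ ⟨k', c'⟩ h
    simpa using h
  have hg : ∀ h, orientation ε (g₀ h) = -orientation ε h := by
    rintro (i | ⟨k, c⟩)
    · exact hT i
    · exact orientation_succ ε k c
  have hcard : Nat.card {h : I ⊕ Fin r × ZMod 4 // orientation ε h = 1} ≤
      Nat.card {h : I ⊕ Fin r × ZMod 4 // orientation ε h = -1} :=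
    Nat.card_le_card_of_injective (fun h => ⟨g₀ h.1, by rw [hg, h.2]⟩)
      fun x y hxy => Subtype.ext (hg₀ (congrArg Subtype.val hxy))
  exact ⟨Equiv.ofBijective f (hinj.bijective_of_nat_card_le hcard), fun h => rfl⟩

/-- The existence of a map with given transpositions and matching. -/
theorem exists_map (hw : ∀ k, (w k).1 ≠ (w k).2)
    (hε : ∀ k, ε (w k).1 = 1 ∧ ε (w k).2 = 1) (hT : ∀ i, ε (T i) = -ε i) (ρ π : Equiv.Perm I)
    (hπ : ∀ i, ε i = -1 → ε (π i) = 1) :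
    ∃ C : UnitaryMap I r, C.ε = orientation ε ∧ (∀ i, C.σ (Sum.inl i) = Sum.inl (ρ i)) ∧
      ∀ h, orientation ε h = -1 → C.α h = arriving w π h := by
  classical
  obtain ⟨e, he⟩ := bijective_arriving hw hε hT hπ
  have hpos : ∀ h : I ⊕ Fin r × ZMod 4, ¬ orientation ε h = -1 → orientation ε h = 1 :=
    fun h hh => (Int.units_eq_one_or _).resolve_right hh
  let α₀ : I ⊕ Fin r × ZMod 4 → I ⊕ Fin r × ZMod 4 := fun h =>
    if hh : orientation ε h = -1 then (e ⟨h, hh⟩).1 else (e.symm ⟨h, hpos h hh⟩).1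
  have hin : ∀ h (hh : orientation ε h = -1), α₀ h = (e ⟨h, hh⟩).1 := fun h hh => dif_pos hh
  have hout : ∀ h (hh : orientation ε h = 1), α₀ h = (e.symm ⟨h, hh⟩).1 := fun h hh =>
    dif_neg (by rw [hh]; exact units_neg_one_ne_one.symm)
  have hinv : Function.Involutive α₀ := by
    intro h
    rcases Int.units_eq_one_or (orientation ε h) with hh | hh
    · rw [hout h hh, hin _ (e.symm ⟨h, hh⟩).2, Subtype.coe_eta, Equiv.apply_symm_apply]
    · rw [hin h hh, hout _ (e ⟨h, hh⟩).2, Subtype.coe_eta, Equiv.symm_apply_apply]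
  have hεα : ∀ h, orientation ε (α₀ h) = -orientation ε h := by
    intro h
    rcases Int.units_eq_one_or (orientation ε h) with hh | hh
    · rw [hout h hh, hh]; exact (e.symm ⟨h, hh⟩).2
    · rw [hin h hh, hh, neg_neg]; exact (e ⟨h, hh⟩).2
  let rot : Equiv.Perm (Fin r × ZMod 4) :=
    ⟨fun x => (x.1, x.2 + 1), fun x => (x.1, x.2 - 1), fun x => by simp, fun x => by simp⟩
  refine ⟨{ σ := Equiv.sumCongr ρ rot
            α := hinv.toPerm
            ε := orientation ε
            α_α := hinv
            ε_α := hεα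
            σ_black := fun k c => rfl
            alternated := orientation_succ ε
            increasing := ?_ }, rfl, fun i => rfl, fun h hh => ?_⟩
  · intro k c k' c' h1 h2
    have h2' : α₀ (Sum.inr (k, c)) = Sum.inr (k', c') := h2
    have h3 : orientation ε (Sum.inr (k', c') : I ⊕ Fin r × ZMod 4) = -1 := by
      rw [← h2', hεα, h1]
    have h4 : (Sum.inr (k, c) : I ⊕ Fin r × ZMod 4) = arriving w π (Sum.inr (k', c')) := by
      rw [← he ⟨_, h3⟩, ← hin _ h3, ← h2', hinv]
    -- The strand starting at the black vertex `k` has start time `k + 1`, so the bound by `k'`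
    -- gives `k < k'`.
    have h5 := startTime_hold_le w k' (if c' = 1 then (w k').1 else (w k').2)
    change startTime (arriving w π (Sum.inr (k', c'))) ≤ k' at h5
    rw [← h4] at h5
    exact h5
  · change α₀ h = _
    rw [hin h hh, he]

end Construction

section Existence

variable {I : Type*} {r : ℕ} [LinearOrder I] [Fintype I] {w : Fin r → I × I} {ε : I → ℤˣ}
  {T : Equiv.Perm I}

/-- An ingoing white half-edge must face the image of its partner under the product of the
transpositions, so the final strands are connected by `(wordProd w).perm * T`. -/
theorem exists_data (hw : ∀ k, (w k).1 < (w k).2) (hε : ∀ k, ε (w k).1 = 1 ∧ ε (w k).2 = 1)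
    (hT : ∀ i, ε (T i) = -ε i) (hTT : ∀ i, T (T i) = i) (ρ : Equiv.Perm I) :
    ∃ C : UnitaryMap I r, C.whiteε = ε ∧ C.whiteρ = ρ ∧ C.outPair = w ∧ C.matching = T := by
  have hsupp : (wordProd w).SuppIn {i | ε i = 1} := suppIn_partialProd hε r
  obtain ⟨C, h1, h2, h3⟩ := exists_map (fun k => (hw k).ne) hε hT ρ
    ((wordProd w).perm * T) fun i hi =>
      hsupp.perm_mem (show ε (T i) = 1 by rw [hT, hi, neg_neg])
  have hwε : C.whiteε = ε := funext fun i => by rw [whiteε, h1]; rfl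
  have hwρ : C.whiteρ = ρ := Equiv.ext fun i =>
    Sum.inl_injective (β := Fin r × ZMod 4) (by rw [← σ_inl_eq, h2])
  have hlab : ∀ s i, ε i = 1 → C.label (hold w s i) = i := by
    intro s
    induction s with
    | zero => exact fun i _ => C.label_inl i
    | succ s ih =>
      intro i hi
      rw [hold]
      split_ifs with hs h5 h6
      · rw [label_black, h3 (Sum.inr (⟨s, hs⟩, 0 + 1)) (by decide : blackOrientation (0 + 1) = -1)]
        have : arriving w ((wordProd w).perm * T) (Sum.inr (⟨s, hs⟩, 0 + 1)) =
            hold w s (w ⟨s, hs⟩).1 := by simp [arriving]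
        rw [this, ih _ (hε _).1, h5]
      · rw [label_black, h3 (Sum.inr (⟨s, hs⟩, 2 + 1)) (by decide : blackOrientation (2 + 1) = -1)]
        have : arriving w ((wordProd w).perm * T) (Sum.inr (⟨s, hs⟩, 2 + 1)) =
            hold w s (w ⟨s, hs⟩).2 := by
          simp [arriving, show (2 + 1 : ZMod 4) ≠ 1 by decide]
        rw [this, ih _ (hε _).2, h6]
      · exact ih i hi
      · exact ih i hi
  have hout : C.outPair = w := funext fun k => by
    rw [C.outPair_eq (c := 0) (by rw [h1]; rfl)]
    have e1 := hlab (k + 1) _ (hε k).1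
    have e2 := hlab (k + 1) _ (hε k).2
    rw [hold_succ, if_pos rfl] at e1
    rw [hold_succ, if_neg (hw k).ne', if_pos rfl] at e2
    rw [e1, zero_add, e2, min_eq_left (hw k).le, max_eq_right (hw k).le]
  have hneg : ∀ j, ε j = -1 → C.matching j = T j := by
    intro j hj
    apply (wordProd C.outPair).perm.injective
    rw [wordProd_matching, facing, h3 (Sum.inl j) hj, hout, arriving, hlab, Equiv.Perm.mul_apply]
    exact hsupp.perm_mem (show ε (T j) = 1 by rw [hT, hj, neg_neg])
  refine ⟨C, hwε, hwρ, hout, Equiv.ext fun i => ?_⟩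
  -- Both matchings are involutions exchanging the two signs, so agreement on the ingoing labels is
  -- enough.
  rcases Int.units_eq_one_or (ε i) with hi | hi
  · have h5 := hneg (T i) (by rw [hT, hi])
    rw [hTT] at h5
    rw [← h5, C.matching_matching, h5]
  · exact hneg i hi

end Existence

end UnitaryMap

end

noncomputable section

/-! ## Monotone sequences of transpositions -/

section MonoWords

variable {I : Type*} [LinearOrder I] [Fintype I]

open Classical in
/-- The sequences of `r` transpositions of elements of `S`, with nondecreasing largest elements. -/
def monoWords (r : ℕ) (S : Finset I) : Finset (Fin r → I × I) :=
  Finset.univ.filter fun w =>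
    (∀ k, (w k).1 ∈ S ∧ (w k).2 ∈ S ∧ (w k).1 < (w k).2) ∧ Monotone fun k => (w k).2

theorem mem_monoWords {r : ℕ} {S : Finset I} {w : Fin r → I × I} : w ∈ monoWords r S ↔
    (∀ k, (w k).1 ∈ S ∧ (w k).2 ∈ S ∧ (w k).1 < (w k).2) ∧ Monotone fun k => (w k).2 := by
  simp [monoWords]

theorem partialProd_init {r : ℕ} (w : Fin (r + 1) → I × I) {s : ℕ} (hs : s ≤ r) :
    partialProd w s = partialProd (Fin.init w : Fin r → I × I) s := by
  induction s with
  | zero => rfl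
  | succ s ih =>
    rw [partialProd, partialProd, ih (by omega), stepSwap, stepSwap, dif_pos (by omega),
      dif_pos (by omega)]
    rfl

theorem wordProd_succ {r : ℕ} (w : Fin (r + 1) → I × I) :
    wordProd w = PartPerm.swap (w (Fin.last r)).1 (w (Fin.last r)).2 *
      wordProd (Fin.init w : Fin r → I × I) := by
  have := partialProd_succ w (Fin.last r)
  rw [Fin.val_last, partialProd_init w le_rfl] at this
  exact this

/-- By monotonicity the top `d` is used by some transposition only if it is the largest element of
the last one. Removing this last transposition gives the recursion of `monoSum`. -/
theorem sum_monoWords {L : List I} (hL : L.Pairwise (· > ·)) (r : ℕ) (F : PartPerm I → ℂ) :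
    ∑ w ∈ monoWords r L.toFinset, F (wordProd w) = monoSum r L F := by
  classical
  induction r, L using monoSum_induction generalizing F with
  | zero L =>
    have : monoWords 0 L.toFinset = Finset.univ := by
      ext w
      simp only [mem_monoWords, Finset.mem_univ, iff_true]
      exact ⟨fun k => k.elim0, fun k => k.elim0⟩
    rw [this, monoSum_zero, Fintype.sum_unique]
    rfl
  | nil r =>
    have : monoWords (r + 1) ([] : List I).toFinset = ∅ := by
      ext w
      simp only [mem_monoWords, Finset.notMem_empty, iff_false]
      intro h
      exact absurd (h.1 0).1 (by simp)
    rw [this, monoSum_nil, Finset.sum_empty]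
  | cons r d L ih1 ih2 =>
    have hd := List.pairwise_cons.1 hL
    rw [monoSum_cons, ← ih1 hd.2,
      ← Finset.sum_filter_add_sum_filter_not _ fun w => (w (Fin.last r)).2 = d, add_comm]
    congr 1
    · refine Finset.sum_congr ?_ fun _ _ => rfl
      ext w
      simp only [Finset.mem_filter, mem_monoWords, List.mem_toFinset, List.mem_cons]
      constructor
      · rintro ⟨⟨h1, h2⟩, h3⟩
        have hlast : (w (Fin.last r)).2 < d := by
          rcases (h1 (Fin.last r)).2.1 with h | h
          · exact absurd h h3
          · exact hd.1 _ h
        have hlt : ∀ k, (w k).2 < d := fun k => (h2 (Fin.le_last k)).trans_lt hlast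
        exact ⟨fun k => ⟨(h1 k).1.resolve_left ((h1 k).2.2.trans (hlt k)).ne,
          (h1 k).2.1.resolve_left (hlt k).ne, (h1 k).2.2⟩, h2⟩
      · rintro ⟨h1, h2⟩
        exact ⟨⟨fun k => ⟨Or.inr (h1 k).1, Or.inr (h1 k).2.1, (h1 k).2.2⟩, h2⟩,
          (hd.1 _ (h1 (Fin.last r)).2.1).ne⟩
    · have h2 : ∀ y, monoSum r (d :: L) (fun a => F (PartPerm.swap y d * a)) =
          ∑ w ∈ monoWords r (d :: L).toFinset, F (PartPerm.swap y d * wordProd w) :=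
        fun y => (ih2 hL _).symm
      simp only [h2]
      rw [← Finset.sum_product']
      refine Finset.sum_bij' (fun w _ => ((w (Fin.last r)).1, (Fin.init w : Fin r → I × I)))
        (fun q _ => (Fin.snoc q.2 (q.1, d) : Fin (r + 1) → I × I)) ?_ ?_ ?_ ?_ ?_
      · intro w hw
        simp only [Finset.mem_filter, mem_monoWords, List.mem_toFinset, List.mem_cons,
          Finset.mem_product] at hw ⊢
        obtain ⟨⟨h1, h2⟩, h3⟩ := hw
        refine ⟨(h1 (Fin.last r)).1.resolve_left ?_, fun k => h1 k.castSucc, fun k k' hk =>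
          h2 (Fin.castSucc_le_castSucc_iff.2 hk)⟩
        have := (h1 (Fin.last r)).2.2
        rw [h3] at this
        exact this.ne
      · rintro ⟨y, w⟩ hw
        simp only [Finset.mem_filter, mem_monoWords, List.mem_toFinset, List.mem_cons,
          Finset.mem_product, Fin.snoc_last, and_true] at hw ⊢
        obtain ⟨hy, h1, h2⟩ := hw
        have hle : ∀ k, (w k).2 ≤ d := fun k => by
          rcases (h1 k).2.1 with h | h
          · exact h.le
          · exact (hd.1 _ h).le
        constructor
        · intro k
          refine Fin.lastCases ?_ (fun k => ?_) k
          · simp only [Fin.snoc_last]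
            exact ⟨Or.inr hy, Or.inl trivial, hd.1 _ hy⟩
          · simp only [Fin.snoc_castSucc]
            exact h1 k
        · intro k k'
          refine Fin.lastCases (fun hk => ?_) (fun k' hk => ?_) k'
          · refine Fin.lastCases ?_ (fun k => ?_) k
            · exact le_rfl
            · simp only [Fin.snoc_last, Fin.snoc_castSucc]
              exact hle k
          · revert hk
            refine Fin.lastCases (fun hk => ?_) (fun k hk => ?_) k
            · exact absurd hk (not_le.2 (Fin.castSucc_lt_last k'))
            · simp only [Fin.snoc_castSucc]
              exact h2 (Fin.castSucc_le_castSucc_iff.1 hk)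
      · intro w hw
        simp only [Finset.mem_filter] at hw
        have : ((w (Fin.last r)).1, d) = w (Fin.last r) := Prod.ext rfl hw.2.symm
        simp only [this]
        exact Fin.snoc_init_self w
      · rintro ⟨y, w⟩ hw
        simp [Fin.init_snoc]
      · intro w hw
        simp only [Finset.mem_filter] at hw
        rw [wordProd_succ, hw.2]

theorem sum_monoWords_plusSet (r : ℕ) (S : Finset I) (F : PartPerm I → ℂ) :
    ∑ w ∈ monoWords r S, F (wordProd w) = monoSum r S.toList F := by
  have h1 : (S.sort (· ≥ ·)).Pairwise (· > ·) := S.sortedGT_sort.pairwise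
  rw [monoSum_toList (S.sort_nodup (· ≥ ·)) (by simp), ← sum_monoWords h1]
  simp

end MonoWords

/-! ## The sum over the maps of unitary type -/

section SumOverMaps

variable {I : Type*} [LinearOrder I] [Fintype I] {N : ℕ}

/-- A matching exists only if half of the labels are outgoing; thus m = d/2 is the number of
outgoing labels. -/
theorem card_eq_of_mem_matchings {ε : I → ℤˣ} {T : Equiv.Perm I}
    (hT : T ∈ matchings fun i => Word.unitSign (ε i)) :
    Fintype.card I = 2 * (plusSet fun i => Word.unitSign (ε i)).card := by
  obtain ⟨-, h2⟩ := UnitaryMap.mem_matchings_unitSign.1 hT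
  have h : (Finset.univ.filter fun i => ¬ ε i = 1).card =
      (Finset.univ.filter fun i => ε i = 1).card := by
    refine Finset.card_equiv T fun i => ?_
    simp only [Finset.mem_filter, Finset.mem_univ, true_and, h2]
    generalize ε i = e
    revert e; decide
  have h' : (plusSet fun i => Word.unitSign (ε i)) = Finset.univ.filter fun i => ε i = 1 := by
    ext i; simp [UnitaryMap.unitSign_eq_one]
  have := Finset.card_filter_add_card_filter_not (s := Finset.univ) fun i => ε i = 1
  rw [h, ← h', Finset.card_univ] at this
  omega

open Classical in
/-- The data of the connected maps with `r` black vertices. -/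
def mapData (r : ℕ) (g : ℤ) (ε : I → ℤˣ) (γ : Equiv.Perm I) :
    Finset ((Fin r → I × I) × Equiv.Perm I) :=
  (monoWords r (plusSet fun i => Word.unitSign (ε i)) ×ˢ
    matchings fun i => Word.unitSign (ε i)).filter fun x =>
    orb γ ⊔ orb x.2 ⊔ (wordProd x.1).part = ⊤ ∧
      eulerChar r γ (fun i => Word.unitSign (ε i)) x.2 (wordProd x.1) = 2 - 2 * g

theorem mem_mapData {r : ℕ} {g : ℤ} {ε : I → ℤˣ} {γ : Equiv.Perm I}
    {x : (Fin r → I × I) × Equiv.Perm I} : x ∈ mapData r g ε γ ↔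
      (x.1 ∈ monoWords r (plusSet fun i => Word.unitSign (ε i)) ∧
        x.2 ∈ matchings fun i => Word.unitSign (ε i)) ∧
      orb γ ⊔ orb x.2 ⊔ (wordProd x.1).part = ⊤ ∧
      eulerChar r γ (fun i => Word.unitSign (ε i)) x.2 (wordProd x.1) = 2 - 2 * g := by
  classical
  simp only [mapData, Finset.mem_filter, Finset.mem_product]

theorem sum_mapData (r : ℕ) (g : ℤ) (ε : I → ℤˣ) (γ : Equiv.Perm I)
    (B : I → Matrix (Fin N) (Fin N) ℂ) :
    ∑ x ∈ mapData r g ε γ, faceTrace γ x.2 B (wordProd x.1) =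
      mapCount r (2 - 2 * g) ⊤ γ (fun i => Word.unitSign (ε i)) B := by
  classical
  rw [mapData, Finset.sum_filter, Finset.sum_product_right, mapCount]
  refine Finset.sum_congr rfl fun T _ => ?_
  rw [← sum_monoWords_plusSet]

/-- The data of a map of unitary type. -/
def UnitaryMapClass.data (C : UnitaryMapClass I) : Σ r : ℕ, (Fin r → I × I) × Equiv.Perm I :=
  ⟨C.1, C.rep.outPair, C.rep.matching⟩

/-- Injectivity is `iso_of_data_eq` and surjectivity is `exists_data`; the other conditions
translate by `nondecreasing_iff`, `connected_iff` and `hasGenus_iff`. -/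
theorem bijOn_data [Nonempty I] (g : ℤ) (ε : I → ℤˣ) (γ : Equiv.Perm I) :
    Set.BijOn UnitaryMapClass.data (connectedMaps g ε γ⁻¹) {x | x.2 ∈ mapData x.1 g ε γ} := by
  refine ⟨?_, ?_, ?_⟩
  · rintro C ⟨h1, h2, h3, h4, h5⟩
    change (C.rep.outPair, C.rep.matching) ∈ mapData C.1 g ε γ
    rw [mem_mapData, ← h4]
    refine ⟨⟨mem_monoWords.2 ⟨fun k => ?_, C.rep.nondecreasing_iff.1 h1⟩, C.rep.matching_mem⟩,
      ?_, (C.rep.hasGenus_iff h2 h5 g).1 h3⟩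
    · simp only [mem_plusSet, UnitaryMap.unitSign_eq_one]
      exact ⟨(C.rep.ε_outPair k).1, (C.rep.ε_outPair k).2, C.rep.outPair_lt k⟩
    · have := C.rep.connected_iff.1 h2
      rwa [h5, orb_inv] at this
  · rintro ⟨r, C⟩ ⟨-, -, -, h4, h5⟩ ⟨r', C'⟩ ⟨-, -, -, h4', h5'⟩ h
    obtain rfl : r = r' := congrArg Sigma.fst h
    have h6 := eq_of_heq (Sigma.mk.inj h).2
    have h7 : UnitaryMap.Iso (Quotient.out C) (Quotient.out C') :=
      UnitaryMap.iso_of_data_eq (h4.trans h4'.symm) (h5.trans h5'.symm)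
        (congrArg Prod.fst h6) (congrArg Prod.snd h6)
    congr 1
    rw [← Quotient.out_eq C, ← Quotient.out_eq C']
    exact Quotient.sound h7
  · rintro ⟨r, w, T⟩ h
    change (w, T) ∈ mapData r g ε γ at h
    rw [mem_mapData] at h
    obtain ⟨⟨hw, hT⟩, hconn, hχ⟩ := h
    rw [mem_monoWords] at hw
    obtain ⟨hTT, hTε⟩ := UnitaryMap.mem_matchings_unitSign.1 hT
    simp only [mem_plusSet, UnitaryMap.unitSign_eq_one] at hw
    obtain ⟨C₀, e1, e2, e3, e4⟩ := UnitaryMap.exists_data (fun k => (hw.1 k).2.2)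
      (fun k => ⟨(hw.1 k).1, (hw.1 k).2.1⟩) hTε hTT γ⁻¹
    let C : UnitaryMapClass I := ⟨r, Quotient.mk _ C₀⟩
    have hiso : UnitaryMap.Iso C₀ C.rep :=
      UnitaryMap.iso_equivalence.symm (Quotient.exact (Quotient.out_eq C.2))
    obtain ⟨f1, f2, f3, f4, -⟩ := hiso.data_eq
    rw [e1] at f1
    rw [e2] at f2
    rw [e3] at f3
    rw [e4] at f4
    have hC : C.rep.Connected := by
      rw [UnitaryMap.connected_iff, f2, f3, f4, orb_inv]; exact hconn
    refine ⟨C, ⟨?_, hC, ?_, f1, f2⟩, ?_⟩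
    · rw [UnitaryMap.nondecreasing_iff, f3]; exact hw.2
    · rw [C.rep.hasGenus_iff hC f2, f1, f3, f4]; exact hχ
    · rw [UnitaryMapClass.data, f3, f4]

theorem lt_of_mem_mapData {r : ℕ} {g : ℤ} {ε : I → ℤˣ} {γ : Equiv.Perm I}
    {x : (Fin r → I × I) × Equiv.Perm I} (hx : x ∈ mapData r g ε γ) :
    (r : ℤ) ≤ 2 * Fintype.card I - (2 - 2 * g) := by
  have h := (mem_mapData.1 hx).2.2
  rw [eulerChar] at h
  have h1 := numCycles_le_card γ
  have h2 := numCycles_le_card ((wordProd x.1).perm * x.2 * γ⁻¹)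
  zify at h1 h2
  have h3 : (0 : ℤ) ≤ (plusSet fun i => Word.unitSign (ε i)).card := Int.natCast_nonneg _
  linarith

theorem sum_connectedMaps [Nonempty I] (g : ℤ) (ε : I → ℤˣ) (γ : Equiv.Perm I)
    (B : I → Matrix (Fin N) (Fin N) ℂ) :
    (-1) ^ (Fintype.card I / 2 + numCycles γ) *
      ∑ᶠ C ∈ connectedMaps g ε γ⁻¹, (-1) ^ numCycles C.rep.whiteφ * ntrPerm C.rep.whiteφ B =
    ∑' r : ℕ, (-1) ^ r * mapCount r (2 - 2 * g) ⊤ γ (fun i => Word.unitSign (ε i)) B := by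
  classical
  -- There are at most |I| vertices of γ and |I| faces, which bounds the number of black vertices
  -- and makes both sums finite.
  set R := (2 * (Fintype.card I : ℤ) - (2 - 2 * g)).toNat + 1 with hR
  have hset : {x : Σ r : ℕ, (Fin r → I × I) × Equiv.Perm I | x.2 ∈ mapData x.1 g ε γ} =
      ↑((Finset.range R).sigma fun r => mapData r g ε γ) := by
    ext x
    simp only [Set.mem_ofPred_eq, Finset.mem_coe, Finset.mem_sigma, Finset.mem_range,
      iff_and_self]
    intro hx
    have := lt_of_mem_mapData hx
    omega
  have hbij := bijOn_data g ε γ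
  rw [hset] at hbij
  rw [finsum_mem_eq_of_bijOn (g := fun x : Σ r : ℕ, (Fin r → I × I) × Equiv.Perm I =>
    (-1 : ℂ) ^ numCycles ((wordProd x.2.1).perm * x.2.2 * γ⁻¹)⁻¹ *
      faceTrace γ x.2.2 B (wordProd x.2.1)) _ hbij, finsum_mem_coe_finset, Finset.sum_sigma,
    tsum_eq_sum (s := Finset.range R), Finset.mul_sum]
  · refine Finset.sum_congr rfl fun r _ => ?_
    rw [← sum_mapData, Finset.mul_sum, Finset.mul_sum]
    refine Finset.sum_congr rfl fun x hx => ?_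
    obtain ⟨⟨-, hT⟩, -, hχ⟩ := mem_mapData.1 hx
    rw [← mul_assoc]
    congr 1
    rw [eulerChar] at hχ
    rw [card_eq_of_mem_matchings hT, Nat.mul_div_cancel_left _ two_pos, numCycles_inv, ← pow_add]
    set a := (plusSet fun i => Word.unitSign (ε i)).card
    set b := numCycles γ
    set c := numCycles ((wordProd x.1).perm * x.2 * γ⁻¹)
    -- Since b + c − a − r = 2 − 2g, the sign of the definition, with exponent a + b + c, equals
    -- (−1)^r.
    have : Even ((a + b + c + r : ℕ) : ℤ) := ⟨a + r + 1 - g, by push_cast; linarith⟩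
    have h2 : Even (a + b + c + r) := by exact_mod_cast this
    have h3 := h2.neg_one_pow (α := ℂ)
    rw [pow_add] at h3
    have h4 : ((-1 : ℂ) ^ r) * (-1) ^ r = 1 := by
      rw [← mul_pow]; simp
    calc (-1 : ℂ) ^ (a + b + c) = (-1) ^ (a + b + c) * ((-1) ^ r * (-1) ^ r) := by rw [h4, mul_one]
      _ = (-1) ^ r := by rw [← mul_assoc, h3, one_mul]
  · intro r hr
    rw [mapCount_eq_zero_of_lt, mul_zero]
    rw [Finset.mem_range, not_lt] at hr
    omega
  · rintro C ⟨-, -, -, -, h5⟩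
    have h6 := C.rep.whiteφ_inv
    rw [h5] at h6
    have h7 : C.rep.whiteφ = ((wordProd C.rep.outPair).perm * C.rep.matching * γ⁻¹)⁻¹ := by
      rw [← h6, inv_inv]
    rw [h7]
    rfl

end SumOverMaps

end

noncomputable section

/-! ## Comparison with the sums over maps of unitary type -/

section Comparison

variable {p N : ℕ} (A : Fin p → Matrix (Fin N) (Fin N) ℂ)

theorem isRep_gammaPerm (L : List (Word p)) :
    IsRep (gammaPerm L) fun i : Fin L.length =>
      List.ofFn fun j : Fin (degs L i) => (finSigmaFinEquiv ⟨i, j⟩ : Labels L) where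
  rot i := by
    rw [List.map_ofFn, ← ofFn_finRotate fun j : Fin (degs L i) =>
      (finSigmaFinEquiv ⟨i, j⟩ : Labels L)]
    congr 1
    ext1 j
    simp [gammaPerm, Equiv.permCongr_apply]
  nodup i := List.nodup_ofFn.2 fun j j' h => by
    have := finSigmaFinEquiv.injective h
    simpa using this
  uniq i i' x hx hx' := by
    rw [List.mem_ofFn] at hx hx'
    obtain ⟨j, rfl⟩ := hx
    obtain ⟨j', h⟩ := hx'
    exact (congrArg Sigma.fst (finSigmaFinEquiv.injective h)).symm
  cover x := by
    refine ⟨(finSigmaFinEquiv.symm x).1, ?_⟩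
    rw [List.mem_ofFn]
    exact ⟨(finSigmaFinEquiv.symm x).2, by simp⟩

theorem map_gammaPerm (L : List (Word p)) (i : Fin L.length) :
    (List.ofFn fun j : Fin (degs L i) => (finSigmaFinEquiv ⟨i, j⟩ : Labels L)).map
      (fun k => ((factor L k).1.eval A, Word.unitSign (factor L k).2)) =
    (L.get i).blocks.map (Word.evalBlock A) := by
  rw [List.map_ofFn]
  have : ∀ j : Fin (degs L i), factor L (finSigmaFinEquiv ⟨i, j⟩) = (L.get i).blocks.get j := by
    intro j
    rw [factor, Equiv.symm_apply_apply]
  refine List.ext_getElem (by simp [degs]) fun k hk hk' => ?_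
  rw [List.getElem_ofFn, List.getElem_map]
  simp only [Function.comp_apply, this, Word.evalBlock]
  rfl

theorem mapSumPos_eq (g : ℤ) {L : List (Word p)} (hL : L ≠ []) (h : ∀ w ∈ L, 0 < w.degree) :
    mapSumPos A g L = listSum A g L := by
  have hdeg : ∀ i, 0 < degs L i := fun i => by
    rw [degs, Word.length_blocks]; exact h _ (List.get_mem _ _)
  have hrep := isRep_gammaPerm L
  have i₀ : Fin L.length := ⟨0, List.length_pos_of_ne_nil hL⟩
  have : Nonempty (Labels L) := ⟨finSigmaFinEquiv ⟨i₀, ⟨0, hdeg i₀⟩⟩⟩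
  have hc : numCycles (gammaPerm L) = L.length := by
    rw [hrep.numCycles_eq, Nat.card_fin]
    intro i hi
    have := congrArg List.length hi
    rw [List.length_ofFn] at this
    exact (hdeg i).ne' this
  have key := sum_connectedMaps g (fun k => (factor L k).2) (gammaPerm L)
    fun k => (factor L k).1.eval A
  rw [hc, Fintype.card_fin] at key
  rw [mapSumPos, key, listSum, monomialSum, wordSum_congr fun i =>
    Word.cyclic_cycEquiv_blocks A (h _ (List.get_mem L i)), wordSum]
  refine tsum_congr fun r => ?_
  rw [wordCount_eq hrep (map_gammaPerm A L)]

/-- The special cases of `mapSum` agree with the general count: the genus cannot be negative, and a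
monomial of degree 0 is an isolated vertex, which contributes its trace when alone and otherwise
prevents connectedness. -/
theorem mapSum_eq (g : ℤ) {L : List (Word p)} (hL : L ≠ []) : mapSum A g L = listSum A g L := by
  have i₀ : Fin L.length := ⟨0, List.length_pos_of_ne_nil hL⟩
  unfold mapSum
  by_cases hg : g < 0
  · rw [if_pos (Or.inl hg), listSum, monomialSum, wordSum_of_neg hg (k := i₀)
      (Word.cyclic_ne_nil A _)]
  rw [if_neg (by tauto)]
  by_cases h : ∀ w ∈ L, 0 < w.degree
  · rw [if_pos h, mapSumPos_eq A g hL h]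
  rw [if_neg h]
  push Not at h
  obtain ⟨w, hw, hw0⟩ := h
  rw [Nat.le_zero] at hw0
  obtain ⟨i, hi⟩ := List.get_of_mem hw
  have hiso : ∀ W : Fin L.length → List (SignedMatrix N),
      (∀ k, W k = if k = i then [(w.eval A, 0)] else (L.get k).cyclic A) →
      listSum A g L = wordSum g W := by
    intro W hW
    rw [listSum, monomialSum]
    refine wordSum_congr (fun k => ?_) g
    rw [hW]
    split_ifs with hk
    · rw [hk, hi]; exact Word.cyclic_cycEquiv_of_degree_zero A hw0
    · exact CycEquiv.refl _
  match L, hL with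
  | [w'], _ =>
    have : Unique (Fin [w'].length) := inferInstanceAs (Unique (Fin 1))
    have hi0 : i = 0 := Subsingleton.elim _ _
    subst hi0
    have hww : w' = w := hi
    change (if g = 0 then ntr (w'.eval A) else 0) = _
    rw [hiso (fun _ => [(w.eval A, 0)]) fun k => by rw [if_pos (Subsingleton.elim _ _)], hww,
      ← wordSum_isolated]
    exact (wordSum_reindex (Equiv.ofUnique (Fin [w'].length) Unit)
      (fun _ : Unit => [(w.eval A, 0)]) g).symm
  | w₁ :: w₂ :: L', _ =>
    rw [hiso _ fun k => rfl]
    obtain ⟨k₁, hk₁⟩ := exists_ne i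
    exact (wordSum_of_isolated (w.eval A) (k₀ := i) (k₁ := k₁) hk₁ (if_pos rfl)
      (by rw [if_neg hk₁]; exact Word.cyclic_ne_nil A _) g).symm

end Comparison

end

theorem theorem4p1 {p N : ℕ} (hN : 1 ≤ N) (A : Fin p → Matrix (Fin N) (Fin N) ℂ)
    -- the tuple is `(P 0, …, P (n - 1), Pl u)`, of length `l = n + 1`
    (n : ℕ) (P : Fin n → Word p) (Pl : Word p) (g : ℕ)
    (hdeg : (2 : ℚ) ≤ ((∑ i, (P i).degree + (Pl ++ [Letter.u]).degree : ℕ) : ℚ) / 2) :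
    mapSum A g (List.ofFn P ++ [Pl ++ [Letter.u]]) =
      - (∑ q ∈ Pl.splits Letter.u,
          (mapSum A (g - 1) (List.ofFn P ++ [q.1 ++ [Letter.u], q.2 ++ [Letter.u]]) +
            ∑ h ∈ Finset.HasAntidiagonal.antidiagonal g, ∑ I : Finset (Fin n),
              mapSum A h.1 (restrict P I ++ [q.1 ++ [Letter.u]]) *
                mapSum A h.2 (restrict P Iᶜ ++ [q.2 ++ [Letter.u]])))
      - (∑ j : Fin n, ∑ q ∈ (P j).splits Letter.u,
          mapSum A g (restrict P {j}ᶜ ++ [q.2 ++ q.1 ++ [Letter.u] ++ Pl ++ [Letter.u]]))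
      + (∑ q ∈ Pl.splits Letter.us,
          (mapSum A (g - 1) (List.ofFn P ++ [q.1, q.2]) +
            ∑ h ∈ Finset.HasAntidiagonal.antidiagonal g, ∑ I : Finset (Fin n),
              mapSum A h.1 (restrict P I ++ [q.1]) * mapSum A h.2 (restrict P Iᶜ ++ [q.2])))
      + (∑ j : Fin n, ∑ q ∈ (P j).splits Letter.us,
          mapSum A g (restrict P {j}ᶜ ++ [q.2 ++ q.1 ++ Pl])) := by
  -- All lists in the identity are nonempty, so every sum of maps can be replaced by the signed
  -- count over words.
  have h1 : ∀ (g : ℤ) (l : List (Word p)) (w : Word p),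
      mapSum A g (l ++ [w]) = listSum A g (l ++ [w]) := fun g l w => mapSum_eq A g (by simp)
  have h2 : ∀ (g : ℤ) (l : List (Word p)) (w w' : Word p),
      mapSum A g (l ++ [w, w']) = listSum A g (l ++ [w, w']) :=
    fun g l w w' => mapSum_eq A g (by simp)
  simp only [h1, h2]
  exact listSum_recursion A P Pl g
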